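/- **Setting.** Let $G$ be a compact matrix quantum group, with Hopf $*$-algebra $\mathcal A$ of polynomial functions (a Hopf $*$-algebra generated, as a $*$-algebra, by the matrix elements of a unitary matrix corepresentation), comultiplication $\phi$, counit $\epsilon$ and antipode $\kappa$; write $\phi(a)=a^{(1)}\otimes a^{(2)}$, etc. Let $\mathrm{ad}(a)=a^{(2)}\otimes\kappa(a^{(1)})a^{(3)}$, and let $\mathrm{lie}(G_{cl})$ be the Lie algebra of the classical part of $G$, i.e. the space of hermitian linear functionals $X$ on $\mathcal A$ with $X(ab)=\epsilon(a)X(b)+X(a)\epsilon(b)$. A right ideal $\mathcal R\subseteq\ker\epsilon$ is *admissible* if $(X\otimes\mathrm{id})\,\mathrm{ad}(\mathcal R)=0$ for all $X\in\mathrm{lie}(G_{cl})$. Let $(\Gamma,d)$ be the minimal admissible (bicovariant) first-order differential calculus over $G$, i.e. the bicovariant calculus, with left and right actions $\ell_\Gamma\colon\Gamma\to\mathcal A\otimes\Gamma$ and $\wp_\Gamma\colon\Gamma\to\Gamma\otimes\mathcal A$, whose right ideal $\{a\in\ker\epsilon: \kappa(a^{(1)})\,da^{(2)}=0\}$ is the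 largest admissible one. Let $\Gamma^\otimes=\bigoplus_k\Gamma^{\otimes k}$ be the tensor algebra of the $\mathcal A$-bimodule $\Gamma$, and let $\ell_\Gamma^\otimes\colon\Gamma^\otimes\to\mathcal A\otimes\Gamma^\otimes$ and $\wp_\Gamma^\otimes\colon\Gamma^\otimes\to\Gamma^\otimes\otimes\mathcal A$ be the homomorphisms extending $\phi$ together with $\ell_\Gamma$, respectively $\wp_\Gamma$. Let $\sigma$ be the canonical flip-over automorphism of $\Gamma\otimes_{\mathcal A}\Gamma$: it is left $\mathcal A$-linear, and on left-invariant elements $\sigma(\eta\otimes\vartheta)=\sum_k\vartheta_k\otimes\kappa(c_k^{(1)})\,\eta\, c_k^{(2)}$, where $\wp_\Gamma(\vartheta)=\sum_k\vartheta_k\otimes c_k$. Let $$A=\bigoplus_n A_n,\qquad A_n=\sum_{\pi\in S_n}(-1)^\pi\sigma_\pi\colon\Gamma^{\otimes n}\to\Gamma^{\otimes n},$$ be the total antisymmetrizer, where $\sigma_\pi$ is obtained from a minimal decomposition of $\pi$ into transpositions $i\leftrightarrow i+1$ by replacing these with the corresponding $\sigma$-twists. Put $S^\vee=\ker A$, so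 that $\Gamma^\vee=\Gamma^\otimes/S^\vee$ is the bicovariant exterior algebra of $\Gamma$. Let $M$ be a non-empty compact smooth manifold of dimension $n\ge1$ (Hausdorff, without boundary), and let $P=(\mathcal B,i,F)$ be a locally trivial quantum principal $G$-bundle over $M$. Here $\mathcal B$ is a unital $*$-algebra, $i\colon S(M)\to\mathcal B$ and $F\colon\mathcal B\to\mathcal B\otimes\mathcal A$ are unital $*$-homomorphisms, $i$ is injective with image $\{b: F(b)=b\otimes1\}$, $F$ is a right coaction of $\mathcal A$, the elements $(q\otimes 1)F(b)$ span $\mathcal B\otimes\mathcal A$, and $M$ is covered by open sets over which $P$ has a local trivialization. A *local trivialization* over an open $U\subseteq M$ is a unital $*$-homomorphism $\pi_U\colon\mathcal B\to S(U)\otimes\mathcal A$ such that $\pi_U(i(f))=f|_U\otimes1$ for $f\in S(M)$, $(\mathrm{id}\otimes\phi)\pi_U=(\pi_U\otimes\mathrm{id})F$, $S_c(U)\otimes\mathcal A\subseteq\pi_U(\mathcal B)$, and $\pi_U(b)=0$ implies $i(f)b=0$ for all $f\in S_c(U)$ ($S$ and $S_c$ denote smooth complex functions and those with compact support). A *trivialization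 system* is a family $\tau=(\pi_U)_{U\in\mathcal U}$ of local trivializations over the members of an open cover $\mathcal U$ of $M$. For $U,V\in\mathcal U$ with $U\cap V\neq\emptyset$, its transition function $\psi_{UV}$ is the $S(U\cap V)$-linear homomorphism of $S(U\cap V)\otimes\mathcal A$ with $\psi_{UV}(\pi_V(b)|_{U\cap V})=\pi_U(b)|_{U\cap V}$ for all $b\in\mathcal B$; put $\varphi_{UV}=\psi_{UV}|_{\mathcal A}$. Let $\Omega(U\cap V)$ be the algebra of smooth complex differential forms, $\widehat\otimes$ the graded tensor product, and $\varphi_{UV}^\otimes\colon\Gamma^\otimes\to\Omega(U\cap V)\,\widehat\otimes\,\Gamma^\otimes$ the homomorphism which extends $\varphi_{UV}$ and satisfies $\varphi_{UV}^\otimes(da)=(d\otimes\mathrm{id}+\mathrm{id}\otimes d)\varphi_{UV}(a)$ for $a\in\mathcal A$. **Lemma (minimality of the exterior algebra).** Let $\mathcal N\subseteq\Gamma^\otimes$ be a graded two-sided ideal which is bicovariant, i.e. $\ell_\Gamma^\otimes(\mathcal N)\subseteq\mathcal A\otimes\mathcal N$ and $\wp_\Gamma^\otimes(\mathcal N)\subseteq\mathcal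 N\otimes\mathcal A$, such that $\mathcal N^0=\mathcal N^1=\{0\}$ and $$\varphi_{UV}^\otimes(\mathcal N)\subseteq\Omega(U\cap V)\,\widehat\otimes\,\mathcal N$$ for every trivialization system $\tau=(\pi_U)_{U\in\mathcal U}$ of $P$ and all $U,V\in\mathcal U$ with $U\cap V\ne\emptyset$. Then $$\mathcal N\subseteq S^\vee .$$ (In this sense $\Gamma^\vee=\Gamma^\otimes/S^\vee$ is minimal: the projection $\Gamma^\otimes\to\Gamma^\vee$ factors through $\Gamma^\otimes/\mathcal N$ for every such $\mathcal N$.) -/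

import Mathlib

open scoped TensorProduct Manifold ContDiff

set_option linter.unusedSectionVars false

noncomputable section

namespace QPB

/-! ### Graded tensor products

The sign rule of a graded tensor product only involves the parity of the degrees, so that it can be
expressed through the parity automorphism `x ↦ (-1)^∂x x` of each of the two graded algebras. -/

section Parity

variable {R : Type*} [Ring R] [Algebra ℂ R]

/-- The even (`i = 0`) and the odd (`i = 1`) part of an algebra, with respect to an automorphism
`θ`: the elements with `θ x = (-1)^i x`. -/
def parityPart (θ : R →ₐ[ℂ] R) (i : ZMod 2) : Submodule ℂ R :=
  LinearMap.ker (θ.toLinearMap - ((-1 : ℂ) ^ i.val) • LinearMap.id)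

theorem mem_parityPart {θ : R →ₐ[ℂ] R} {i : ZMod 2} {x : R} :
    x ∈ parityPart θ i ↔ θ x = ((-1 : ℂ) ^ i.val) • x := by
  simp [parityPart, sub_eq_zero]

theorem mem_parityPart_zero {θ : R →ₐ[ℂ] R} {x : R} : x ∈ parityPart θ 0 ↔ θ x = x := by
  simp [mem_parityPart]

theorem mem_parityPart_one {θ : R →ₐ[ℂ] R} {x : R} : x ∈ parityPart θ 1 ↔ θ x = -x := by
  have : (1 : ZMod 2).val = 1 := rfl
  simp [mem_parityPart, this]

theorem parity_cases (i : ZMod 2) : i = 0 ∨ i = 1 := by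
  revert i; decide

/-- The projection onto the even part. -/
def evenPart (θ : R →ₐ[ℂ] R) (h : ∀ x, θ (θ x) = x) : R →ₗ[ℂ] parityPart θ 0 :=
  ((2 : ℂ)⁻¹ • (LinearMap.id + θ.toLinearMap)).codRestrict (parityPart θ 0) fun x => by
    simp [mem_parityPart_zero, h, add_comm]

/-- The projection onto the odd part. -/
def oddPart (θ : R →ₐ[ℂ] R) (h : ∀ x, θ (θ x) = x) : R →ₗ[ℂ] parityPart θ 1 :=
  ((2 : ℂ)⁻¹ • (LinearMap.id - θ.toLinearMap)).codRestrict (parityPart θ 1) fun x => by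
    simp [mem_parityPart_one, h, smul_sub]

theorem coe_evenPart (θ : R →ₐ[ℂ] R) (h : ∀ x, θ (θ x) = x) (x : R) :
    (evenPart θ h x : R) = (2 : ℂ)⁻¹ • (x + θ x) := rfl

theorem coe_oddPart (θ : R →ₐ[ℂ] R) (h : ∀ x, θ (θ x) = x) (x : R) :
    (oddPart θ h x : R) = (2 : ℂ)⁻¹ • (x - θ x) := rfl

/-- The decomposition of an element into its even and its odd part. -/
def parityDecompose (θ : R →ₐ[ℂ] R) (h : ∀ x, θ (θ x) = x) :
    R →+ DirectSum (ZMod 2) fun i => parityPart θ i :=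
  (DirectSum.of (fun i => parityPart θ i) 0).comp (evenPart θ h).toAddMonoidHom +
  (DirectSum.of (fun i => parityPart θ i) 1).comp (oddPart θ h).toAddMonoidHom

theorem parityDecompose_apply (θ : R →ₐ[ℂ] R) (h : ∀ x, θ (θ x) = x) (x : R) :
    parityDecompose θ h x = DirectSum.of (fun i => parityPart θ i) 0 (evenPart θ h x) +
      DirectSum.of (fun i => parityPart θ i) 1 (oddPart θ h x) := rfl

/-- An automorphism with `θ² = 1` gives a grading by parity. -/
@[reducible]
def parityGradedAlgebra (θ : R →ₐ[ℂ] R) (h : ∀ x, θ (θ x) = x) :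
    GradedAlgebra (parityPart θ) where
  one_mem := by simp [mem_parityPart_zero]
  mul_mem := by
    intro i j x y hx hy
    have two : (1 + 1 : ZMod 2) = 0 := rfl
    rcases parity_cases i with rfl | rfl <;> rcases parity_cases j with rfl | rfl <;>
      simp only [add_zero, zero_add, two, mem_parityPart_zero, mem_parityPart_one] at hx hy ⊢ <;>
      simp [hx, hy]
  __ := DirectSum.Decomposition.ofAddHom (parityPart θ) (parityDecompose θ h)
    (by
      ext x
      have : x + θ x + (x - θ x) = (2 : ℂ) • x := by rw [two_smul]; abel
      rw [AddMonoidHom.comp_apply, parityDecompose_apply, map_add, DirectSum.coeAddMonoidHom_of,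
        DirectSum.coeAddMonoidHom_of, coe_evenPart, coe_oddPart, ← smul_add, this, smul_smul]
      norm_num)
    (by
      ext i y : 2
      obtain ⟨y, hy⟩ := y
      have half : ∀ z : R, (2 : ℂ)⁻¹ • (z + z) = z := fun z => by
        rw [← two_smul ℂ z, smul_smul]; norm_num
      rw [AddMonoidHom.comp_apply, AddMonoidHom.comp_apply, DirectSum.coeAddMonoidHom_of,
        parityDecompose_apply, AddMonoidHom.comp_apply, AddMonoidHom.id_apply]
      rcases parity_cases i with rfl | rfl
      · have hy' := mem_parityPart_zero.1 hy
        have h1 : oddPart θ h y = 0 := Subtype.ext (by rw [coe_oddPart, hy']; simp)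
        have h0 : evenPart θ h y = ⟨y, hy⟩ :=
          Subtype.ext (by rw [coe_evenPart, hy', half])
        simp only [h1, h0, map_zero, add_zero]
      · have hy' := mem_parityPart_one.1 hy
        have h0 : evenPart θ h y = 0 := Subtype.ext (by rw [coe_evenPart, hy']; simp)
        have h1 : oddPart θ h y = ⟨y, hy⟩ :=
          Subtype.ext (by rw [coe_oddPart, hy', sub_neg_eq_add, half])
        simp only [h1, h0, map_zero, zero_add])

end Parity

/-! ### Minimal decompositions of permutations -/

section Words

open Equiv

/-- A decomposition of a permutation `p` of `{0, …, n-1}` into transpositions `k ↔ k + 1`, recorded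
as the list of the indices `k`; it is minimal (see below).  With `i = p⁻¹ 0`, the permutation `p` is the cycle
`(0 1 … i) = s₀ s₁ ⋯ s_{i-1}` followed by a permutation of `{1, …, n-1}`. -/
def permWord : (n : ℕ) → Perm (Fin n) → List ℕ
  | 0, _ => []
  | n + 1, p =>
    (permWord n (Perm.decomposeFin (p * (Fin.cycleRange (p⁻¹ 0))⁻¹)).2).map (· + 1) ++
      List.range (p⁻¹ 0 : Fin (n + 1))

/-- The product of the transpositions `k ↔ k + 1` along a word. -/
def wordPerm (w : List ℕ) : Perm ℕ := (w.map fun k => swap k (k + 1)).prod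

theorem wordPerm_append (v w : List ℕ) (x : ℕ) :
    wordPerm (v ++ w) x = wordPerm v (wordPerm w x) := by
  simp [wordPerm]

theorem wordPerm_cons (k : ℕ) (w : List ℕ) (x : ℕ) :
    wordPerm (k :: w) x = swap k (k + 1) (wordPerm w x) := by
  simp [wordPerm]

theorem wordPerm_map_succ_zero (w : List ℕ) : wordPerm (w.map (· + 1)) 0 = 0 := by
  induction w with
  | nil => rfl
  | cons k w ih => rw [List.map_cons, wordPerm_cons, ih]; exact swap_apply_of_ne_of_ne (by simp) (by simp)

theorem wordPerm_map_succ_succ (w : List ℕ) (x : ℕ) :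
    wordPerm (w.map (· + 1)) (x + 1) = wordPerm w x + 1 := by
  induction w with
  | nil => rfl
  | cons k w ih =>
    rw [List.map_cons, wordPerm_cons, ih, wordPerm_cons]
    simp only [swap_apply_def]
    split_ifs <;> omega

theorem wordPerm_range (i x : ℕ) :
    wordPerm (List.range i) x = if x < i then x + 1 else if x = i then 0 else x := by
  induction i generalizing x with
  | zero => simp [wordPerm]
  | succ i ih =>
    rw [List.range_succ, wordPerm_append, wordPerm_cons]
    simp only [wordPerm, List.map_nil, List.prod_nil, Perm.coe_one, id_eq, swap_apply_def]
    change wordPerm (List.range i) _ = _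
    rw [ih]
    split_ifs <;> omega

theorem perm_decomp {n : ℕ} (p : Perm (Fin (n + 1))) (j : Fin n) :
    p ((p⁻¹ 0).succAbove j) =
      ((Perm.decomposeFin (p * (Fin.cycleRange (p⁻¹ 0))⁻¹)).2 j).succ := by
  set i := p⁻¹ 0 with hi
  set q := p * (Fin.cycleRange i)⁻¹ with hq
  have h0 : q 0 = 0 := by
    have : (Fin.cycleRange i)⁻¹ 0 = i := by
      rw [Perm.inv_eq_iff_eq]; exact (Fin.cycleRange_self i).symm
    rw [hq, Perm.mul_apply, this, hi]; exact p.apply_symm_apply 0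
  have h1 : p (i.succAbove j) = q j.succ := by
    rw [hq, Perm.mul_apply]; congr 1
    rw [Perm.eq_inv_iff_eq]; exact Fin.cycleRange_succAbove i j
  have h2 : q = Perm.decomposeFin.symm (Perm.decomposeFin q) := (Equiv.symm_apply_apply _ _).symm
  have h3 : (Perm.decomposeFin q).1 = 0 := by
    have e : Perm.decomposeFin.symm ((Perm.decomposeFin q).1, (Perm.decomposeFin q).2) 0 =
        (Perm.decomposeFin q).1 := Perm.decomposeFin_symm_apply_zero _ _
    rw [← e, Prod.mk.eta, ← h2, h0]
  rw [h1]; conv_lhs => rw [h2]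
  rw [← Prod.mk.eta (p := Perm.decomposeFin q), h3]
  simp

/-- `permWord n p` is a decomposition of `p`. -/
theorem wordPerm_permWord : ∀ (n : ℕ) (p : Perm (Fin n)) (x : Fin n),
    wordPerm (permWord n p) x = p x
  | 0, _, x => x.elim0
  | n + 1, p, x => by
    rw [permWord, wordPerm_append, wordPerm_range]
    rcases Fin.eq_self_or_eq_succAbove (p⁻¹ 0) x with rfl | ⟨j, rfl⟩
    · simp [wordPerm_map_succ_zero]
    · rw [perm_decomp, Fin.val_succ, ← wordPerm_permWord n, ← wordPerm_map_succ_succ]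
      congr 1
      rcases lt_or_ge j.castSucc (p⁻¹ 0) with h | h
      · rw [Fin.succAbove_of_castSucc_lt _ _ h, if_pos (show (j.castSucc : ℕ) < _ from h)]; rfl
      · rw [Fin.succAbove_of_le_castSucc _ _ h]
        have : ((p⁻¹ 0 : Fin (n+1)) : ℕ) ≤ j := h
        rw [Fin.val_succ, if_neg (by omega), if_neg (by omega)]

/-- The inversions of a permutation. -/
def inversions {n : ℕ} (f : Fin n → ℕ) : Finset (Fin n × Fin n) :=
  Finset.univ.filter fun q => q.1 < q.2 ∧ f q.2 < f q.1

theorem card_inversions_le {n : ℕ} (w : List ℕ) :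
    (inversions fun x : Fin n => wordPerm w x).card ≤ w.length := by
  induction w with
  | nil =>
    rw [List.length_nil, Nat.le_zero, Finset.card_eq_zero]
    refine Finset.filter_eq_empty_iff.2 fun q _ h => ?_
    have h1 := h.1
    have h2 : (q.2 : ℕ) < q.1 := h.2
    exact absurd h1 (not_lt.2 (le_of_lt h2))
  | cons k w ih =>
    by_cases hx : ∃ q : Fin n × Fin n, wordPerm w q.1 = k ∧ wordPerm w q.2 = k + 1
    · obtain ⟨q, hq⟩ := hx
      refine (Finset.card_le_card (t := insert q (inversions fun x : Fin n => wordPerm w x))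
        fun r hr => ?_).trans ((Finset.card_insert_le _ _).trans (by simpa using ih))
      simp only [inversions, Finset.mem_filter, Finset.mem_univ, true_and, Finset.mem_insert] at hr ⊢
      by_cases e : r = q
      · exact Or.inl e
      refine Or.inr ⟨hr.1, ?_⟩
      have hr2 := hr.2
      rw [wordPerm_cons, wordPerm_cons] at hr2
      by_contra hlt
      apply e
      have hne : wordPerm w r.1 ≠ wordPerm w r.2 := fun h => by
        have := (wordPerm w).injective h
        exact absurd (Fin.ext this) hr.1.ne
      have : wordPerm w r.1 = k ∧ wordPerm w r.2 = k + 1 := by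
        simp only [swap_apply_def] at hr2
        split_ifs at hr2 <;> omega
      exact Prod.ext (Fin.ext ((wordPerm w).injective (this.1.trans hq.1.symm)))
        (Fin.ext ((wordPerm w).injective (this.2.trans hq.2.symm)))
    · refine (Finset.card_le_card fun r hr => ?_).trans (ih.trans (by simp))
      simp only [inversions, Finset.mem_filter, Finset.mem_univ, true_and] at hr ⊢
      refine ⟨hr.1, ?_⟩
      have hr2 := hr.2
      rw [wordPerm_cons, wordPerm_cons] at hr2
      by_contra hlt
      have hne : wordPerm w r.1 ≠ wordPerm w r.2 := fun h => by
        have := (wordPerm w).injective h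
        exact absurd (Fin.ext this) hr.1.ne
      apply hx
      refine ⟨r, ?_⟩
      simp only [swap_apply_def] at hr2
      split_ifs at hr2 <;> omega

theorem length_permWord_le : ∀ (n : ℕ) (p : Perm (Fin n)),
    (permWord n p).length ≤ (inversions fun x => (p x : ℕ)).card
  | 0, _ => by simp [permWord]
  | n + 1, p => by
    rw [permWord, List.length_append, List.length_map, List.length_range]
    set i := p⁻¹ 0 with hi
    set r := (Perm.decomposeFin (p * (Fin.cycleRange i)⁻¹)).2
    have hp : ∀ j, p (i.succAbove j) = (r j).succ := perm_decomp p
    have hpi : p i = 0 := by simp [hi]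
    have h1 : ((inversions fun x => (r x : ℕ)).image
        (fun q => (i.succAbove q.1, i.succAbove q.2))).card =
        (inversions fun x => (r x : ℕ)).card :=
      Finset.card_image_of_injective _ fun a b h => by
        simp only [Prod.mk.injEq, Fin.succAbove_right_inj] at h
        exact Prod.ext h.1 h.2
    have h2 : ((Finset.Iio i).image (fun j => (j, i))).card = i := by
      rw [Finset.card_image_of_injective _ fun a b h => (Prod.mk.inj h).1, Fin.card_Iio]
    refine (Nat.add_le_add_right (length_permWord_le n r) _).trans ?_
    rw [← h1]
    conv_lhs => rw [← h2]
    rw [← Finset.card_union_of_disjoint]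
    · refine Finset.card_le_card fun q hq => ?_
      simp only [inversions, Finset.mem_union, Finset.mem_image, Finset.mem_filter,
        Finset.mem_univ, true_and, Finset.mem_Iio] at hq ⊢
      rcases hq with ⟨a, ⟨ha, hb⟩, rfl⟩ | ⟨j, hj, rfl⟩
      · refine ⟨by simpa using ha, ?_⟩
        simp only [hp, Fin.val_succ]; omega
      · refine ⟨hj, ?_⟩
        rw [hpi]
        have : p j ≠ 0 := fun h => hj.ne (p.injective (h.trans hpi.symm))
        exact Nat.pos_of_ne_zero fun h => this (Fin.ext h)
    · refine Finset.disjoint_left.2 fun q h h' => ?_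
      simp only [Finset.mem_image, Finset.mem_Iio] at h h'
      obtain ⟨a, -, rfl⟩ := h
      obtain ⟨j, -, e⟩ := h'
      exact (Fin.succAbove_ne i a.2) (Prod.mk.inj e).2.symm

/-- The decomposition `permWord n p` is minimal. -/
theorem length_permWord_minimal (n : ℕ) (p : Perm (Fin n)) (w : List ℕ)
    (hw : ∀ x : Fin n, wordPerm w x = p x) : (permWord n p).length ≤ w.length := by
  refine (length_permWord_le n p).trans ?_
  simp only [← hw]
  exact card_inversions_le w

end Words

/-! ### Braid operators and antisymmetrizers on tensor algebras -/

section Braid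

variable {V : Type*} [AddCommGroup V] [Module ℂ V]

/-- `v ⊗ t ↦ v t`. -/
def joinHead : V ⊗[ℂ] TensorAlgebra ℂ V →ₗ[ℂ] TensorAlgebra ℂ V :=
  TensorProduct.lift ((LinearMap.mul ℂ (TensorAlgebra ℂ V)).comp (TensorAlgebra.ι ℂ))

/-- Left multiplication by vectors, keeping track of the first factor. -/
def splitHeadAux :
    V →ₗ[ℂ] Module.End ℂ (TensorAlgebra ℂ V × (V ⊗[ℂ] TensorAlgebra ℂ V)) where
  toFun v := (LinearMap.mulLeft ℂ (TensorAlgebra.ι ℂ v) ∘ₗ LinearMap.fst ℂ _ _).prod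
    (TensorProduct.mk ℂ V (TensorAlgebra ℂ V) v ∘ₗ LinearMap.fst ℂ _ _)
  map_add' v w := by
    refine LinearMap.ext fun x => ?_
    simp [add_mul]
  map_smul' c v := by
    refine LinearMap.ext fun x => ?_
    simp [TensorProduct.smul_tmul']

/-- The splitting of the first factor: `v t ↦ v ⊗ t` and `1 ↦ 0`. -/
def splitHead : TensorAlgebra ℂ V →ₗ[ℂ] V ⊗[ℂ] TensorAlgebra ℂ V :=
  LinearMap.snd ℂ (TensorAlgebra ℂ V) (V ⊗[ℂ] TensorAlgebra ℂ V) ∘ₗ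
    LinearMap.applyₗ ((1, 0) : TensorAlgebra ℂ V × (V ⊗[ℂ] TensorAlgebra ℂ V)) ∘ₗ
      (TensorAlgebra.lift ℂ (splitHeadAux (V := V))).toLinearMap

theorem splitHead_one : splitHead (1 : TensorAlgebra ℂ V) = 0 := by
  simp [splitHead]

theorem splitHead_ι_mul (v : V) (t : TensorAlgebra ℂ V) :
    splitHead (TensorAlgebra.ι ℂ v * t) = v ⊗ₜ t := by
  have key : ∀ t : TensorAlgebra ℂ V,
      (TensorAlgebra.lift ℂ splitHeadAux t ((1, 0) : TensorAlgebra ℂ V × (V ⊗[ℂ] TensorAlgebra ℂ V))).1 = t := by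
    intro t
    suffices h : ∀ x : TensorAlgebra ℂ V × (V ⊗[ℂ] TensorAlgebra ℂ V),
        (TensorAlgebra.lift ℂ splitHeadAux t x).1 = t * x.1 by simpa using h (1, 0)
    induction t using TensorAlgebra.induction with
    | algebraMap r => intro x; simp [Algebra.smul_def]
    | ι v => intro x; simp [splitHeadAux]
    | mul a b ha hb => intro x; rw [map_mul, Module.End.mul_apply, ha, hb, mul_assoc]
    | add a b ha hb => intro x; simp [ha, hb, add_mul]
  have e : splitHeadAux v (TensorAlgebra.lift ℂ splitHeadAux t
      ((1, 0) : TensorAlgebra ℂ V × (V ⊗[ℂ] TensorAlgebra ℂ V))) =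
      (TensorAlgebra.ι ℂ v * t, v ⊗ₜ t) := by
    conv_rhs => rw [← key t]
    rfl
  simp [splitHead, e]

/-- The operator `id ⊗ f`: `v t ↦ v f(t)` and `1 ↦ 1`. -/
def tailMap (f : Module.End ℂ (TensorAlgebra ℂ V)) : Module.End ℂ (TensorAlgebra ℂ V) :=
  Algebra.linearMap ℂ _ ∘ₗ TensorAlgebra.algebraMapInv.toLinearMap +
    joinHead ∘ₗ f.lTensor V ∘ₗ splitHead

/-- The action of `s` on the first two factors: `v w t ↦ s(v ⊗ w) t` (and `0` in the degrees below
`2`, where it is not used). -/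
def headTwist (s : Module.End ℂ (V ⊗[ℂ] V)) : Module.End ℂ (TensorAlgebra ℂ V) :=
  joinHead ∘ₗ joinHead.lTensor V ∘ₗ (TensorProduct.assoc ℂ V V _).toLinearMap ∘ₗ
    s.rTensor _ ∘ₗ (TensorProduct.assoc ℂ V V _).symm.toLinearMap ∘ₗ
      splitHead.lTensor V ∘ₗ splitHead

/-- The action of `s` on the factors number `k` and `k + 1` (counted from `0`). -/
def twistAt (s : Module.End ℂ (V ⊗[ℂ] V)) : ℕ → Module.End ℂ (TensorAlgebra ℂ V)
  | 0 => headTwist s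
  | k + 1 => tailMap (twistAt s k)

/-- The operator `s_p` of a permutation `p ∈ S_n`: the transpositions `k ↔ k + 1` of a minimal
decomposition of `p` are replaced by the twists of the corresponding factors. -/
def permTwist (s : Module.End ℂ (V ⊗[ℂ] V)) (n : ℕ) (p : Equiv.Perm (Fin n)) :
    Module.End ℂ (TensorAlgebra ℂ V) :=
  ((permWord n p).map (twistAt s)).prod

/-- The operator `∑_{p ∈ S_n} (-1)^p s_p`, which is meant to act on the tensors of degree `n`. -/
def degreeAntisymmetrizer (s : Module.End ℂ (V ⊗[ℂ] V)) (n : ℕ) :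
    Module.End ℂ (TensorAlgebra ℂ V) :=
  ∑ p : Equiv.Perm (Fin n), (Equiv.Perm.sign p : ℤ) • permTwist s n p

/-- The total antisymmetrizer: `∑_{p ∈ S_n} (-1)^p s_p` on the tensors of degree `n`. -/
def tensorAntisymmetrizer (s : Module.End ℂ (V ⊗[ℂ] V)) : Module.End ℂ (TensorAlgebra ℂ V) :=
  DirectSum.toModule ℂ ℕ _ (fun n => degreeAntisymmetrizer s n ∘ₗ
      (LinearMap.range (TensorAlgebra.ι ℂ : V →ₗ[ℂ] _) ^ n).subtype) ∘ₗ
    (DirectSum.decomposeLinearEquiv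
      (fun n : ℕ => LinearMap.range (TensorAlgebra.ι ℂ : V →ₗ[ℂ] _) ^ n)).toLinearMap

end Braid

/-! ### Compact matrix quantum groups -/

section QuantumGroup

variable (A : Type*) [Ring A] [StarRing A] [HopfAlgebra ℂ A] [StarModule ℂ A]

/-- `A` is the Hopf `*`-algebra of polynomial functions on a compact matrix quantum group: it is
generated, as a `*`-algebra, by the matrix elements of a unitary matrix corepresentation. -/
structure IsCompactMatrixQuantumGroup : Prop where
  comul_star : ∀ a : A, Coalgebra.comul (R := ℂ) (star a) = star (Coalgebra.comul (R := ℂ) a)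
  exists_fundamental : ∃ (m : ℕ) (u : Matrix (Fin m) (Fin m) A),
    (∀ i j, Coalgebra.comul (R := ℂ) (u i j) = ∑ k, u i k ⊗ₜ[ℂ] u k j) ∧
    (∀ i j, Coalgebra.counit (R := ℂ) (u i j) = if i = j then 1 else 0) ∧
    u ∈ unitary (Matrix (Fin m) (Fin m) A) ∧
    StarAlgebra.adjoin ℂ {a : A | ∃ i j, a = u i j} = ⊤

end QuantumGroup

section Hopf

variable {A : Type*} [Ring A] [HopfAlgebra ℂ A]

/-- The adjoint action `ad(a) = a⁽²⁾ ⊗ κ(a⁽¹⁾) a⁽³⁾`. -/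
def adjointAction : A →ₗ[ℂ] A ⊗[ℂ] A :=
  TensorProduct.lift
      (LinearMap.lTensorHom A ∘ₗ LinearMap.mul ℂ A ∘ₗ HopfAlgebra.antipode ℂ (A := A)) ∘ₗ
    (Coalgebra.comul (R := ℂ) (A := A)).lTensor A ∘ₗ Coalgebra.comul

/-- The Lie algebra of the classical part `G_cl` of `G`.  The points of `G_cl` are the
`*`-characters of `A`, so its tangent vectors at the neutral element `ε` are the hermitian linear
functionals which are derivations over `ε`. -/
structure IsClassicalLie [StarRing A] (X : A →ₗ[ℂ] ℂ) : Prop where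
  map_mul : ∀ a b : A,
    X (a * b) = Coalgebra.counit (R := ℂ) a * X b + X a * Coalgebra.counit (R := ℂ) b
  map_star : ∀ a : A, X (star a) = star (X a)

/-- A subspace `R` of `A` is admissible if `(X ⊗ id) ad(R) = 0` for all `X ∈ lie(G_cl)`. -/
def IsAdmissible [StarRing A] (R : Submodule ℂ A) : Prop :=
  ∀ X : A →ₗ[ℂ] ℂ, IsClassicalLie X → ∀ a ∈ R, X.rTensor A (adjointAction a) = 0

end Hopf

/-! ### Bicovariant first-order calculi and their tensor bundle algebras -/

section Calculus

variable (A Γ : Type*) [Ring A] [HopfAlgebra ℂ A] [AddCommGroup Γ] [Module ℂ Γ] [Module A Γ]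
  [Module Aᵐᵒᵖ Γ] [IsScalarTower ℂ A Γ] [IsScalarTower ℂ Aᵐᵒᵖ Γ] [SMulCommClass A Aᵐᵒᵖ Γ]

/-- The right module structure `ξ ↦ (a ↦ ξ a)`. -/
def rightAct : Γ →ₗ[ℂ] A →ₗ[ℂ] Γ :=
  LinearMap.mk₂ ℂ (fun ξ a => MulOpposite.op a • ξ) (fun _ _ _ => smul_add _ _ _)
    (fun c ξ a => smul_comm _ _ _)
    (fun ξ a b => by rw [MulOpposite.op_add, add_smul])
    (fun c ξ a => by rw [MulOpposite.op_smul, smul_assoc])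

/-- The left module structure `a ↦ (ξ ↦ a ξ)`. -/
def leftAct : A →ₗ[ℂ] Γ →ₗ[ℂ] Γ := (Algebra.lsmul ℂ ℂ Γ).toLinearMap

/-- A bicovariant first-order differential calculus: an `A`-bimodule `Γ` with a derivation
`d : A → Γ` such that `Γ = A dA`, and with a left action `ℓ : Γ → A ⊗ Γ` and a right action
`℘ : Γ → Γ ⊗ A` of the quantum group which extend the comultiplication. -/
structure BicovariantCalculus where
  d : A →ₗ[ℂ] Γ
  leibniz : ∀ a b : A, d (a * b) = a • d b + MulOpposite.op b • d a
  span_eq_top : Submodule.span ℂ {ξ : Γ | ∃ a b : A, ξ = a • d b} = ⊤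
  coactL : Γ →ₗ[ℂ] A ⊗[ℂ] Γ
  coactL_d : ∀ a : A, coactL (d a) = d.lTensor A (Coalgebra.comul a)
  coactL_smul : ∀ (a : A) (ξ : Γ), coactL (a • ξ) =
    TensorProduct.map₂ (LinearMap.mul ℂ A) (leftAct A Γ) (Coalgebra.comul a) (coactL ξ)
  coactL_op_smul : ∀ (a : A) (ξ : Γ), coactL (MulOpposite.op a • ξ) =
    TensorProduct.map₂ (LinearMap.mul ℂ A) (rightAct A Γ) (coactL ξ) (Coalgebra.comul a)
  coactR : Γ →ₗ[ℂ] Γ ⊗[ℂ] A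
  coactR_d : ∀ a : A, coactR (d a) = d.rTensor A (Coalgebra.comul a)
  coactR_smul : ∀ (a : A) (ξ : Γ), coactR (a • ξ) =
    TensorProduct.map₂ (leftAct A Γ) (LinearMap.mul ℂ A) (Coalgebra.comul a) (coactR ξ)
  coactR_op_smul : ∀ (a : A) (ξ : Γ), coactR (MulOpposite.op a • ξ) =
    TensorProduct.map₂ (rightAct A Γ) (LinearMap.mul ℂ A) (coactR ξ) (Coalgebra.comul a)

/-- The defining relations of the tensor bundle algebra, imposed on the tensor algebra of the vector
space `A ⊕ Γ`. -/
inductive TensorBundleRel : TensorAlgebra ℂ (A × Γ) → TensorAlgebra ℂ (A × Γ) → Prop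
  | one : TensorBundleRel (TensorAlgebra.ι ℂ (1, 0)) 1
  | mul (a b : A) : TensorBundleRel
      (TensorAlgebra.ι ℂ (a, 0) * TensorAlgebra.ι ℂ (b, 0)) (TensorAlgebra.ι ℂ (a * b, 0))
  | left (a : A) (ξ : Γ) : TensorBundleRel
      (TensorAlgebra.ι ℂ (a, 0) * TensorAlgebra.ι ℂ (0, ξ)) (TensorAlgebra.ι ℂ (0, a • ξ))
  | right (a : A) (ξ : Γ) : TensorBundleRel
      (TensorAlgebra.ι ℂ (0, ξ) * TensorAlgebra.ι ℂ (a, 0))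
      (TensorAlgebra.ι ℂ (0, MulOpposite.op a • ξ))

/-- The tensor bundle algebra `Γ^⊗ = A ⊕ Γ ⊕ (Γ ⊗_A Γ) ⊕ …`, that is, the tensor algebra of the
`A`-bimodule `Γ`: the universal algebra with a homomorphism from `A` and a bimodule map from
`Γ`. -/
def TensorBundle : Type _ := RingQuot (TensorBundleRel A Γ)

instance : Ring (TensorBundle A Γ) := inferInstanceAs (Ring (RingQuot (TensorBundleRel A Γ)))

instance : Algebra ℂ (TensorBundle A Γ) :=
  inferInstanceAs (Algebra ℂ (RingQuot (TensorBundleRel A Γ)))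

namespace TensorBundle

/-- The quotient map. -/
def mk : TensorAlgebra ℂ (A × Γ) →ₐ[ℂ] TensorBundle A Γ :=
  RingQuot.mkAlgHom ℂ (TensorBundleRel A Γ)

theorem mk_rel {x y : TensorAlgebra ℂ (A × Γ)} (h : TensorBundleRel A Γ x y) :
    mk A Γ x = mk A Γ y :=
  RingQuot.mkAlgHom_rel ℂ h

/-- The inclusion `A → Γ^⊗`. -/
def incl : A →ₐ[ℂ] TensorBundle A Γ :=
  AlgHom.ofLinearMap
    ((mk A Γ).toLinearMap ∘ₗ TensorAlgebra.ι ℂ ∘ₗ LinearMap.inl ℂ A Γ)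
    (by simpa using mk_rel A Γ .one)
    (fun a b => by simpa using (mk_rel A Γ (.mul a b)).symm)

/-- The inclusion `Γ → Γ^⊗`. -/
def form : Γ →ₗ[ℂ] TensorBundle A Γ :=
  (mk A Γ).toLinearMap ∘ₗ TensorAlgebra.ι ℂ ∘ₗ LinearMap.inr ℂ A Γ

theorem incl_mul_form (a : A) (ξ : Γ) : incl A Γ a * form A Γ ξ = form A Γ (a • ξ) := by
  exact (map_mul (mk A Γ) _ _).symm.trans (mk_rel A Γ (.left a ξ))

theorem form_mul_incl (a : A) (ξ : Γ) :
    form A Γ ξ * incl A Γ a = form A Γ (MulOpposite.op a • ξ) := by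
  exact (map_mul (mk A Γ) _ _).symm.trans (mk_rel A Γ (.right a ξ))

variable {A Γ}

/-- The universal property of `Γ^⊗`. -/
def lift {R : Type*} [Ring R] [Algebra ℂ R] (f : A →ₐ[ℂ] R) (g : Γ →ₗ[ℂ] R)
    (hl : ∀ (a : A) (ξ : Γ), g (a • ξ) = f a * g ξ)
    (hr : ∀ (a : A) (ξ : Γ), g (MulOpposite.op a • ξ) = g ξ * f a) :
    TensorBundle A Γ →ₐ[ℂ] R :=
  RingQuot.liftAlgHom ℂ ⟨TensorAlgebra.lift ℂ (f.toLinearMap.coprod g), by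
    intro x y h
    cases h <;> simp [hl, hr]⟩

section Lift

variable {R : Type*} [Ring R] [Algebra ℂ R] (f : A →ₐ[ℂ] R) (g : Γ →ₗ[ℂ] R)
    (hl : ∀ (a : A) (ξ : Γ), g (a • ξ) = f a * g ξ)
    (hr : ∀ (a : A) (ξ : Γ), g (MulOpposite.op a • ξ) = g ξ * f a)

theorem lift_mk (x : TensorAlgebra ℂ (A × Γ)) :
    lift f g hl hr (mk A Γ x) = TensorAlgebra.lift ℂ (f.toLinearMap.coprod g) x :=
  RingQuot.liftAlgHom_mkAlgHom_apply ℂ _ _ _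

theorem lift_incl (a : A) : lift f g hl hr (incl A Γ a) = f a := by
  refine (lift_mk f g hl hr _).trans ?_
  simp

theorem lift_form (ξ : Γ) : lift f g hl hr (form A Γ ξ) = g ξ := by
  refine (lift_mk f g hl hr _).trans ?_
  simp

end Lift

/-- Homomorphisms on `Γ^⊗` are determined by their restrictions to `A` and `Γ`. -/
theorem algHom_ext {R : Type*} [Ring R] [Algebra ℂ R] {f g : TensorBundle A Γ →ₐ[ℂ] R}
    (h0 : ∀ a, f (incl A Γ a) = g (incl A Γ a)) (h1 : ∀ ξ, f (form A Γ ξ) = g (form A Γ ξ)) :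
    f = g := by
  refine RingQuot.ringQuot_ext' ℂ (s := TensorBundleRel A Γ) f g ?_
  refine TensorAlgebra.hom_ext (LinearMap.ext fun x => ?_)
  have hx : x = LinearMap.inl ℂ A Γ x.1 + LinearMap.inr ℂ A Γ x.2 := by simp
  rw [hx, map_add, map_add]
  exact congrArg₂ (· + ·) (h0 x.1) (h1 x.2)

variable (A Γ)

/-- The parity automorphism `x ↦ (-1)^∂x x` of `Γ^⊗`. -/
def parity : TensorBundle A Γ →ₐ[ℂ] TensorBundle A Γ :=
  lift (incl A Γ) (-form A Γ) (fun a ξ => by simp [incl_mul_form])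
    (fun a ξ => by simp [form_mul_incl])

theorem parity_parity (x : TensorBundle A Γ) : parity A Γ (parity A Γ x) = x := by
  have : (parity A Γ).comp (parity A Γ) = AlgHom.id ℂ _ :=
    algHom_ext (fun a => by simp [parity, lift_incl]) (fun ξ => by simp [parity, lift_form])
  exact DFunLike.congr_fun this x

instance : GradedAlgebra (parityPart (parity A Γ)) := parityGradedAlgebra _ (parity_parity A Γ)

/-- The homogeneous component `Γ^{⊗ k}` of `Γ^⊗`: it is spanned by the products
`a ξ₁ ⋯ ξ_k` with `a ∈ A` and `ξ_i ∈ Γ`. -/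
def degree (k : ℕ) : Submodule ℂ (TensorBundle A Γ) :=
  LinearMap.range (incl A Γ).toLinearMap * LinearMap.range (form A Γ) ^ k

end TensorBundle

namespace BicovariantCalculus

variable {A Γ} (C : BicovariantCalculus A Γ)

/-- The projection `π_inv(ξ) = κ(ξ⁽⁻¹⁾) ξ⁽⁰⁾` of `Γ` onto the left-invariant elements. -/
def invProj : Γ →ₗ[ℂ] Γ :=
  TensorProduct.lift (leftAct A Γ ∘ₗ HopfAlgebra.antipode ℂ) ∘ₗ C.coactL

/-- The map `π(a) = κ(a⁽¹⁾) da⁽²⁾`. -/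
def germ : A →ₗ[ℂ] Γ :=
  TensorProduct.lift ((leftAct A Γ ∘ₗ HopfAlgebra.antipode ℂ).compl₂ C.d) ∘ₗ Coalgebra.comul

/-- The right ideal `R ⊆ ker ε` which corresponds to the left-covariant calculus `Γ`. -/
def ideal : Submodule ℂ A := LinearMap.ker (Coalgebra.counit (R := ℂ) (A := A)) ⊓ C.germ.ker

/-- `Γ` is the minimal admissible left-covariant calculus: the associated right ideal
`R ⊆ ker ε` is admissible, and it contains every admissible right ideal `R' ⊆ ker ε`. -/
structure IsMinimalAdmissible [StarRing A] : Prop where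
  admissible : IsAdmissible C.ideal
  minimal : ∀ R' : Submodule ℂ A, (∀ a ∈ R', ∀ b : A, a * b ∈ R') →
    R' ≤ LinearMap.ker (Coalgebra.counit (R := ℂ) (A := A)) → IsAdmissible R' → R' ≤ C.ideal

/-- The left action `ℓ^⊗ : Γ^⊗ → A ⊗ Γ^⊗`, the homomorphism extending `φ` and `ℓ`. -/
def tensorCoactL : TensorBundle A Γ →ₐ[ℂ] A ⊗[ℂ] TensorBundle A Γ :=
  TensorBundle.lift
    ((Algebra.TensorProduct.map (AlgHom.id ℂ A) (TensorBundle.incl A Γ)).comp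
      (Bialgebra.comulAlgHom ℂ A))
    ((TensorBundle.form A Γ).lTensor A ∘ₗ C.coactL)
    (fun a ξ => by
      simp only [LinearMap.comp_apply, AlgHom.comp_apply, C.coactL_smul,
        Bialgebra.comulAlgHom_apply]
      induction Coalgebra.comul (R := ℂ) a with
      | zero => simp
      | add x y hx hy => simp [add_mul, hx, hy]
      | tmul x y =>
        induction C.coactL ξ with
        | zero => simp
        | add x y hx hy => rw [map_add, map_add, map_add, mul_add, hx, hy]
        | tmul z η => simp [leftAct, TensorBundle.incl_mul_form])
    (fun a ξ => by
      simp only [LinearMap.comp_apply, AlgHom.comp_apply, C.coactL_op_smul,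
        Bialgebra.comulAlgHom_apply]
      induction Coalgebra.comul (R := ℂ) a with
      | zero => simp
      | add x y hx hy => simp [mul_add, hx, hy]
      | tmul x y =>
        induction C.coactL ξ with
        | zero => simp
        | add x y hx hy => simp [add_mul, hx, hy]
        | tmul z η => simp [rightAct, TensorBundle.form_mul_incl])

/-- The right action `℘^⊗ : Γ^⊗ → Γ^⊗ ⊗ A`, the homomorphism extending `φ` and `℘`. -/
def tensorCoactR : TensorBundle A Γ →ₐ[ℂ] TensorBundle A Γ ⊗[ℂ] A :=
  TensorBundle.lift
    ((Algebra.TensorProduct.map (TensorBundle.incl A Γ) (AlgHom.id ℂ A)).comp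
      (Bialgebra.comulAlgHom ℂ A))
    ((TensorBundle.form A Γ).rTensor A ∘ₗ C.coactR)
    (fun a ξ => by
      simp only [LinearMap.comp_apply, AlgHom.comp_apply, C.coactR_smul,
        Bialgebra.comulAlgHom_apply]
      induction Coalgebra.comul (R := ℂ) a with
      | zero => simp
      | add x y hx hy => simp [add_mul, hx, hy]
      | tmul x y =>
        induction C.coactR ξ with
        | zero => simp
        | add x y hx hy => rw [map_add, map_add, map_add, mul_add, hx, hy]
        | tmul η z => simp [leftAct, TensorBundle.incl_mul_form])
    (fun a ξ => by
      simp only [LinearMap.comp_apply, AlgHom.comp_apply, C.coactR_op_smul,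
        Bialgebra.comulAlgHom_apply]
      induction Coalgebra.comul (R := ℂ) a with
      | zero => simp
      | add x y hx hy => simp [mul_add, hx, hy]
      | tmul x y =>
        induction C.coactR ξ with
        | zero => simp
        | add x y hx hy => simp [add_mul, hx, hy]
        | tmul η z => simp [rightAct, TensorBundle.form_mul_incl])

/-- `N` is a bicovariant graded (two-sided) ideal of `Γ^⊗`. -/
structure IsBicovariantGradedIdeal (N : Submodule ℂ (TensorBundle A Γ)) : Prop where
  mul_mem_left : ∀ x, ∀ y ∈ N, x * y ∈ N
  mul_mem_right : ∀ x ∈ N, ∀ y, x * y ∈ N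
  graded : N = ⨆ k, N ⊓ TensorBundle.degree A Γ k
  left_covariant : ∀ x ∈ N, C.tensorCoactL x ∈ LinearMap.range (N.subtype.lTensor A)
  right_covariant : ∀ x ∈ N, C.tensorCoactR x ∈ LinearMap.range (N.subtype.rTensor A)

/-! #### The bicovariant exterior algebra -/

/-- The right module structure `η ∘ a = κ(a⁽¹⁾) η a⁽²⁾`. -/
def circ : Γ →ₗ[ℂ] A →ₗ[ℂ] Γ :=
  LinearMap.flip
    (TensorProduct.lift ((LinearMap.mul ℂ (Module.End ℂ Γ)).compl₁₂ (rightAct A Γ).flip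
      (leftAct A Γ ∘ₗ HopfAlgebra.antipode ℂ)).flip ∘ₗ Coalgebra.comul)

/-- The flip-over operator `σ(η ⊗ ϑ) = ∑_k ϑ_k ⊗ (η ∘ c_k)`, with `℘(ϑ) = ∑_k ϑ_k ⊗ c_k`, which is
used for left-invariant `η` and `ϑ`. -/
def flipOver : Module.End ℂ (Γ ⊗[ℂ] Γ) :=
  TensorProduct.lift ((LinearMap.lcomp ℂ (Γ ⊗[ℂ] Γ) C.coactR) ∘ₗ LinearMap.lTensorHom Γ ∘ₗ circ)

theorem invProj_smul (a : A) (ξ : Γ) :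
    C.invProj (a • ξ) = Coalgebra.counit (R := ℂ) a • C.invProj ξ := by
  simp only [invProj, LinearMap.comp_apply, C.coactL_smul]
  induction C.coactL ξ with
  | zero => simp
  | add x y hx hy => rw [map_add, map_add, map_add, hx, hy, smul_add]
  | tmul z η =>
    have h := HopfAlgebra.sum_antipode_mul_eq_algebraMap_counit (R := ℂ)
      (Coalgebra.Repr.arbitrary ℂ a)
    conv_lhs => rw [← (Coalgebra.Repr.arbitrary ℂ a).eq]
    simp only [map_sum, LinearMap.sum_apply, TensorProduct.map₂_apply_tmul, leftAct,
      TensorProduct.lift.tmul, LinearMap.comp_apply, AlgHom.toLinearMap_apply,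
      TensorProduct.map_tmul, Algebra.lsmul_coe, LinearMap.mul_apply',
      HopfAlgebra.antipode_mul_antidistrib, smul_smul, mul_assoc, ← Finset.sum_smul,
      ← Finset.mul_sum]
    rw [h, ← Algebra.commutes, ← smul_smul, algebraMap_smul]

/-- The coordinates `Γ → A ⊗ Γ_inv`, `ξ ↦ ξ⁽⁻¹⁾ ⊗ π_inv(ξ⁽⁰⁾)`, with respect to `Γ = A Γ_inv`. -/
def coord : Γ →ₗ[ℂ] A ⊗[ℂ] Γ := C.invProj.lTensor A ∘ₗ C.coactL

theorem coord_smul (a : A) (ξ : Γ) :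
    C.coord (a • ξ) = (LinearMap.mulLeft ℂ a).rTensor Γ (C.coord ξ) := by
  simp only [coord, LinearMap.comp_apply, C.coactL_smul]
  induction C.coactL ξ with
  | zero => simp
  | add x y hx hy => rw [map_add, map_add, map_add, map_add, hx, hy]
  | tmul z η =>
    have h := congrArg (TensorProduct.rid ℂ A)
      (Coalgebra.sum_tmul_counit_eq (R := ℂ) (Coalgebra.Repr.arbitrary ℂ a))
    simp only [map_sum, TensorProduct.rid_tmul, one_smul] at h
    conv_lhs => rw [← (Coalgebra.Repr.arbitrary ℂ a).eq]
    simp only [map_sum, LinearMap.sum_apply, TensorProduct.map₂_apply_tmul, leftAct,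
      AlgHom.toLinearMap_apply, TensorProduct.map_tmul, Algebra.lsmul_coe, LinearMap.mul_apply',
      LinearMap.lTensor_tmul, LinearMap.rTensor_tmul, invProj_smul, TensorProduct.tmul_smul,
      TensorProduct.smul_tmul', ← smul_mul_assoc, ← TensorProduct.sum_tmul, ← Finset.sum_mul, h,
      LinearMap.mulLeft_apply]

/-- Left multiplication by a form on `A ⊗ Γ_inv^⊗`: `ξ (a ⊗ t) = b ⊗ ϑ t` if `ξ a` has the
coordinates `b ⊗ ϑ`. -/
def formMul : Γ →ₗ[ℂ] Module.End ℂ (A ⊗[ℂ] TensorAlgebra ℂ Γ) where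
  toFun ξ := joinHead.lTensor A ∘ₗ
    (TensorProduct.assoc ℂ A Γ (TensorAlgebra ℂ Γ)).toLinearMap ∘ₗ
      (C.coord ∘ₗ rightAct A Γ ξ).rTensor (TensorAlgebra ℂ Γ)
  map_add' ξ η := by
    simp only [map_add, LinearMap.comp_add, LinearMap.rTensor_add]
  map_smul' c ξ := by
    simp only [map_smul, LinearMap.comp_smul, LinearMap.rTensor_smul, RingHom.id_apply]

theorem formMul_tmul (ξ : Γ) (a : A) (t : TensorAlgebra ℂ Γ) :
    C.formMul ξ (a ⊗ₜ t) = joinHead.lTensor A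
      (TensorProduct.assoc ℂ A Γ (TensorAlgebra ℂ Γ) (C.coord (MulOpposite.op a • ξ) ⊗ₜ t)) :=
  rfl

/-- The representation of `Γ^⊗` on `A ⊗ Γ_inv^⊗` by left multiplication. -/
def leftMul : TensorBundle A Γ →ₐ[ℂ] Module.End ℂ (A ⊗[ℂ] TensorAlgebra ℂ Γ) :=
  TensorBundle.lift
    (AlgHom.ofLinearMap (LinearMap.rTensorHom (TensorAlgebra ℂ Γ) ∘ₗ LinearMap.mul ℂ A)
      (by ext; simp) (fun a b => by ext; simp [mul_assoc]))
    C.formMul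
    (fun a ξ => by
      refine TensorProduct.ext' fun b t => ?_
      simp only [AlgHom.ofLinearMap_apply, LinearMap.comp_apply, Module.End.mul_apply, formMul_tmul,
        ← smul_comm a (MulOpposite.op b) ξ, coord_smul]
      induction C.coord (MulOpposite.op b • ξ) with
      | zero => simp
      | add x y hx hy => simp only [map_add, TensorProduct.add_tmul, hx, hy]
      | tmul z η => simp)
    (fun a ξ => by
      refine TensorProduct.ext' fun b t => ?_
      simp [formMul_tmul, mul_smul])

/-- The natural identification `Γ^⊗ → A ⊗ Γ_inv^⊗`. -/
def toInv : TensorBundle A Γ →ₗ[ℂ] A ⊗[ℂ] TensorAlgebra ℂ Γ :=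
  LinearMap.applyₗ (1 : A ⊗[ℂ] TensorAlgebra ℂ Γ) ∘ₗ C.leftMul.toLinearMap

variable (A Γ) in
/-- The natural identification `A ⊗ Γ_inv^⊗ → Γ^⊗`, `a ⊗ ϑ₁ ⋯ ϑ_n ↦ a ϑ₁ ⋯ ϑ_n`. -/
def ofInv : A ⊗[ℂ] TensorAlgebra ℂ Γ →ₗ[ℂ] TensorBundle A Γ :=
  TensorProduct.lift ((LinearMap.mul ℂ (TensorBundle A Γ)).compl₁₂ (TensorBundle.incl A Γ).toLinearMap
    (TensorAlgebra.lift ℂ (TensorBundle.form A Γ)).toLinearMap)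

/-- The total antisymmetrizer `A = ⊕ A_n : Γ^⊗ → Γ^⊗`, `A_n = ∑_{p ∈ S_n} (-1)^p σ_p`.  All the maps
`σ_p` are left `A`-linear, and given by the flip-over operator on left-invariant elements. -/
def antisymmetrizer : Module.End ℂ (TensorBundle A Γ) :=
  ofInv A Γ ∘ₗ (tensorAntisymmetrizer C.flipOver).lTensor A ∘ₗ C.toInv

/-- The ideal `S^∨ = ker A`; the bicovariant exterior algebra is `Γ^∨ = Γ^⊗ / S^∨`. -/
def exteriorIdeal : Submodule ℂ (TensorBundle A Γ) := LinearMap.ker C.antisymmetrizer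

end BicovariantCalculus

end Calculus

/-! ### Smooth functions and differential forms -/

section Manifold

variable (n : ℕ) (N : Type*) [TopologicalSpace N] [ChartedSpace (EuclideanSpace ℝ (Fin n)) N]

/-- The `*`-algebra `S(N)` of smooth complex functions on an `n`-dimensional manifold `N`. -/
def Smooth : StarSubalgebra ℂ (N → ℂ) where
  carrier := {f | ContMDiff (𝓡 n) 𝓘(ℝ, ℂ) ∞ f}
  mul_mem' hf hg :=
    ((contDiff_mul (𝕜 := ℝ) (𝔸 := ℂ)).contMDiff).comp (hf.prodMk_space hg)
  add_mem' hf hg := hf.add hg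
  algebraMap_mem' _ := contMDiff_const
  star_mem' hf := (Complex.conjCLE.contDiff.contMDiff).comp hf

/-- All (not necessarily smooth) complex differential forms: at each point `x` an element of the
exterior algebra of the complex vector space of real-linear maps `T_x N → ℂ`. -/
abbrev RoughForms : Type _ :=
  (x : N) → ExteriorAlgebra ℂ (TangentSpace (𝓡 n) x →L[ℝ] ℂ)

/-- A smooth function as a differential form of degree `0`. -/
def roughFn : Smooth n N →ₐ[ℂ] RoughForms n N :=
  (AlgHom.pi fun x => (Algebra.ofId ℂ (ExteriorAlgebra ℂ (TangentSpace (𝓡 n) x →L[ℝ] ℂ))).comp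
    (Pi.evalAlgHom ℂ (fun _ : N => ℂ) x)).comp (Smooth n N).subtype.toAlgHom

variable {n N} in
/-- The differential of a smooth function at a point. -/
def diffAt (f : Smooth n N) (x : N) : TangentSpace (𝓡 n) x →L[ℝ] ℂ :=
  mfderiv (𝓡 n) 𝓘(ℝ, ℂ) (f : N → ℂ) x

theorem diffAt_add (f g : Smooth n N) (x : N) : diffAt (f + g) x = diffAt f x + diffAt g x :=
  mfderiv_add ((f.2 x).mdifferentiableAt (by simp)) ((g.2 x).mdifferentiableAt (by simp))

theorem diffAt_smul (c : ℂ) (f : Smooth n N) (x : N) : diffAt (c • f) x = c • diffAt f x := by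
  have h1 := ((f.2 x).mdifferentiableAt (by simp)).hasMFDerivAt
  have h2 : HasMFDerivAt 𝓘(ℝ, ℂ) 𝓘(ℝ, ℂ) (fun z : ℂ => c • z) ((f : N → ℂ) x)
      (c • ContinuousLinearMap.id ℝ ℂ) :=
    ((hasFDerivAt_id (𝕜 := ℝ) ((f : N → ℂ) x)).const_smul c).hasMFDerivAt
  exact (h2.comp x h1).mfderiv

/-- The differential of a smooth function. -/
def roughD : Smooth n N →ₗ[ℂ] RoughForms n N where
  toFun f x := ExteriorAlgebra.ι ℂ (diffAt f x)
  map_add' f g := by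
    funext x
    rw [diffAt_add, map_add]
    rfl
  map_smul' c f := by
    funext x
    rw [diffAt_smul, map_smul]
    rfl

/-- The forms generated by smooth functions and their differentials. -/
def generatedForms : Subalgebra ℂ (RoughForms n N) :=
  Algebra.adjoin ℂ (Set.range (roughFn n N) ∪ Set.range (roughD n N))

/-- The algebra `Ω(N)` of smooth complex differential forms: the forms which are locally sums of
products `f₀ df₁ ∧ ⋯ ∧ df_k` with smooth functions `f_i`. -/
def Forms : Subalgebra ℂ (RoughForms n N) where
  carrier := {w | ∀ x : N, ∃ O ∈ nhds x, ∃ η ∈ generatedForms n N, ∀ y ∈ O, w y = η y}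
  mul_mem' := by
    rintro w w' h h' x
    obtain ⟨O, hO, η, hη, e⟩ := h x
    obtain ⟨O', hO', η', hη', e'⟩ := h' x
    exact ⟨O ∩ O', Filter.inter_mem hO hO', η * η', mul_mem hη hη', fun y hy => by
      rw [Pi.mul_apply, Pi.mul_apply, e y hy.1, e' y hy.2]⟩
  add_mem' := by
    rintro w w' h h' x
    obtain ⟨O, hO, η, hη, e⟩ := h x
    obtain ⟨O', hO', η', hη', e'⟩ := h' x
    exact ⟨O ∩ O', Filter.inter_mem hO hO', η + η', add_mem hη hη', fun y hy => by
      rw [Pi.add_apply, Pi.add_apply, e y hy.1, e' y hy.2]⟩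
  algebraMap_mem' c x := ⟨Set.univ, Filter.univ_mem, algebraMap ℂ _ c,
    (generatedForms n N).algebraMap_mem c, fun _ _ => rfl⟩

theorem generatedForms_le : generatedForms n N ≤ Forms n N :=
  fun η hη _ => ⟨Set.univ, Filter.univ_mem, η, hη, fun _ _ => rfl⟩

/-- The inclusion of the smooth functions, `S(N) = Ω⁰(N) ⊆ Ω(N)`. -/
def formsFn : Smooth n N →ₐ[ℂ] Forms n N :=
  (roughFn n N).codRestrict (Forms n N) fun f =>
    generatedForms_le n N (Algebra.subset_adjoin (Or.inl ⟨f, rfl⟩))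

/-- The differential `d : S(N) → Ω¹(N) ⊆ Ω(N)`. -/
def formsD : Smooth n N →ₗ[ℂ] Forms n N :=
  (roughD n N).codRestrict (Subalgebra.toSubmodule (Forms n N)) fun f =>
    generatedForms_le n N (Algebra.subset_adjoin (Or.inr ⟨f, rfl⟩))

/-- The pointwise parity automorphism. -/
def roughParity : RoughForms n N →ₐ[ℂ] RoughForms n N :=
  AlgHom.pi fun x => (CliffordAlgebra.involute
    (Q := (0 : QuadraticForm ℂ (TangentSpace (𝓡 n) x →L[ℝ] ℂ)))).comp
      (Pi.evalAlgHom ℂ (fun y : N => ExteriorAlgebra ℂ (TangentSpace (𝓡 n) y →L[ℝ] ℂ)) x)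

theorem roughParity_apply (w : RoughForms n N) (x : N) :
    roughParity n N w x = CliffordAlgebra.involute (w x) := rfl

theorem roughParity_mem_generatedForms {η : RoughForms n N} (hη : η ∈ generatedForms n N) :
    roughParity n N η ∈ generatedForms n N := by
  have h : generatedForms n N ≤ (generatedForms n N).comap (roughParity n N) := by
    refine Algebra.adjoin_le ?_
    rintro _ (⟨f, rfl⟩ | ⟨f, rfl⟩)
    · have : roughParity n N (roughFn n N f) = roughFn n N f := by
        funext x
        exact AlgHom.commutes _ _
      change roughParity n N (roughFn n N f) ∈ generatedForms n N
      rw [this]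
      exact Algebra.subset_adjoin (Or.inl ⟨f, rfl⟩)
    · have : roughParity n N (roughD n N f) = -roughD n N f := by
        funext x
        exact CliffordAlgebra.involute_ι _
      change roughParity n N (roughD n N f) ∈ generatedForms n N
      rw [this]
      exact neg_mem (Algebra.subset_adjoin (Or.inr ⟨f, rfl⟩))
  exact h hη

/-- The parity automorphism `w ↦ (-1)^∂w w` of `Ω(N)`. -/
def formsParity : Forms n N →ₐ[ℂ] Forms n N :=
  ((roughParity n N).comp (Forms n N).val).codRestrict (Forms n N) fun w x => by
    obtain ⟨O, hO, η, hη, e⟩ := w.2 x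
    exact ⟨O, hO, _, roughParity_mem_generatedForms n N hη, fun y hy =>
      congrArg CliffordAlgebra.involute (e y hy)⟩

theorem formsParity_formsParity (w : Forms n N) : formsParity n N (formsParity n N w) = w :=
  Subtype.ext (funext fun _ => CliffordAlgebra.involute_involute _)

instance : GradedAlgebra (parityPart (formsParity n N)) :=
  parityGradedAlgebra _ (formsParity_formsParity n N)

variable {N} in
/-- The pull-back of smooth functions along a smooth map. -/
def Smooth.pullback {N' : Type*} [TopologicalSpace N'] [ChartedSpace (EuclideanSpace ℝ (Fin n)) N']
    (h : N → N') (hh : ContMDiff (𝓡 n) (𝓡 n) ∞ h) : Smooth n N' →ₐ[ℂ] Smooth n N where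
  toFun f := ⟨fun x => (f : N' → ℂ) (h x), f.2.comp hh⟩
  map_one' := rfl
  map_mul' _ _ := rfl
  map_zero' := rfl
  map_add' _ _ := rfl
  commutes' _ := rfl

end Manifold

/-! ### Locally trivial quantum principal bundles over classical manifolds -/

section Bundle

open TopologicalSpace (Opens)

variable (n : ℕ) (M : Type*) [TopologicalSpace M] [ChartedSpace (EuclideanSpace ℝ (Fin n)) M]

variable {M} in
/-- The restriction of functions from `M` to an open subset. -/
def res (U : Opens M) : Smooth n M →ₐ[ℂ] Smooth n U :=
  Smooth.pullback n (Subtype.val : U → M) contMDiff_subtype_val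

variable {M} in
/-- The restriction of functions to a smaller open set. -/
def resLE {U V : Opens M} (h : U ≤ V) : Smooth n V →ₐ[ℂ] Smooth n U :=
  Smooth.pullback n (Opens.inclusion h) (contMDiff_inclusion h)

variable (A : Type*) [Ring A] [StarRing A] [HopfAlgebra ℂ A] [StarModule ℂ A]
  (B : Type*) [Ring B] [StarRing B] [Algebra ℂ B] [StarModule ℂ B]

/-- A quantum principal `G`-bundle `P = (B, i, F)` over the manifold `M`. -/
structure QuantumPrincipalBundle where
  i : Smooth n M →⋆ₐ[ℂ] B
  F : B →⋆ₐ[ℂ] B ⊗[ℂ] A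
  injective : Function.Injective i
  mem_range_iff : ∀ b : B, b ∈ Set.range i ↔ F b = b ⊗ₜ[ℂ] (1 : A)
  counit : ∀ b : B, (Coalgebra.counit (R := ℂ) (A := A)).lTensor B (F b) = b ⊗ₜ[ℂ] (1 : ℂ)
  coassoc : ∀ b : B, (Coalgebra.comul (R := ℂ) (A := A)).lTensor B (F b) =
    TensorProduct.assoc ℂ B A A ((F : B →ₗ[ℂ] B ⊗[ℂ] A).rTensor A (F b))
  free : ∀ y : B ⊗[ℂ] A, y ∈ Submodule.span ℂ {z : B ⊗[ℂ] A | ∃ q b : B, z = (q ⊗ₜ[ℂ] 1) * F b}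

variable {n M A B} (P : QuantumPrincipalBundle n M A B)

/-- A local trivialization of `P` over the open set `U`: a `*`-homomorphism
`π_U : B → S(U) ⊗ A`, compatible with the inclusions of functions on the base and with the right
actions of `G`, which restricts to a bijection between `i(S_c(U)) B` and `S_c(U) ⊗ A`. -/
structure IsLocalTrivialization (U : Opens M) (π : B →⋆ₐ[ℂ] Smooth n U ⊗[ℂ] A) : Prop where
  base : ∀ f : Smooth n M, π (P.i f) = res n U f ⊗ₜ[ℂ] (1 : A)
  covariant : ∀ b : B, (Coalgebra.comul (R := ℂ) (A := A)).lTensor (Smooth n U) (π b) =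
    TensorProduct.assoc ℂ (Smooth n U) A A
      ((π : B →ₗ[ℂ] Smooth n U ⊗[ℂ] A).rTensor A (P.F b))
  injective : ∀ f : Smooth n M, tsupport (f : M → ℂ) ⊆ U → ∀ b : B, π b = 0 → P.i f * b = 0
  surjective : ∀ f : Smooth n M, tsupport (f : M → ℂ) ⊆ U → ∀ a : A,
    ∃ b : B, π b = res n U f ⊗ₜ[ℂ] a

/-- `P` is locally trivial. -/
def IsLocallyTrivial : Prop :=
  ∀ x : M, ∃ U : Opens M, x ∈ U ∧
    ∃ π : B →⋆ₐ[ℂ] Smooth n U ⊗[ℂ] A, IsLocalTrivialization P U π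

/-- A trivialization system `τ = (π_U)_{U ∈ 𝒰}`, with an open cover `𝒰` of `M`. -/
structure TrivializationSystem where
  cover : Set (Opens M)
  iSup_eq_top : sSup cover = ⊤
  triv : ∀ U : cover, B →⋆ₐ[ℂ] Smooth n (U : Opens M) ⊗[ℂ] A
  isLocalTrivialization : ∀ U : cover, IsLocalTrivialization P U (triv U)

/-- `ψ` is the transition function `ψ_{UV} : S(U ∩ V) ⊗ A → S(U ∩ V) ⊗ A` from `π_V` to `π_U`: the
`S(U ∩ V)`-linear homomorphism with `ψ_{UV} (π_V(b)|_{U ∩ V}) = π_U(b)|_{U ∩ V}`. -/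
def IsTransitionFunction {U V : Opens M} (πU : B →⋆ₐ[ℂ] Smooth n U ⊗[ℂ] A)
    (πV : B →⋆ₐ[ℂ] Smooth n V ⊗[ℂ] A)
    (ψ : Smooth n (U ⊓ V : Opens M) ⊗[ℂ] A →ₐ[Smooth n (U ⊓ V : Opens M)]
      Smooth n (U ⊓ V : Opens M) ⊗[ℂ] A) : Prop :=
  ∀ b : B, ψ ((resLE n (inf_le_right : U ⊓ V ≤ V)).toLinearMap.rTensor A (πV b)) =
    (resLE n (inf_le_left : U ⊓ V ≤ U)).toLinearMap.rTensor A (πU b)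

end Bundle

/-! ### Compatibility of an ideal with the transition functions -/

section Compatibility

open TopologicalSpace (Opens)

variable {A Γ : Type*} [Ring A] [StarRing A] [HopfAlgebra ℂ A] [StarModule ℂ A] [AddCommGroup Γ]
  [Module ℂ Γ] [Module A Γ] [Module Aᵐᵒᵖ Γ] [IsScalarTower ℂ A Γ] [IsScalarTower ℂ Aᵐᵒᵖ Γ]
  [SMulCommClass A Aᵐᵒᵖ Γ] (C : BicovariantCalculus A Γ)
  {n : ℕ} {N : Type*} [TopologicalSpace N] [ChartedSpace (EuclideanSpace ℝ (Fin n)) N]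

variable (A Γ n N) in
/-- The graded tensor product `Ω(N) ⊗̂ Γ^⊗`, with the product
`(α ⊗ x)(β ⊗ y) = (-1)^{∂x ∂β} αβ ⊗ xy`. -/
abbrev FormsTensor : Type _ :=
  GradedTensorProduct ℂ (parityPart (formsParity n N)) (parityPart (TensorBundle.parity A Γ))

variable (A Γ n N) in
/-- The elements of the algebraic tensor product as elements of `Ω(N) ⊗̂ Γ^⊗`. -/
def toFormsTensor : Forms n N ⊗[ℂ] TensorBundle A Γ ≃ₗ[ℂ] FormsTensor A Γ n N :=
  GradedTensorProduct.of ℂ (parityPart (formsParity n N)) (parityPart (TensorBundle.parity A Γ))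

/-- `Φ` is the homomorphism `φ^⊗ : Γ^⊗ → Ω(N) ⊗̂ Γ^⊗` which extends a given map
`φ : A → S(N) ⊗ A` and satisfies `φ^⊗(da) = (d ⊗ id + id ⊗ d) φ(a)`.  There is at most one such
homomorphism, since `Γ^⊗` is generated by `A` and `dA`. -/
structure IsTensorExtension (φ : A → Smooth n N ⊗[ℂ] A)
    (Φ : TensorBundle A Γ →ₐ[ℂ] FormsTensor A Γ n N) : Prop where
  map_incl : ∀ a : A, Φ (TensorBundle.incl A Γ a) = toFormsTensor A Γ n N
    (TensorProduct.map (formsFn n N).toLinearMap (TensorBundle.incl A Γ).toLinearMap (φ a))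
  map_d : ∀ a : A, Φ (TensorBundle.form A Γ (C.d a)) = toFormsTensor A Γ n N
    (TensorProduct.map (formsD n N) (TensorBundle.incl A Γ).toLinearMap (φ a) +
      TensorProduct.map (formsFn n N).toLinearMap (TensorBundle.form A Γ ∘ₗ C.d) (φ a))

variable {M : Type*} [TopologicalSpace M] [ChartedSpace (EuclideanSpace ℝ (Fin n)) M]
  {B : Type*} [Ring B] [StarRing B] [Algebra ℂ B] [StarModule ℂ B]

/-- `N` is compatible with all transition functions of the bundle `P`:
`φ_{UV}^⊗(N) ⊆ Ω(U ∩ V) ⊗̂ N` for each trivialization system `τ = (π_U)_{U ∈ 𝒰}` and all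
`U, V ∈ 𝒰` with `U ∩ V ≠ ∅`, where `φ_{UV}` is the restriction of the transition function `ψ_{UV}`
to `A`. -/
def IsCompatible (P : QuantumPrincipalBundle n M A B) (N : Submodule ℂ (TensorBundle A Γ)) :
    Prop :=
  ∀ (τ : TrivializationSystem P) (U V : τ.cover),
    ((U : Opens M) ⊓ (V : Opens M) : Opens M) ≠ ⊥ →
    ∀ ψ, IsTransitionFunction (τ.triv U) (τ.triv V) ψ →
    ∀ Φ : TensorBundle A Γ →ₐ[ℂ] FormsTensor A Γ n ((U : Opens M) ⊓ (V : Opens M) : Opens M),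
      IsTensorExtension C (fun a => ψ (1 ⊗ₜ a)) Φ →
    ∀ x ∈ N, Φ x ∈ Submodule.map
      (toFormsTensor A Γ n ((U : Opens M) ⊓ (V : Opens M) : Opens M)).toLinearMap
      (LinearMap.range (N.subtype.lTensor (Forms n ((U : Opens M) ⊓ (V : Opens M) : Opens M))))

end Compatibility

end QPB

/-! For X in lie(G_cl) let R_X(a) = X(a⁽¹⁾)a⁽²⁾ be the derivation of A generated by X. Because the
right ideal of the calculus is admissible, there is an A-bimodule map χ_X : Γ → A with χ_X(da) =
R_X(a) (`exists_isContraction`). Because this ideal is the largest admissible one, a left-invariant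
form killed by all χ_X is zero (`eq_zero_of_contractions`). Each χ_X extends to an antiderivation
ι_X of Γ^⊗ which vanishes on A.

Compatibility with all transition functions forces N to be stable under every ι_X
(`contraction_mem_of_isCompatible`). The functional X integrates to characters exp(tX) of A. For a
real smooth function h on M, a local trivialization can be twisted by x ↦ exp(h(x)X), and the result
is again a local trivialization (`IsLocalTrivialization.twist`). The transition function between the
two is a ↦ exp(hX)(a⁽¹⁾) ⊗ a⁽²⁾, and its extension to forms is x ↦ G(x) + dh G(ι_X x), where G(x) =
exp(hX)(x⁽⁻¹⁾) ⊗ x⁽⁰⁾. Left covariance of N puts G(x) into Ω ⊗ N, so for x in N the term dh G(ι_X x)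
lies there as well. At a point where h = 0 and dh ≠ 0, a functional which reads off the coefficient
of dh turns this term into ι_X x.

The rest is algebra on left-invariant tensors, to which left covariance reduces the claim. In degree
n + 1, the antiderivation ι_X is χ_X ⊗ id applied to the alternating sum of cycles Z = ∑ (-1)^i σ_0
⋯ σ_{i-1} (`contraction_fromTensors`). By the coset decomposition of S_{n+1}, the antisymmetrizer is
A_{n+1} = (id ⊗ A_n) Z with the same Z (`degreeAntisymmetrizer_succ`). If A_n kills the
left-invariant parts of N in degree n, then χ_X ⊗ A_n kills Z y for every left-invariant y in N of
degree n + 1 and every X. As the χ_X separate left-invariant forms, A_{n+1} y = 0. The induction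
starts from N⁰ = 0. -/

namespace QPB

/-! ### Convolution by a representation and its inverse -/

section Convolution

variable {A M : Type*} [Ring A] [HopfAlgebra ℂ A] [AddCommGroup M] [Module ℂ M]

/-- The convolution `a ↦ ρ(a⁽¹⁾) f(a⁽²⁾)` of a representation with a linear map. -/
def conv (ρ : A →ₐ[ℂ] Module.End ℂ M) (f : A →ₗ[ℂ] M) : A →ₗ[ℂ] M :=
  TensorProduct.lift (ρ.toLinearMap.compl₂ f) ∘ₗ Coalgebra.comul

/-- The convolution `a ↦ ρ(κ(a⁽¹⁾)) f(a⁽²⁾)`. -/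
def antiConv (ρ : A →ₐ[ℂ] Module.End ℂ M) (f : A →ₗ[ℂ] M) : A →ₗ[ℂ] M :=
  TensorProduct.lift ((ρ.toLinearMap ∘ₗ HopfAlgebra.antipode ℂ).compl₂ f) ∘ₗ Coalgebra.comul

theorem conv_apply (ρ : A →ₐ[ℂ] Module.End ℂ M) (f : A →ₗ[ℂ] M) (a : A) :
    conv ρ f a = TensorProduct.lift (ρ.toLinearMap.compl₂ f) (Coalgebra.comul a) := rfl

theorem antiConv_apply (ρ : A →ₐ[ℂ] Module.End ℂ M) (f : A →ₗ[ℂ] M) (a : A) :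
    antiConv ρ f a = TensorProduct.lift ((ρ.toLinearMap ∘ₗ HopfAlgebra.antipode ℂ).compl₂ f)
      (Coalgebra.comul a) := rfl

theorem comul_eq_sum (a : A) : Coalgebra.comul (R := ℂ) a =
    ∑ i ∈ (Coalgebra.Repr.arbitrary ℂ a).index, (Coalgebra.Repr.arbitrary ℂ a).left i ⊗ₜ[ℂ]
      (Coalgebra.Repr.arbitrary ℂ a).right i :=
  (Coalgebra.Repr.arbitrary ℂ a).eq.symm

theorem lift_counit_smul (f : A →ₗ[ℂ] M) (a : A) :
    TensorProduct.lift (((LinearMap.lsmul ℂ M) ∘ₗ Coalgebra.counit (R := ℂ) (A := A)).compl₂ f)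
      (Coalgebra.comul a) = f a := by
  have h := congrArg (f ∘ₗ (TensorProduct.lid ℂ A).toLinearMap)
    (Coalgebra.rTensor_counit_comul (R := ℂ) a)
  have e : TensorProduct.lift (((LinearMap.lsmul ℂ M) ∘ₗ
      Coalgebra.counit (R := ℂ) (A := A)).compl₂ f) =
      (f ∘ₗ (TensorProduct.lid ℂ A).toLinearMap) ∘ₗ
        (Coalgebra.counit (R := ℂ) (A := A)).rTensor A := by
    ext x y; simp
  rw [e, LinearMap.comp_apply, h]
  simp

theorem antipode_mul_eq (ρ : A →ₐ[ℂ] Module.End ℂ M) (a : A) (m : M) :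
    TensorProduct.lift ((LinearMap.mul ℂ (Module.End ℂ M)).compl₁₂
      (ρ.toLinearMap ∘ₗ HopfAlgebra.antipode ℂ) ρ.toLinearMap) (Coalgebra.comul a) m =
      Coalgebra.counit (R := ℂ) a • m := by
  have h := congrArg ρ (HopfAlgebra.mul_antipode_rTensor_comul_apply (R := ℂ) a)
  rw [AlgHom.commutes] at h
  have h' := LinearMap.congr_fun h m
  rw [Module.algebraMap_end_apply] at h'
  rw [← h', comul_eq_sum]
  simp

theorem mul_antipode_eq (ρ : A →ₐ[ℂ] Module.End ℂ M) (a : A) (m : M) :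
    TensorProduct.lift ((LinearMap.mul ℂ (Module.End ℂ M)).compl₁₂
      ρ.toLinearMap (ρ.toLinearMap ∘ₗ HopfAlgebra.antipode ℂ)) (Coalgebra.comul a) m =
      Coalgebra.counit (R := ℂ) a • m := by
  have h := congrArg ρ (HopfAlgebra.mul_antipode_lTensor_comul_apply (R := ℂ) a)
  rw [AlgHom.commutes] at h
  have h' := LinearMap.congr_fun h m
  rw [Module.algebraMap_end_apply] at h'
  rw [← h', comul_eq_sum]
  simp

/-- Iterated convolutions, through coassociativity. -/
theorem lift_comp_lift_comul (φ ψ : A →ₗ[ℂ] Module.End ℂ M) (f : A →ₗ[ℂ] M) (a : A) :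
    TensorProduct.lift (φ.compl₂ (TensorProduct.lift (ψ.compl₂ f) ∘ₗ Coalgebra.comul))
      (Coalgebra.comul a) =
    TensorProduct.lift ((TensorProduct.lift ((LinearMap.mul ℂ (Module.End ℂ M)).compl₁₂ φ ψ) ∘ₗ
      Coalgebra.comul).compl₂ f) (Coalgebra.comul a) := by
  have h := congrArg (TensorProduct.lift (φ.compl₂ (TensorProduct.lift (ψ.compl₂ f))))
    (Coalgebra.coassoc_apply (R := ℂ) a)
  have e : TensorProduct.lift (φ.compl₂ (TensorProduct.lift (ψ.compl₂ f) ∘ₗ Coalgebra.comul)) =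
      TensorProduct.lift (φ.compl₂ (TensorProduct.lift (ψ.compl₂ f))) ∘ₗ
        (Coalgebra.comul (R := ℂ) (A := A)).lTensor A := by
    ext x y; simp
  rw [e, LinearMap.comp_apply, ← h]
  induction Coalgebra.comul (R := ℂ) a with
  | zero => simp
  | add x y hx hy => simp only [map_add, hx, hy]
  | tmul x y =>
    simp only [LinearMap.rTensor_tmul, TensorProduct.lift.tmul, LinearMap.compl₂_apply,
      LinearMap.comp_apply]
    induction Coalgebra.comul (R := ℂ) x with
    | zero => simp
    | add x y hx hy => simp only [map_add, TensorProduct.add_tmul, LinearMap.add_apply, hx, hy]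
    | tmul x y => simp

theorem conv_antiConv (ρ : A →ₐ[ℂ] Module.End ℂ M) (f : A →ₗ[ℂ] M) :
    conv ρ (antiConv ρ f) = f := by
  ext a
  rw [conv_apply, antiConv, lift_comp_lift_comul, ← lift_counit_smul f a]
  congr 2
  ext x m
  simp only [LinearMap.compl₂_apply, LinearMap.comp_apply, LinearMap.lsmul_apply]
  exact mul_antipode_eq ρ x (f m)

theorem antiConv_conv (ρ : A →ₐ[ℂ] Module.End ℂ M) (f : A →ₗ[ℂ] M) :
    antiConv ρ (conv ρ f) = f := by
  ext a
  rw [antiConv_apply, conv, lift_comp_lift_comul, ← lift_counit_smul f a]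
  congr 2
  ext x m
  simp only [LinearMap.compl₂_apply, LinearMap.comp_apply, LinearMap.lsmul_apply]
  exact antipode_mul_eq ρ x (f m)

/-- The main tool for identities which involve κ. Two maps agree if their convolutions do, and
convolution turns κ(a⁽¹⁾)da⁽²⁾ back into da, where the axioms of the calculus apply directly. -/
theorem conv_injective (ρ : A →ₐ[ℂ] Module.End ℂ M) : Function.Injective (conv ρ) :=
  Function.LeftInverse.injective (antiConv_conv ρ)

theorem conv_conv (ρ ρ₁ ρ₂ : A →ₐ[ℂ] Module.End ℂ M) (f : A →ₗ[ℂ] M)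
    (h : ∀ a, ρ a = TensorProduct.lift ((LinearMap.mul ℂ (Module.End ℂ M)).compl₁₂
      ρ₁.toLinearMap ρ₂.toLinearMap) (Coalgebra.comul a)) :
    conv ρ₁ (conv ρ₂ f) = conv ρ f := by
  ext a
  rw [conv_apply, conv, lift_comp_lift_comul, conv_apply]
  congr 3
  ext x : 1
  exact (h x).symm

/-- Convolutions commute with intertwiners. -/
theorem conv_comp {M' : Type*} [AddCommGroup M'] [Module ℂ M'] (ρ : A →ₐ[ℂ] Module.End ℂ M)
    (ρ' : A →ₐ[ℂ] Module.End ℂ M') (T : M →ₗ[ℂ] M') (h : ∀ a m, T (ρ a m) = ρ' a (T m))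
    (f : A →ₗ[ℂ] M) : T ∘ₗ conv ρ f = conv ρ' (T ∘ₗ f) := by
  ext a
  simp only [LinearMap.comp_apply, conv_apply]
  induction Coalgebra.comul (R := ℂ) a with
  | zero => simp
  | add x y hx hy => simp only [map_add, hx, hy]
  | tmul x y => simp [h]

theorem antiConv_comp {M' : Type*} [AddCommGroup M'] [Module ℂ M'] (ρ : A →ₐ[ℂ] Module.End ℂ M)
    (ρ' : A →ₐ[ℂ] Module.End ℂ M') (T : M →ₗ[ℂ] M') (h : ∀ a m, T (ρ a m) = ρ' a (T m))
    (f : A →ₗ[ℂ] M) : T ∘ₗ antiConv ρ f = antiConv ρ' (T ∘ₗ f) := by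
  ext a
  simp only [LinearMap.comp_apply, antiConv_apply]
  induction Coalgebra.comul (R := ℂ) a with
  | zero => simp
  | add x y hx hy => simp only [map_add, hx, hy]
  | tmul x y => simp [h]

/-- The behaviour of `a ↦ ρ(κ(a⁽¹⁾)) f(a⁽²⁾)` on products, for a derivation `f` with values in a
bimodule with the left action `ρ` and the right action `r`. -/
theorem antiConv_derivation (ρ : A →ₐ[ℂ] Module.End ℂ M) (r : A →ₗ[ℂ] Module.End ℂ M)
    (hr : ∀ a b m, ρ a (r b m) = r b (ρ a m)) (f : A →ₗ[ℂ] M)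
    (hf : ∀ a b, f (a * b) = ρ a (f b) + r b (f a)) (a b : A) :
    antiConv ρ f (a * b) = Coalgebra.counit (R := ℂ) a • antiConv ρ f b +
      antiConv ρ (r.flip (antiConv ρ f a)) b := by
  -- Since κ reverses products, the term with f(b⁽²⁾) contains κ(b⁽¹⁾)κ(a⁽¹⁾)a⁽²⁾, which collapses
  -- to ε(a)κ(b⁽¹⁾). In the other term the right action of b⁽²⁾ commutes with κ(a⁽¹⁾), so that
  -- κ(a⁽¹⁾)f(a⁽²⁾) is formed first.
  have h : ∀ m, ∑ i ∈ (Coalgebra.Repr.arbitrary ℂ a).index,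
      ρ (HopfAlgebra.antipode ℂ ((Coalgebra.Repr.arbitrary ℂ a).left i))
        (ρ ((Coalgebra.Repr.arbitrary ℂ a).right i) m) = Coalgebra.counit (R := ℂ) a • m := by
    intro m
    have := antipode_mul_eq ρ a m
    rw [comul_eq_sum] at this
    simpa using this
  simp only [antiConv_apply, Bialgebra.comul_mul]
  rw [comul_eq_sum a]
  induction Coalgebra.comul (R := ℂ) b with
  | zero => simp
  | add x y hx hy => simp only [mul_add, map_add, smul_add, hx, hy]; abel
  | tmul x y =>
    simp only [Finset.sum_mul, map_sum, TensorProduct.lift.tmul, LinearMap.compl₂_apply,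
      LinearMap.comp_apply, AlgHom.toLinearMap_apply, Algebra.TensorProduct.tmul_mul_tmul,
      HopfAlgebra.antipode_mul_antidistrib, map_mul, Module.End.mul_apply, hf, map_add, hr,
      LinearMap.flip_apply, LinearMap.sum_apply, Finset.sum_add_distrib]
    rw [← map_sum, h, map_smul]

end Convolution

/-! ### Convolution by tensor products of representations -/

section TensorRepresentations

variable {A M₁ M₂ : Type*} [Ring A] [HopfAlgebra ℂ A] [AddCommGroup M₁] [Module ℂ M₁]
  [AddCommGroup M₂] [Module ℂ M₂]

/-- The tensor product of two representations. -/
def tensorRep (ρ₁ : A →ₐ[ℂ] Module.End ℂ M₁) (ρ₂ : A →ₐ[ℂ] Module.End ℂ M₂) :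
    A →ₐ[ℂ] Module.End ℂ (M₁ ⊗[ℂ] M₂) :=
  ((Module.endTensorEndAlgHom (R := ℂ) (S := ℂ) (A := ℂ)).comp
    (Algebra.TensorProduct.map ρ₁ ρ₂)).comp (Bialgebra.comulAlgHom ℂ A)

/-- A representation on the first factor. -/
def firstRep (M₂ : Type*) [AddCommGroup M₂] [Module ℂ M₂] (ρ₁ : A →ₐ[ℂ] Module.End ℂ M₁) :
    A →ₐ[ℂ] Module.End ℂ (M₁ ⊗[ℂ] M₂) :=
  ((Module.endTensorEndAlgHom (R := ℂ) (S := ℂ) (A := ℂ)).comp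
    Algebra.TensorProduct.includeLeft).comp ρ₁

/-- A representation on the second factor. -/
def secondRep (M₁ : Type*) [AddCommGroup M₁] [Module ℂ M₁] (ρ₂ : A →ₐ[ℂ] Module.End ℂ M₂) :
    A →ₐ[ℂ] Module.End ℂ (M₁ ⊗[ℂ] M₂) :=
  ((Module.endTensorEndAlgHom (R := ℂ) (S := ℂ) (A := ℂ)).comp
    Algebra.TensorProduct.includeRight).comp ρ₂

theorem firstRep_tmul (ρ₁ : A →ₐ[ℂ] Module.End ℂ M₁) (a : A) (m : M₁) (m' : M₂) :
    firstRep M₂ ρ₁ a (m ⊗ₜ m') = ρ₁ a m ⊗ₜ m' := by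
  simp [firstRep, Module.endTensorEndAlgHom_apply]

theorem secondRep_tmul (ρ₂ : A →ₐ[ℂ] Module.End ℂ M₂) (a : A) (m : M₁) (m' : M₂) :
    secondRep M₁ ρ₂ a (m ⊗ₜ m') = m ⊗ₜ ρ₂ a m' := by
  simp [secondRep, Module.endTensorEndAlgHom_apply]

theorem tensorRep_apply (ρ₁ : A →ₐ[ℂ] Module.End ℂ M₁) (ρ₂ : A →ₐ[ℂ] Module.End ℂ M₂) (a : A)
    (z : M₁ ⊗[ℂ] M₂) : tensorRep ρ₁ ρ₂ a z =
      TensorProduct.map₂ ρ₁.toLinearMap ρ₂.toLinearMap (Coalgebra.comul a) z := by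
  simp only [tensorRep, AlgHom.comp_apply, Bialgebra.comulAlgHom_apply]
  induction Coalgebra.comul (R := ℂ) a with
  | zero => simp
  | add x y hx hy => simp only [map_add, LinearMap.add_apply, hx, hy]
  | tmul x y =>
    induction z with
    | zero => simp
    | add z w hz hw => rw [map_add, map_add, hz, hw]
    | tmul m m' => simp [Module.endTensorEndAlgHom_apply]

theorem tensorRep_eq_lift (ρ₁ : A →ₐ[ℂ] Module.End ℂ M₁) (ρ₂ : A →ₐ[ℂ] Module.End ℂ M₂) (a : A) :
    tensorRep ρ₁ ρ₂ a = TensorProduct.lift ((LinearMap.mul ℂ (Module.End ℂ (M₁ ⊗[ℂ] M₂))).compl₁₂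
      (firstRep M₂ ρ₁).toLinearMap (secondRep M₁ ρ₂).toLinearMap) (Coalgebra.comul a) := by
  simp only [tensorRep, AlgHom.comp_apply, Bialgebra.comulAlgHom_apply]
  induction Coalgebra.comul (R := ℂ) a with
  | zero => simp
  | add x y hx hy => simp only [map_add, hx, hy]
  | tmul x y =>
    refine TensorProduct.ext' fun m m' => ?_
    simp [firstRep_tmul, secondRep_tmul, Module.endTensorEndAlgHom_apply]

/-- Allows the two tensor factors to be treated one after the other in covariance computations. -/
theorem conv_tensorRep (ρ₁ : A →ₐ[ℂ] Module.End ℂ M₁) (ρ₂ : A →ₐ[ℂ] Module.End ℂ M₂)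
    (f : A →ₗ[ℂ] M₁ ⊗[ℂ] M₂) :
    conv (tensorRep ρ₁ ρ₂) f = conv (firstRep M₂ ρ₁) (conv (secondRep M₁ ρ₂) f) :=
  (conv_conv _ _ _ f (tensorRep_eq_lift ρ₁ ρ₂)).symm

theorem conv_firstRep_rTensor (ρ₁ : A →ₐ[ℂ] Module.End ℂ M₁) (f : A →ₗ[ℂ] M₁) :
    conv (firstRep A ρ₁) (f.rTensor A ∘ₗ Coalgebra.comul) =
      (conv ρ₁ f).rTensor A ∘ₗ Coalgebra.comul := by
  ext a
  have h := congrArg (TensorProduct.lift ((firstRep A ρ₁).toLinearMap.compl₂ (f.rTensor A)))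
    (Coalgebra.coassoc_apply (R := ℂ) a)
  have e : TensorProduct.lift ((firstRep A ρ₁).toLinearMap.compl₂
      (f.rTensor A ∘ₗ Coalgebra.comul)) =
      TensorProduct.lift ((firstRep A ρ₁).toLinearMap.compl₂ (f.rTensor A)) ∘ₗ
        (Coalgebra.comul (R := ℂ) (A := A)).lTensor A := by
    ext x y; simp
  rw [conv_apply, e, LinearMap.comp_apply, ← h, LinearMap.comp_apply]
  induction Coalgebra.comul (R := ℂ) a with
  | zero => simp
  | add x y hx hy => simp only [map_add, hx, hy]
  | tmul x y =>
    simp only [LinearMap.rTensor_tmul, conv_apply]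
    induction Coalgebra.comul (R := ℂ) x with
    | zero => simp
    | add x y hx hy => simp only [map_add, TensorProduct.add_tmul, hx, hy]
    | tmul x y => simp [firstRep_tmul]

theorem antiConv_mem {M : Type*} [AddCommGroup M] [Module ℂ M] {ρ : A →ₐ[ℂ] Module.End ℂ M}
    {S : Submodule ℂ M} (hS : ∀ a, ∀ m ∈ S, ρ a m ∈ S) {f : A →ₗ[ℂ] M} (hf : ∀ a, f a ∈ S)
    (a : A) : antiConv ρ f a ∈ S := by
  rw [antiConv_apply]
  induction Coalgebra.comul (R := ℂ) a with
  | zero => simp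
  | add x y hx hy => simpa only [map_add] using S.add_mem hx hy
  | tmul x y => exact hS _ _ (hf _)

end TensorRepresentations

/-! ### Left-invariant one-forms -/

section InvariantForms

variable {A Γ : Type*} [Ring A] [HopfAlgebra ℂ A] [AddCommGroup Γ] [Module ℂ Γ] [Module A Γ]
  [Module Aᵐᵒᵖ Γ] [IsScalarTower ℂ A Γ] [IsScalarTower ℂ Aᵐᵒᵖ Γ] [SMulCommClass A Aᵐᵒᵖ Γ]

namespace BicovariantCalculus

theorem circ_eq_antiConv (ξ : Γ) :
    circ ξ = antiConv (Algebra.lsmul ℂ ℂ Γ) (rightAct A Γ ξ) := by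
  ext a
  rw [circ, LinearMap.flip_apply, LinearMap.comp_apply, antiConv_apply]
  induction Coalgebra.comul (R := ℂ) a with
  | zero => simp
  | add x y hx hy => simp only [map_add, LinearMap.add_apply, hx, hy]
  | tmul x y =>
    simp only [TensorProduct.lift.tmul, LinearMap.flip_apply, LinearMap.compl₁₂_apply,
      LinearMap.mul_apply', Module.End.mul_apply, LinearMap.comp_apply, LinearMap.compl₂_apply]
    exact (smul_comm _ _ _).symm

/-- `ξ a = a⁽¹⁾ (ξ ∘ a⁽²⁾)`. -/
theorem conv_circ (ξ : Γ) :
    conv (Algebra.lsmul ℂ ℂ Γ) (circ ξ) = rightAct A Γ ξ := by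
  rw [circ_eq_antiConv, conv_antiConv]

variable (C : BicovariantCalculus A Γ)

theorem germ_eq_antiConv : C.germ = antiConv (Algebra.lsmul ℂ ℂ Γ) C.d := rfl

theorem conv_germ : conv (Algebra.lsmul ℂ ℂ Γ) C.germ = C.d := conv_antiConv _ _

theorem d_one : C.d 1 = 0 := by
  have h := C.leibniz 1 1
  simpa using h

theorem germ_one : C.germ 1 = 0 := by
  simp [germ, Algebra.TensorProduct.one_def, d_one]

/-- The space `Γ_inv` of left-invariant forms. -/
def invForms : Submodule ℂ Γ := LinearMap.range C.germ

theorem germ_mul (a b : A) :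
    C.germ (a * b) = Coalgebra.counit (R := ℂ) a • C.germ b + circ (C.germ a) b := by
  rw [circ_eq_antiConv, germ_eq_antiConv]
  exact antiConv_derivation (Algebra.lsmul ℂ ℂ Γ) (rightAct A Γ).flip
    (fun a b m => smul_comm _ _ _) C.d C.leibniz a b

/-- The product rule for π gives π(b) ∘ a = π(ba) − ε(b)π(a). -/
theorem circ_mem_invForms {ϑ : Γ} (h : ϑ ∈ C.invForms) (a : A) : circ ϑ a ∈ C.invForms := by
  obtain ⟨b, rfl⟩ := h
  rw [eq_sub_of_add_eq' (C.germ_mul b a).symm]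
  exact sub_mem ⟨_, rfl⟩ (C.invForms.smul_mem _ ⟨_, rfl⟩)

/-- Both sides have the convolution a ↦ a⁽¹⁾ ⊗ da⁽²⁾ with respect to the tensor product
representation: the left one since ℓ is covariant and a⁽¹⁾π(a⁽²⁾) = da, the right one by convolving
factor by factor. -/
theorem coactL_comp_germ : C.coactL ∘ₗ C.germ = TensorProduct.mk ℂ A Γ 1 ∘ₗ C.germ := by
  apply conv_injective (tensorRep (Algebra.lmul ℂ A) (Algebra.lsmul ℂ ℂ Γ))
  rw [← conv_comp (Algebra.lsmul ℂ ℂ Γ) _ _ fun a m => by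
    rw [tensorRep_apply]; exact C.coactL_smul a m, conv_germ, conv_tensorRep,
    ← conv_comp (Algebra.lsmul ℂ ℂ Γ) _ _ (fun a m => by
      rw [TensorProduct.mk_apply, TensorProduct.mk_apply, secondRep_tmul]), conv_germ]
  ext a
  rw [LinearMap.comp_apply, coactL_d, conv_apply]
  congr 1
  ext x y
  simp [firstRep_tmul]

theorem coactL_of_mem {ϑ : Γ} (h : ϑ ∈ C.invForms) : C.coactL ϑ = 1 ⊗ₜ ϑ := by
  obtain ⟨a, rfl⟩ := h
  exact LinearMap.congr_fun C.coactL_comp_germ a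

theorem invProj_of_mem {ϑ : Γ} (h : ϑ ∈ C.invForms) : C.invProj ϑ = ϑ := by
  simp [invProj, C.coactL_of_mem h, leftAct]

theorem coord_of_mem {ϑ : Γ} (h : ϑ ∈ C.invForms) : C.coord ϑ = 1 ⊗ₜ ϑ := by
  simp [coord, C.coactL_of_mem h, C.invProj_of_mem h]

/-- In Sweedler notation the right side is π(a⁽²⁾) ⊗ κ(a⁽¹⁾)a⁽³⁾. Convolution in the second factor
removes κ(a⁽¹⁾), and convolution in the first then turns π into d, which leaves ℘(da). -/
theorem coactR_comp_germ : C.coactR ∘ₗ C.germ =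
    antiConv (secondRep Γ (Algebra.lmul ℂ A)) (C.germ.rTensor A ∘ₗ Coalgebra.comul) := by
  apply conv_injective (tensorRep (Algebra.lsmul ℂ ℂ Γ) (Algebra.lmul ℂ A))
  rw [← conv_comp (Algebra.lsmul ℂ ℂ Γ) _ _ fun a m => by
    rw [tensorRep_apply]; exact C.coactR_smul a m, conv_germ, conv_tensorRep, conv_antiConv,
    conv_firstRep_rTensor, conv_germ]
  ext a
  rw [LinearMap.comp_apply, coactR_d, LinearMap.comp_apply]

theorem coactR_mem {ϑ : Γ} (h : ϑ ∈ C.invForms) :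
    C.coactR ϑ ∈ Submodule.map₂ (TensorProduct.mk ℂ Γ A) C.invForms ⊤ := by
  obtain ⟨a, rfl⟩ := h
  have e := LinearMap.congr_fun C.coactR_comp_germ a
  rw [LinearMap.comp_apply] at e
  rw [e]
  refine antiConv_mem (fun b m hm => ?_) (fun b => ?_) a
  · have hle : Submodule.map₂ (TensorProduct.mk ℂ Γ A) C.invForms ⊤ ≤ Submodule.comap
        (secondRep Γ (Algebra.lmul ℂ A) b)
        (Submodule.map₂ (TensorProduct.mk ℂ Γ A) C.invForms ⊤) := by
      refine Submodule.map₂_le.2 fun ϑ hϑ c _ => ?_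
      rw [Submodule.mem_comap, TensorProduct.mk_apply, secondRep_tmul]
      exact Submodule.apply_mem_map₂ _ hϑ trivial
    exact hle hm
  · rw [LinearMap.comp_apply]
    induction Coalgebra.comul (R := ℂ) b with
    | zero => simp
    | add x y hx hy => simpa only [map_add] using Submodule.add_mem _ hx hy
    | tmul x y => exact Submodule.apply_mem_map₂ _ ⟨x, rfl⟩ trivial

theorem induction_smul_d {p : Γ → Prop} (zero : p 0) (add : ∀ x y, p x → p y → p (x + y))
    (smul_d : ∀ a b : A, p (a • C.d b)) (ξ : Γ) : p ξ := by
  have h : ξ ∈ Submodule.span ℂ {ξ : Γ | ∃ a b : A, ξ = a • C.d b} := by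
    rw [C.span_eq_top]; trivial
  induction h using Submodule.span_induction with
  | mem x h => obtain ⟨a, b, rfl⟩ := h; exact smul_d a b
  | zero => exact zero
  | add x y _ _ hx hy => exact add x y hx hy
  -- The property is not assumed to be stable under scalars, so the scalar is carried through a
  -- second induction and absorbed at the generators by c(a db) = (ca) db.
  | smul c x hx h =>
    clear h
    induction hx using Submodule.span_induction generalizing c with
    | mem x h => obtain ⟨a, b, rfl⟩ := h; rw [← smul_assoc]; exact smul_d _ b
    | zero => rw [smul_zero]; exact zero
    | add x y _ _ hx hy => rw [smul_add]; exact add _ _ (hx c) (hy c)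
    | smul c' x _ h => rw [smul_smul]; exact h _

/-- On generators, a db = a b⁽¹⁾ π(b⁽²⁾). -/
theorem mem_map₂_invForms (ξ : Γ) :
    ξ ∈ Submodule.map₂ (leftAct A Γ) ⊤ C.invForms := by
  induction ξ using C.induction_smul_d with
  | zero => exact zero_mem _
  | add x y hx hy => exact add_mem hx hy
  | smul_d a b =>
    rw [← C.conv_germ, conv_apply]
    induction Coalgebra.comul (R := ℂ) b with
    | zero => simp
    | add x y hx hy => simpa only [map_add, smul_add] using Submodule.add_mem _ hx hy
    | tmul x y =>
      have : a • (Algebra.lsmul ℂ ℂ Γ x) (C.germ y) = leftAct A Γ (a * x) (C.germ y) :=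
        (mul_smul a x (C.germ y)).symm
      simp only [TensorProduct.lift.tmul, LinearMap.compl₂_apply, AlgHom.toLinearMap_apply]
      rw [this]
      exact Submodule.apply_mem_map₂ _ trivial ⟨y, rfl⟩

/-- The counit law is not an axiom of `BicovariantCalculus`. It holds on the elements a db, because
ℓ extends φ and ε is multiplicative, and these elements span Γ. -/
theorem counit_coactL (ξ : Γ) :
    TensorProduct.lid ℂ Γ ((Coalgebra.counit (R := ℂ) (A := A)).rTensor Γ (C.coactL ξ)) = ξ := by
  induction ξ using C.induction_smul_d with
  | zero => simp
  | add x y hx hy => simp only [map_add, hx, hy]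
  | smul_d a b =>
    have key : ∀ (s : A ⊗[ℂ] A) (z : A ⊗[ℂ] Γ),
        TensorProduct.lid ℂ Γ ((Coalgebra.counit (R := ℂ) (A := A)).rTensor Γ
          (TensorProduct.map₂ (LinearMap.mul ℂ A) (leftAct A Γ) s z)) =
        TensorProduct.lid ℂ A ((Coalgebra.counit (R := ℂ) (A := A)).rTensor A s) •
          TensorProduct.lid ℂ Γ ((Coalgebra.counit (R := ℂ) (A := A)).rTensor Γ z) := by
      intro s z
      induction s with
      | zero => simp
      | add x y hx hy => simp only [map_add, LinearMap.add_apply, hx, hy, add_smul]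
      | tmul x y =>
        induction z with
        | zero => simp
        | add z w hz hw => simp only [map_add, hz, hw, smul_add]
        | tmul u η =>
          simp [leftAct, mul_smul, smul_comm (Coalgebra.counit (R := ℂ) u) y η]
    have hd : TensorProduct.lid ℂ Γ ((Coalgebra.counit (R := ℂ) (A := A)).rTensor Γ
        (C.coactL (C.d b))) = C.d b := by
      have h := congrArg (fun z => C.d (TensorProduct.lid ℂ A z))
        (Coalgebra.rTensor_counit_comul (R := ℂ) b)
      simp only [TensorProduct.lid_tmul, one_smul] at h
      rw [coactL_d]
      conv_rhs => rw [← h]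
      induction Coalgebra.comul (R := ℂ) b with
      | zero => simp
      | add x y hx hy => simp only [map_add, hx, hy]
      | tmul x y => simp
    rw [coactL_smul, key, hd, Coalgebra.rTensor_counit_comul]
    simp

end BicovariantCalculus

end InvariantForms

theorem antiConv_zero {A M : Type*} [Ring A] [HopfAlgebra ℂ A] [AddCommGroup M] [Module ℂ M]
    (ρ : A →ₐ[ℂ] Module.End ℂ M) : antiConv ρ 0 = 0 := by
  have : TensorProduct.lift
      ((ρ.toLinearMap ∘ₗ HopfAlgebra.antipode ℂ).compl₂ (0 : A →ₗ[ℂ] M)) = 0 := by ext; simp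
  ext a
  rw [antiConv_apply, this]
  rfl

/-! ### Vector fields of the classical Lie algebra and the largest admissible ideal -/

section VectorFields

variable {A : Type*} [Ring A] [HopfAlgebra ℂ A]

/-- The right-invariant vector field `a ↦ X(a⁽¹⁾) a⁽²⁾`. -/
def vectorField (X : A →ₗ[ℂ] ℂ) : A →ₗ[ℂ] A :=
  (TensorProduct.lid ℂ A).toLinearMap ∘ₗ X.rTensor A ∘ₗ Coalgebra.comul

theorem vectorField_apply (X : A →ₗ[ℂ] ℂ) (a : A) :
    vectorField X a = TensorProduct.lid ℂ A (X.rTensor A (Coalgebra.comul a)) := rfl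

theorem lid_counit_comul (a : A) : TensorProduct.lid ℂ A
    ((Coalgebra.counit (R := ℂ) (A := A)).rTensor A (Coalgebra.comul a)) = a := by
  rw [Coalgebra.rTensor_counit_comul]; simp

/-- A derivation over the counit gives a derivation of `A`. -/
theorem vectorField_mul {X : A →ₗ[ℂ] ℂ} (hX : ∀ a b : A,
    X (a * b) = Coalgebra.counit (R := ℂ) a * X b + X a * Coalgebra.counit (R := ℂ) b) (a b : A) :
    vectorField X (a * b) = a * vectorField X b + vectorField X a * b := by
  have key : ∀ s t : A ⊗[ℂ] A, TensorProduct.lid ℂ A (X.rTensor A (s * t)) =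
      TensorProduct.lid ℂ A ((Coalgebra.counit (R := ℂ) (A := A)).rTensor A s) *
        TensorProduct.lid ℂ A (X.rTensor A t) +
      TensorProduct.lid ℂ A (X.rTensor A s) *
        TensorProduct.lid ℂ A ((Coalgebra.counit (R := ℂ) (A := A)).rTensor A t) := by
    intro s t
    induction s with
    | zero => simp
    | add x y hx hy => simp only [map_add, add_mul, hx, hy]; abel
    | tmul x y =>
      induction t with
      | zero => simp
      | add x y hx hy => simp only [map_add, mul_add, hx, hy]; abel
      | tmul z w => simp [hX, add_smul, smul_smul, mul_comm]
  rw [vectorField_apply, Bialgebra.comul_mul, key, lid_counit_comul, lid_counit_comul]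
  rfl

theorem map_one_eq_zero {X : A →ₗ[ℂ] ℂ} (hX : ∀ a b : A,
    X (a * b) = Coalgebra.counit (R := ℂ) a * X b + X a * Coalgebra.counit (R := ℂ) b) :
    X 1 = 0 := by
  have h := hX 1 1
  simpa using h

theorem vectorField_one {X : A →ₗ[ℂ] ℂ} (hX : ∀ a b : A,
    X (a * b) = Coalgebra.counit (R := ℂ) a * X b + X a * Coalgebra.counit (R := ℂ) b) :
    vectorField X 1 = 0 := by
  simp [vectorField_apply, Algebra.TensorProduct.one_def, map_one_eq_zero hX]

/-- X consumes only the leftmost Sweedler factor, so this is coassociativity. -/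
theorem comul_vectorField (X : A →ₗ[ℂ] ℂ) (a : A) :
    Coalgebra.comul (R := ℂ) (vectorField X a) =
      (vectorField X).rTensor A (Coalgebra.comul a) := by
  have h := congrArg (fun z => TensorProduct.lid ℂ _ (X.rTensor (A ⊗[ℂ] A) z))
    (Coalgebra.coassoc_apply (R := ℂ) a)
  have h1 : ∀ z : A ⊗[ℂ] A, Coalgebra.comul (R := ℂ) (TensorProduct.lid ℂ A (X.rTensor A z)) =
      TensorProduct.lid ℂ _ (X.rTensor (A ⊗[ℂ] A)
        ((Coalgebra.comul (R := ℂ) (A := A)).lTensor A z)) := by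
    intro z
    induction z with
    | zero => simp
    | add x y hx hy => simp only [map_add, hx, hy]
    | tmul x y => simp
  have h2 : ∀ z : A ⊗[ℂ] A, (vectorField X).rTensor A z =
      TensorProduct.lid ℂ _ (X.rTensor (A ⊗[ℂ] A) (TensorProduct.assoc ℂ A A A
        ((Coalgebra.comul (R := ℂ) (A := A)).rTensor A z))) := by
    intro z
    induction z with
    | zero => simp
    | add x y hx hy => simp only [map_add, hx, hy]
    | tmul x y =>
      rw [LinearMap.rTensor_tmul, LinearMap.rTensor_tmul, vectorField_apply]
      induction Coalgebra.comul (R := ℂ) x with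
      | zero => simp
      | add x y hx hy => simp only [map_add, TensorProduct.add_tmul, hx, hy]
      | tmul x y => simp [TensorProduct.smul_tmul']
  rw [vectorField_apply, h1, h2]
  exact h.symm

/-- `(X ⊗ id) ad` in terms of the vector field of `X`. -/
theorem lid_rTensor_adjointAction (X : A →ₗ[ℂ] ℂ) (a : A) :
    TensorProduct.lid ℂ A (X.rTensor A (adjointAction a)) =
      antiConv (Algebra.lmul ℂ A) (vectorField X) a := by
  have key : ∀ z : A ⊗[ℂ] A, TensorProduct.lid ℂ A (X.rTensor A (TensorProduct.lift
      (LinearMap.lTensorHom A ∘ₗ LinearMap.mul ℂ A ∘ₗ HopfAlgebra.antipode ℂ (A := A))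
        ((Coalgebra.comul (R := ℂ) (A := A)).lTensor A z))) =
      TensorProduct.lift (((Algebra.lmul ℂ A).toLinearMap ∘ₗ HopfAlgebra.antipode ℂ).compl₂
        (vectorField X)) z := by
    intro z
    induction z with
    | zero => simp
    | add x y hx hy => simp only [map_add, hx, hy]
    | tmul x y =>
      simp only [LinearMap.lTensor_tmul, TensorProduct.lift.tmul, LinearMap.compl₂_apply,
        vectorField_apply]
      induction Coalgebra.comul (R := ℂ) y with
      | zero => simp
      | add x y hx hy => simp only [map_add, hx, hy]
      | tmul y w => simp
  exact key _

/-- The right ideal of all elements of `ker ε` which are annihilated by `(X ⊗ id) ad` for all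
`X ∈ lie(G_cl)`. -/
def maximalIdeal (A : Type*) [Ring A] [StarRing A] [HopfAlgebra ℂ A] : Submodule ℂ A :=
  LinearMap.ker (Coalgebra.counit (R := ℂ) (A := A)) ⊓
    ⨅ (X : A →ₗ[ℂ] ℂ) (_ : IsClassicalLie X),
      LinearMap.ker (antiConv (Algebra.lmul ℂ A) (vectorField X))

variable [StarRing A]

theorem mem_maximalIdeal {a : A} : a ∈ maximalIdeal A ↔ Coalgebra.counit (R := ℂ) a = 0 ∧
    ∀ X : A →ₗ[ℂ] ℂ, IsClassicalLie X → antiConv (Algebra.lmul ℂ A) (vectorField X) a = 0 := by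
  simp [maximalIdeal, Submodule.mem_iInf]

theorem isAdmissible_maximalIdeal : IsAdmissible (maximalIdeal A) := fun X hX a ha => by
  apply (TensorProduct.lid ℂ A).injective
  rw [lid_rTensor_adjointAction, (mem_maximalIdeal.1 ha).2 X hX, map_zero]

/-- As R_X is a derivation, κ(·⁽¹⁾)R_X(·⁽²⁾) takes ab to the sum of a multiple of ε(a) and a term
linear in its value at a. Both vanish. -/
theorem mul_mem_maximalIdeal {a : A} (ha : a ∈ maximalIdeal A) (b : A) :
    a * b ∈ maximalIdeal A := by
  rw [mem_maximalIdeal] at ha ⊢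
  refine ⟨by simp [ha.1], fun X hX => ?_⟩
  rw [antiConv_derivation (Algebra.lmul ℂ A) (LinearMap.mul ℂ A).flip
    (fun a b m => (mul_assoc a m b).symm) _ (vectorField_mul hX.map_mul), ha.1, ha.2 X hX, map_zero, antiConv_zero]
  simp

end VectorFields

/-! ### Contraction of one-forms with vector fields -/

section Contractions

variable {A Γ : Type*} [Ring A] [StarRing A] [HopfAlgebra ℂ A] [AddCommGroup Γ] [Module ℂ Γ]
  [Module A Γ]
  [Module Aᵐᵒᵖ Γ] [IsScalarTower ℂ A Γ] [IsScalarTower ℂ Aᵐᵒᵖ Γ] [SMulCommClass A Aᵐᵒᵖ Γ]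

namespace BicovariantCalculus

variable (C : BicovariantCalculus A Γ)

/-- The contraction of one-forms with the right-invariant vector field of `X`: the bimodule map
`χ : Γ → A` with `χ(da) = X(a⁽¹⁾) a⁽²⁾`. -/
structure IsContraction (X : A →ₗ[ℂ] ℂ) (χ : Γ →ₗ[ℂ] A) : Prop where
  map_smul : ∀ (a : A) (ξ : Γ), χ (a • ξ) = a * χ ξ
  map_op_smul : ∀ (a : A) (ξ : Γ), χ (MulOpposite.op a • ξ) = χ ξ * a
  map_d : ∀ a : A, χ (C.d a) = vectorField X a

variable {C}

theorem IsContraction.map_germ {X : A →ₗ[ℂ] ℂ} {χ : Γ →ₗ[ℂ] A} (h : C.IsContraction X χ) (a : A) :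
    χ (C.germ a) = antiConv (Algebra.lmul ℂ A) (vectorField X) a := by
  have := LinearMap.congr_fun (antiConv_comp (Algebra.lsmul ℂ ℂ Γ) (Algebra.lmul ℂ A) χ
    h.map_smul C.d) a
  rw [LinearMap.comp_apply] at this
  rw [germ_eq_antiConv, this]
  congr 2
  exact LinearMap.ext h.map_d

/-- On a db both sides equal φ(a)(R_X ⊗ id)φ(b): the contraction acts on the left Sweedler factor
and ℘ only splits off the right one. -/
theorem IsContraction.comul {X : A →ₗ[ℂ] ℂ} {χ : Γ →ₗ[ℂ] A} (h : C.IsContraction X χ) (ξ : Γ) :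
    Coalgebra.comul (R := ℂ) (χ ξ) = χ.rTensor A (C.coactR ξ) := by
  induction ξ using C.induction_smul_d with
  | zero => simp
  | add x y hx hy => simp only [map_add, hx, hy]
  | smul_d a b =>
    have key : ∀ (s : A ⊗[ℂ] A) (z : Γ ⊗[ℂ] A),
        χ.rTensor A (TensorProduct.map₂ (leftAct A Γ) (LinearMap.mul ℂ A) s z) =
          s * χ.rTensor A z := by
      intro s z
      induction s with
      | zero => simp
      | add x y hx hy => simp only [map_add, LinearMap.add_apply, hx, hy, add_mul]
      | tmul x y =>
        induction z with
        | zero => simp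
        | add z w hz hw => simp only [map_add, hz, hw, mul_add]
        | tmul η u => simp [leftAct, h.map_smul]
    rw [h.map_smul, h.map_d, Bialgebra.comul_mul, comul_vectorField, coactR_smul, key, coactR_d,
      ← LinearMap.comp_apply (χ.rTensor A), ← LinearMap.rTensor_comp]
    congr 3
    exact (LinearMap.ext h.map_d).symm

/-- Both maps vanish at 1, so a may be replaced by a − ε(a)1, which lies in ker ε. There
admissibility applies, through `lid_rTensor_adjointAction`. -/
theorem ideal_le_ker (hC : C.IsMinimalAdmissible) {X : A →ₗ[ℂ] ℂ} (hX : IsClassicalLie X) :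
    LinearMap.ker C.germ ≤ LinearMap.ker (antiConv (Algebra.lmul ℂ A) (vectorField X)) := by
  intro a ha
  rw [LinearMap.mem_ker] at ha ⊢
  have h1 : antiConv (Algebra.lmul ℂ A) (vectorField X) 1 = 0 := by
    simp [antiConv, Algebra.TensorProduct.one_def, vectorField_one hX.map_mul]
  have hmem : a - Coalgebra.counit (R := ℂ) a • (1 : A) ∈ C.ideal := by
    refine ⟨?_, ?_⟩
    · simp
    · change C.germ _ = 0
      rw [map_sub, map_smul, germ_one, ha]
      simp
  have h := congrArg (TensorProduct.lid ℂ A) (hC.admissible X hX _ hmem)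
  rw [lid_rTensor_adjointAction, map_zero, map_sub, map_smul, h1, smul_zero, sub_zero] at h
  exact h

theorem exists_comp_eq_of_ker_le {V W Z : Type*} [AddCommGroup V] [Module ℂ V] [AddCommGroup W]
    [Module ℂ W] [AddCommGroup Z] [Module ℂ Z] (f : V →ₗ[ℂ] W) (g : V →ₗ[ℂ] Z)
    (h : LinearMap.ker f ≤ LinearMap.ker g) : ∃ L : W →ₗ[ℂ] Z, L ∘ₗ f = g := by
  obtain ⟨L, hL⟩ := LinearMap.exists_extend
    ((LinearMap.ker f).liftQ g h ∘ₗ f.quotKerEquivRange.symm.toLinearMap)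
  refine ⟨L, LinearMap.ext fun v => ?_⟩
  have := LinearMap.congr_fun hL ⟨f v, v, rfl⟩
  rw [LinearMap.comp_apply, Submodule.subtype_apply] at this
  rw [LinearMap.comp_apply, this, LinearMap.comp_apply]
  have e : f.quotKerEquivRange.symm ⟨f v, v, rfl⟩ = (LinearMap.ker f).mkQ v := by
    rw [LinearEquiv.symm_apply_eq]; rfl
  change (LinearMap.ker f).liftQ g h (f.quotKerEquivRange.symm ⟨f v, v, rfl⟩) = g v
  rw [e]
  exact Submodule.liftQ_apply _ _ _

/-- By `ideal_le_ker` the assignment π(a) ↦ κ(a⁽¹⁾)R_X(a⁽²⁾) is well defined, and it is extended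
left A-linearly along Γ = A Γ_inv. The formula on da is a⁽¹⁾κ(a⁽²⁾) = ε(a)1. Right linearity then
follows from the Leibniz rule for R_X and from (a dc)b = a d(cb) − ac db. -/
theorem exists_isContraction (hC : C.IsMinimalAdmissible) {X : A →ₗ[ℂ] ℂ}
    (hX : IsClassicalLie X) : ∃ χ : Γ →ₗ[ℂ] A, C.IsContraction X χ := by
  -- L is extended arbitrarily from π(A) to Γ; only its values on π(A) are used.
  obtain ⟨L, hL⟩ := exists_comp_eq_of_ker_le _ _ (ideal_le_ker hC hX)
  have h1 : ∀ (a : A) (ξ : Γ), TensorProduct.lift ((LinearMap.mul ℂ A).compl₂ L)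
      (C.coord (a • ξ)) = a * TensorProduct.lift ((LinearMap.mul ℂ A).compl₂ L) (C.coord ξ) := by
    intro a ξ
    rw [coord_smul]
    induction C.coord ξ with
    | zero => simp
    | add x y hx hy => simp only [map_add, hx, hy, mul_add]
    | tmul x y => simp [mul_assoc]
  have h2 : ∀ b : A, TensorProduct.lift ((LinearMap.mul ℂ A).compl₂ L) (C.coord (C.d b)) =
      vectorField X b := by
    intro b
    have e := LinearMap.congr_fun (conv_antiConv (Algebra.lmul ℂ A) (vectorField X)) b
    rw [← hL, conv_apply] at e
    rw [← e, coord, LinearMap.comp_apply, coactL_d, ← LinearMap.comp_apply (C.invProj.lTensor A),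
      ← LinearMap.lTensor_comp]
    have : C.invProj ∘ₗ C.d = C.germ := by
      ext a
      rw [LinearMap.comp_apply, invProj, LinearMap.comp_apply, coactL_d, germ,
        LinearMap.comp_apply]
      induction Coalgebra.comul (R := ℂ) a with
      | zero => simp
      | add x y hx hy => simp only [map_add, hx, hy]
      | tmul x y => simp
    rw [this]
    induction Coalgebra.comul (R := ℂ) b with
    | zero => simp
    | add x y hx hy => simp only [map_add, hx, hy]
    | tmul x y => simp
  refine ⟨TensorProduct.lift ((LinearMap.mul ℂ A).compl₂ L) ∘ₗ C.coord, h1, fun b ξ => ?_, h2⟩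
  simp only [LinearMap.comp_apply]
  induction ξ using C.induction_smul_d with
  | zero => simp
  | add x y hx hy => simp only [map_add, smul_add, hx, hy, add_mul]
  | smul_d a c =>
    have e : MulOpposite.op b • a • C.d c = a • C.d (c * b) - (a * c) • C.d b := by
      rw [C.leibniz, smul_add, ← smul_comm a (MulOpposite.op b), mul_smul]; abel
    rw [e, map_sub, map_sub, h1, h1, h2, h1, h2, h2, vectorField_mul hX.map_mul]
    noncomm_ring

/-- For ϑ = π(a), the vanishing of all contractions says that a − ε(a)1 belongs to `maximalIdeal`.
This is an admissible right ideal inside ker ε, hence contained in the ideal of the calculus by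
maximality, and π vanishes there. -/
theorem eq_zero_of_contractions (hC : C.IsMinimalAdmissible) {ϑ : Γ} (hϑ : ϑ ∈ C.invForms)
    (h : ∀ X : A →ₗ[ℂ] ℂ, IsClassicalLie X → ∀ χ : Γ →ₗ[ℂ] A, C.IsContraction X χ → χ ϑ = 0) :
    ϑ = 0 := by
  obtain ⟨a, rfl⟩ := hϑ
  have hmem : a - Coalgebra.counit (R := ℂ) a • (1 : A) ∈ maximalIdeal A := by
    refine mem_maximalIdeal.2 ⟨by simp, fun X hX => ?_⟩
    obtain ⟨χ, hχ⟩ := exists_isContraction hC hX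
    rw [map_sub, map_smul, ← hχ.map_germ, ← hχ.map_germ, germ_one, map_zero, smul_zero, sub_zero,
      h X hX χ hχ]
  have := (hC.minimal _ (fun a ha b => mul_mem_maximalIdeal ha b) inf_le_left
    isAdmissible_maximalIdeal hmem).2
  have h0 : C.germ (a - Coalgebra.counit (R := ℂ) a • (1 : A)) = 0 := this
  rwa [map_sub, map_smul, germ_one, smul_zero, sub_zero] at h0

end BicovariantCalculus

end Contractions

/-! ### Coset decomposition of S_{n+1} and factorization of the antisymmetrizer -/

section Shuffles

open Equiv

/-- The permutation `(0 1 … i) ↦` followed by a permutation of `{1, …, n}`. -/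
def cyclePerm {n : ℕ} (q : Fin (n + 1) × Perm (Fin n)) : Perm (Fin (n + 1)) :=
  Perm.decomposeFin.symm (0, q.2) * Fin.cycleRange q.1

theorem cyclePerm_inv_zero {n : ℕ} (q : Fin (n + 1) × Perm (Fin n)) :
    (cyclePerm q)⁻¹ 0 = q.1 := by
  rw [Perm.inv_eq_iff_eq, cyclePerm, Perm.mul_apply, Fin.cycleRange_self,
    Perm.decomposeFin_symm_apply_zero]

theorem cyclePerm_tail {n : ℕ} (q : Fin (n + 1) × Perm (Fin n)) :
    (Perm.decomposeFin (cyclePerm q * (Fin.cycleRange ((cyclePerm q)⁻¹ 0))⁻¹)).2 = q.2 := by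
  rw [cyclePerm_inv_zero, cyclePerm, mul_inv_cancel_right, Equiv.apply_symm_apply]

theorem cyclePerm_injective {n : ℕ} : Function.Injective (cyclePerm (n := n)) := fun q q' h =>
  Prod.ext (by rw [← cyclePerm_inv_zero q, h, cyclePerm_inv_zero])
    (by rw [← cyclePerm_tail q, h, cyclePerm_tail])

/-- The cycles represent the cosets of the stabilizer of 0. Given injectivity, it is enough to
count: (n+1)! = (n+1) · n!. -/
theorem cyclePerm_bijective {n : ℕ} : Function.Bijective (cyclePerm (n := n)) := by
  rw [Fintype.bijective_iff_injective_and_card]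
  refine ⟨cyclePerm_injective, ?_⟩
  rw [Fintype.card_prod, Fintype.card_perm, Fintype.card_perm, Fintype.card_fin, Fintype.card_fin,
    Nat.factorial_succ]

/-- The chosen minimal words respect the coset decomposition. Thus the operators σ_p factor
accordingly, without any appeal to the braid relation. -/
theorem permWord_cyclePerm {n : ℕ} (q : Fin (n + 1) × Perm (Fin n)) :
    permWord (n + 1) (cyclePerm q) = (permWord n q.2).map (· + 1) ++ List.range q.1 := by
  rw [permWord, cyclePerm_tail, cyclePerm_inv_zero]

theorem sign_cyclePerm {n : ℕ} (q : Fin (n + 1) × Perm (Fin n)) :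
    Perm.sign (cyclePerm q) = Perm.sign q.2 * (-1) ^ (q.1 : ℕ) := by
  rw [cyclePerm, Perm.sign_mul, Fin.sign_cycleRange, Perm.decomposeFin.symm_sign]
  simp

variable {V : Type*} [AddCommGroup V] [Module ℂ V]

theorem joinHead_tmul (v : V) (t : TensorAlgebra ℂ V) :
    joinHead (v ⊗ₜ t) = TensorAlgebra.ι ℂ v * t := rfl

theorem splitHead_joinHead (z : V ⊗[ℂ] TensorAlgebra ℂ V) : splitHead (joinHead z) = z := by
  induction z with
  | zero => simp
  | add x y hx hy => simp only [map_add, hx, hy]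
  | tmul v t => exact splitHead_ι_mul v t

theorem joinHead_splitHead {t : TensorAlgebra ℂ V} (h : t ∈ LinearMap.range (joinHead (V := V))) :
    joinHead (splitHead t) = t := by
  obtain ⟨z, rfl⟩ := h
  rw [splitHead_joinHead]

theorem tailMap_joinHead (f : Module.End ℂ (TensorAlgebra ℂ V)) (z : V ⊗[ℂ] TensorAlgebra ℂ V) :
    tailMap f (joinHead z) = joinHead (f.lTensor V z) := by
  rw [tailMap, LinearMap.add_apply, LinearMap.comp_apply joinHead, LinearMap.comp_apply (f.lTensor V),
    splitHead_joinHead, add_eq_right]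
  -- It remains to see that the scalar summand of `tailMap` vanishes on tensors which have a first
  -- factor.
  induction z with
  | zero => simp
  | add x y hx hy => rw [map_add, map_add, hx, hy, add_zero]
  | tmul v t => simp [joinHead_tmul, TensorAlgebra.algebraMapInv]

variable (s : Module.End ℂ (V ⊗[ℂ] V))

theorem twistAt_mem (k : ℕ) {t : TensorAlgebra ℂ V} (h : t ∈ LinearMap.range (joinHead (V := V))) :
    twistAt s k t ∈ LinearMap.range (joinHead (V := V)) := by
  obtain ⟨z, rfl⟩ := h
  cases k with
  | zero => exact ⟨_, rfl⟩
  | succ k => exact ⟨_, (tailMap_joinHead _ z).symm⟩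

/-- The product of the twists along a word. -/
def wordTwist (w : List ℕ) : Module.End ℂ (TensorAlgebra ℂ V) := (w.map (twistAt s)).prod

theorem wordTwist_mem (w : List ℕ) {t : TensorAlgebra ℂ V}
    (h : t ∈ LinearMap.range (joinHead (V := V))) :
    wordTwist s w t ∈ LinearMap.range (joinHead (V := V)) := by
  induction w with
  | nil => simpa [wordTwist] using h
  | cons k w ih =>
    rw [wordTwist, List.map_cons, List.prod_cons]
    exact twistAt_mem s k ih

theorem wordTwist_map_succ (w : List ℕ) (z : V ⊗[ℂ] TensorAlgebra ℂ V) :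
    wordTwist s (w.map (· + 1)) (joinHead z) = joinHead ((wordTwist s w).lTensor V z) := by
  induction w with
  | nil =>
    have : (wordTwist s []) = LinearMap.id := rfl
    rw [this, LinearMap.lTensor_id]; rfl
  | cons k w ih =>
    have h1 : wordTwist s ((k :: w).map (· + 1)) =
      tailMap (twistAt s k) * wordTwist s (w.map (· + 1)) := rfl
    have h2 : wordTwist s (k :: w) = twistAt s k ∘ₗ wordTwist s w := rfl
    rw [h1, Module.End.mul_apply, ih, tailMap_joinHead, h2, LinearMap.lTensor_comp]
    rfl

theorem wordTwist_append (v w : List ℕ) : wordTwist s (v ++ w) = wordTwist s v * wordTwist s w := by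
  simp [wordTwist]

/-- The alternating sum `∑_{i < n} (-1)^i σ_0 ⋯ σ_{i-1}` over the cycles which move the factor number
`i` to the front. -/
def cycleSum (n : ℕ) : Module.End ℂ (TensorAlgebra ℂ V) :=
  ∑ i ∈ Finset.range n, ((-1 : ℤ) ^ i) • wordTwist s (List.range i)

theorem cycleSum_mem (n : ℕ) {t : TensorAlgebra ℂ V}
    (h : t ∈ LinearMap.range (joinHead (V := V))) :
    cycleSum s n t ∈ LinearMap.range (joinHead (V := V)) := by
  rw [cycleSum, LinearMap.sum_apply]
  exact sum_mem fun i _ => zsmul_mem (wordTwist_mem s _ h) _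

/-- The term i = 0 gives the first summand. Every other word 0, 1, …, i is the letter 0 followed by
the shifted word 0, …, i−1, and shifted words act behind the first factor; the additional sign is
the minus. This is the recursion obeyed by an antiderivation on a product with a one-form. -/
theorem cycleSum_succ (n : ℕ) (v : V) (t : TensorAlgebra ℂ V) :
    cycleSum s (n + 1) (TensorAlgebra.ι ℂ v * t) = TensorAlgebra.ι ℂ v * t -
      headTwist s (TensorAlgebra.ι ℂ v * cycleSum s n t) := by
  have h : ∀ i, wordTwist s (List.range (i + 1)) (TensorAlgebra.ι ℂ v * t) =
      headTwist s (TensorAlgebra.ι ℂ v * wordTwist s (List.range i) t) := by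
    intro i
    have h1 : wordTwist s (List.range (i + 1)) =
        headTwist s * wordTwist s ((List.range i).map (· + 1)) := by
      rw [List.range_succ_eq_map]; rfl
    rw [h1, Module.End.mul_apply, ← joinHead_tmul, wordTwist_map_succ]
    rfl
  rw [cycleSum, Finset.sum_range_succ', LinearMap.add_apply, LinearMap.sum_apply, cycleSum,
    LinearMap.sum_apply, Finset.mul_sum, map_sum, add_comm, sub_eq_add_neg, ← Finset.sum_neg_distrib]
  congr 1
  · simp [wordTwist]
  · refine Finset.sum_congr rfl fun i _ => ?_
    rw [LinearMap.smul_apply, h, LinearMap.smul_apply, mul_smul_comm, map_zsmul, pow_succ, mul_neg_one,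
      neg_smul]

/-- The factorization of the antisymmetrizers. -/
theorem degreeAntisymmetrizer_succ (n : ℕ) (z : V ⊗[ℂ] TensorAlgebra ℂ V) :
    degreeAntisymmetrizer s (n + 1) (joinHead z) = joinHead
      ((degreeAntisymmetrizer s n).lTensor V (splitHead (cycleSum s (n + 1) (joinHead z)))) := by
  -- The cycle acts first and keeps the tensor in positive degree, so the shifted word of the
  -- remaining permutation acts on all factors after the first.
  have h : ∀ q : Fin (n + 1) × Perm (Fin n), permTwist s (n + 1) (cyclePerm q) (joinHead z) =
      joinHead ((permTwist s n q.2).lTensor V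
        (splitHead (wordTwist s (List.range q.1) (joinHead z)))) := by
    intro q
    have h1 : permTwist s (n + 1) (cyclePerm q) =
        wordTwist s ((permWord n q.2).map (· + 1)) * wordTwist s (List.range q.1) := by
      rw [← wordTwist_append, ← permWord_cyclePerm]; rfl
    rw [h1, Module.End.mul_apply]
    conv_lhs => rw [← joinHead_splitHead (wordTwist_mem s (List.range q.1) ⟨z, rfl⟩)]
    rw [wordTwist_map_succ]
    rfl
  have hl : (degreeAntisymmetrizer s n).lTensor V = ∑ r : Perm (Fin n),
      (Perm.sign r : ℤ) • (permTwist s n r).lTensor V := by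
    change LinearMap.lTensorHom V (degreeAntisymmetrizer s n) = _
    rw [degreeAntisymmetrizer, map_sum]
    exact Finset.sum_congr rfl fun r _ => map_zsmul _ _ _
  rw [degreeAntisymmetrizer, LinearMap.sum_apply, ← cyclePerm_bijective.sum_comp,
    Fintype.sum_prod_type, cycleSum, LinearMap.sum_apply, map_sum, map_sum, map_sum,
    ← Fin.sum_univ_eq_sum_range fun i => joinHead ((degreeAntisymmetrizer s n).lTensor V
      (splitHead ((((-1 : ℤ) ^ i) • wordTwist s (List.range i)) (joinHead z))))]
  refine Finset.sum_congr rfl fun i _ => ?_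
  rw [hl, LinearMap.sum_apply, map_sum]
  refine Finset.sum_congr rfl fun r _ => ?_
  rw [LinearMap.smul_apply, h, sign_cyclePerm, LinearMap.smul_apply, LinearMap.smul_apply]
  simp only [map_zsmul]
  rw [smul_smul]
  simp

theorem headTwist_ι_mul_ι_mul (v w : V) (t : TensorAlgebra ℂ V) :
    headTwist s (TensorAlgebra.ι ℂ v * (TensorAlgebra.ι ℂ w * t)) =
      joinHead (joinHead.lTensor V (TensorProduct.assoc ℂ V V _ (s (v ⊗ₜ w) ⊗ₜ t))) := by
  simp [headTwist, splitHead_ι_mul]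

theorem tensorAntisymmetrizer_of_mem {n : ℕ} {t : TensorAlgebra ℂ V}
    (h : t ∈ (LinearMap.range (TensorAlgebra.ι ℂ : V →ₗ[ℂ] TensorAlgebra ℂ V)) ^ n) :
    tensorAntisymmetrizer s t = degreeAntisymmetrizer s n t := by
  change DirectSum.toModule ℂ ℕ _ _ (DirectSum.decompose _ t) = _
  rw [DirectSum.decompose_of_mem _ h]
  exact DirectSum.toModule_lof ℂ n _

end Shuffles

/-! ### Antiderivations of Γ^⊗ and left-invariant tensors -/

section TensorContraction

variable {A Γ : Type*} [Ring A] [HopfAlgebra ℂ A] [AddCommGroup Γ] [Module ℂ Γ]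
  [Module A Γ]
  [Module Aᵐᵒᵖ Γ] [IsScalarTower ℂ A Γ] [IsScalarTower ℂ Aᵐᵒᵖ Γ] [SMulCommClass A Aᵐᵒᵖ Γ]

namespace TensorBundle

theorem parity_incl (a : A) : parity A Γ (incl A Γ a) = incl A Γ a := lift_incl _ _ _ _ a

theorem parity_form (ξ : Γ) : parity A Γ (form A Γ ξ) = -form A Γ ξ := lift_form _ _ _ _ ξ

/-- The representation of `Γ^⊗` by triangular matrices which encodes an antiderivation. -/
def contractionMatrix (χ : Γ →ₗ[ℂ] A) (hl : ∀ (a : A) (ξ : Γ), χ (a • ξ) = a * χ ξ)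
    (hr : ∀ (a : A) (ξ : Γ), χ (MulOpposite.op a • ξ) = χ ξ * a) :
    TensorBundle A Γ →ₐ[ℂ] Matrix (Fin 2) (Fin 2) (TensorBundle A Γ) :=
  lift
    ((Matrix.diagonalAlgHom (n := Fin 2) ℂ).comp (AlgHom.pi fun _ => incl A Γ))
    { toFun := fun ξ => !![-form A Γ ξ, incl A Γ (χ ξ); 0, form A Γ ξ]
      map_add' := fun ξ η => by
        ext i j; fin_cases i <;> fin_cases j <;> simp [add_comm]
      map_smul' := fun c ξ => by
        ext i j; fin_cases i <;> fin_cases j <;> simp }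
    (fun a ξ => by
      ext i j; fin_cases i <;> fin_cases j <;> simp [hl, incl_mul_form])
    (fun a ξ => by
      ext i j; fin_cases i <;> fin_cases j <;> simp [hr, form_mul_incl])

/-- The antiderivation of `Γ^⊗` which vanishes on `A` and extends a bimodule map `Γ → A`. -/
def contraction (χ : Γ →ₗ[ℂ] A) (hl : ∀ (a : A) (ξ : Γ), χ (a • ξ) = a * χ ξ)
    (hr : ∀ (a : A) (ξ : Γ), χ (MulOpposite.op a • ξ) = χ ξ * a) :
    TensorBundle A Γ →ₗ[ℂ] TensorBundle A Γ where
  toFun x := contractionMatrix χ hl hr x 0 1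
  map_add' x y := by simp
  map_smul' c x := by simp

variable (χ : Γ →ₗ[ℂ] A) (hl : ∀ (a : A) (ξ : Γ), χ (a • ξ) = a * χ ξ)
    (hr : ∀ (a : A) (ξ : Γ), χ (MulOpposite.op a • ξ) = χ ξ * a)

theorem contractionMatrix_incl (a : A) :
    contractionMatrix χ hl hr (incl A Γ a) = Matrix.diagonal fun _ => incl A Γ a :=
  lift_incl _ _ _ _ a

theorem contractionMatrix_form (ξ : Γ) :
    contractionMatrix χ hl hr (form A Γ ξ) =
      !![-form A Γ ξ, incl A Γ (χ ξ); 0, form A Γ ξ] :=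
  lift_form _ _ _ _ ξ

theorem contraction_incl (a : A) : contraction χ hl hr (incl A Γ a) = 0 := by
  change contractionMatrix χ hl hr (incl A Γ a) 0 1 = 0
  simp [contractionMatrix_incl]

theorem contraction_form (ξ : Γ) : contraction χ hl hr (form A Γ ξ) = incl A Γ (χ ξ) := by
  change contractionMatrix χ hl hr (form A Γ ξ) 0 1 = _
  simp [contractionMatrix_form]

/-- An induction principle for `Γ^⊗`. -/
theorem induction_on {p : TensorBundle A Γ → Prop} (incl' : ∀ a, p (incl A Γ a))
    (form' : ∀ ξ, p (form A Γ ξ)) (add : ∀ x y, p x → p y → p (x + y))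
    (mul : ∀ x y, p x → p y → p (x * y)) (x : TensorBundle A Γ) : p x := by
  obtain ⟨t, rfl⟩ := RingQuot.mkAlgHom_surjective ℂ (TensorBundleRel A Γ) x
  change p (mk A Γ t)
  induction t using TensorAlgebra.induction with
  | algebraMap r =>
    have := incl' (algebraMap ℂ A r)
    rw [AlgHom.commutes] at this
    rwa [AlgHom.commutes]
  | ι v =>
    have hx : v = LinearMap.inl ℂ A Γ v.1 + LinearMap.inr ℂ A Γ v.2 := by simp
    rw [hx, map_add, map_add]
    exact add _ _ (incl' v.1) (form' v.2)
  | mul a b ha hb => rw [map_mul]; exact mul _ _ ha hb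
  | add a b ha hb => rw [map_add]; exact add _ _ ha hb

theorem contractionMatrix_apply (x : TensorBundle A Γ) :
    contractionMatrix χ hl hr x = !![parity A Γ x, contraction χ hl hr x; 0, x] := by
  have h : contractionMatrix χ hl hr x 0 0 = parity A Γ x ∧
      contractionMatrix χ hl hr x 1 0 = 0 ∧ contractionMatrix χ hl hr x 1 1 = x := by
    induction x using induction_on with
    | incl' a => simp [contractionMatrix_incl, parity_incl]
    | form' ξ => simp [contractionMatrix_form, parity_form]
    | add x y hx hy => simp [hx, hy]
    | mul x y hx hy => simp [Matrix.mul_apply, Fin.sum_univ_two, hx, hy]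
  ext i j
  fin_cases i <;> fin_cases j
  · exact h.1
  · rfl
  · exact h.2.1
  · exact h.2.2

/-- The matrices with rows (parity x, ι x) and (0, x) multiply by the graded Leibniz rule in the
upper right corner. -/
theorem contraction_mul (x y : TensorBundle A Γ) : contraction χ hl hr (x * y) =
    contraction χ hl hr x * y + parity A Γ x * contraction χ hl hr y := by
  change contractionMatrix χ hl hr (x * y) 0 1 = _
  rw [map_mul, contractionMatrix_apply, contractionMatrix_apply]
  simp [Matrix.mul_apply, Fin.sum_univ_two, add_comm]

end TensorBundle

namespace BicovariantCalculus

open TensorBundle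

variable (C : BicovariantCalculus A Γ)

variable (A Γ) in
/-- The homomorphism from the tensor algebra of the vector space `Γ` to `Γ^⊗`. -/
def fromTensors : TensorAlgebra ℂ Γ →ₐ[ℂ] TensorBundle A Γ := TensorAlgebra.lift ℂ (form A Γ)

theorem fromTensors_ι (ξ : Γ) : fromTensors A Γ (TensorAlgebra.ι ℂ ξ) = form A Γ ξ :=
  TensorAlgebra.lift_ι_apply _ _

/-- The tensors of degree `n` over the left-invariant forms. -/
def invTensors (n : ℕ) : Submodule ℂ (TensorAlgebra ℂ Γ) :=
  (C.invForms.map (TensorAlgebra.ι ℂ)) ^ n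

theorem ι_mul_mem_invTensors {n : ℕ} {ϑ : Γ} (hϑ : ϑ ∈ C.invForms) {t : TensorAlgebra ℂ Γ}
    (ht : t ∈ C.invTensors n) : TensorAlgebra.ι ℂ ϑ * t ∈ C.invTensors (n + 1) := by
  rw [invTensors, pow_succ']
  exact Submodule.mul_mem_mul ⟨ϑ, hϑ, rfl⟩ ht

theorem invTensors_induction {p : ℕ → TensorAlgebra ℂ Γ → Prop}
    (one : p 0 1) (smul : ∀ (c : ℂ) n t, p n t → p n (c • t))
    (add : ∀ n x y, p n x → p n y → p n (x + y))
    (ι_mul : ∀ n, ∀ ϑ ∈ C.invForms, ∀ t ∈ C.invTensors n, p n t →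
      p (n + 1) (TensorAlgebra.ι ℂ ϑ * t)) :
    ∀ n, ∀ t ∈ C.invTensors n, p n t := by
  intro n
  induction n with
  | zero =>
    intro t ht
    rw [invTensors, pow_zero, Submodule.mem_one] at ht
    obtain ⟨c, rfl⟩ := ht
    rw [Algebra.algebraMap_eq_smul_one]
    exact smul _ _ _ one
  | succ n ih =>
    intro t ht
    rw [invTensors, pow_succ'] at ht
    induction ht using Submodule.mul_induction_on' with
    | mem_mul_mem a ha b hb =>
      obtain ⟨ϑ, hϑ, rfl⟩ := ha
      exact ι_mul n ϑ hϑ b hb (ih b hb)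
    | add x _ y _ hx hy => exact add _ _ _ hx hy

theorem invTensors_le (n : ℕ) : C.invTensors n ≤
    (LinearMap.range (TensorAlgebra.ι ℂ : Γ →ₗ[ℂ] TensorAlgebra ℂ Γ)) ^ n :=
  pow_le_pow_left' (LinearMap.map_le_range) n

theorem toInv_incl_mul (a : A) (x : TensorBundle A Γ) :
    C.toInv (incl A Γ a * x) = (LinearMap.mulLeft ℂ a).rTensor _ (C.toInv x) := by
  simp only [toInv, LinearMap.comp_apply, AlgHom.toLinearMap_apply, map_mul,
    LinearMap.applyₗ_apply_apply, Module.End.mul_apply]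
  rw [leftMul, lift_incl]
  rfl

theorem toInv_form_mul (ξ : Γ) (x : TensorBundle A Γ) :
    C.toInv (form A Γ ξ * x) = C.formMul ξ (C.toInv x) := by
  simp only [toInv, LinearMap.comp_apply, AlgHom.toLinearMap_apply, map_mul,
    LinearMap.applyₗ_apply_apply, Module.End.mul_apply]
  rw [leftMul, lift_form]

theorem toInv_one : C.toInv 1 = 1 ⊗ₜ 1 := by
  simp [toInv, Algebra.TensorProduct.one_def]

theorem toInv_fromTensors {n : ℕ} {t : TensorAlgebra ℂ Γ} (ht : t ∈ C.invTensors n) :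
    C.toInv (fromTensors A Γ t) = 1 ⊗ₜ t := by
  refine C.invTensors_induction (p := fun _ t => C.toInv (fromTensors A Γ t) = 1 ⊗ₜ t) ?_ ?_ ?_ ?_
    n t ht
  · rw [map_one, toInv_one]
  · intro c n t h
    rw [map_smul, map_smul, h, TensorProduct.tmul_smul]
  · intro n x y hx hy
    rw [map_add, map_add, hx, hy, TensorProduct.tmul_add]
  · intro n ϑ hϑ t _ h
    rw [map_mul, fromTensors_ι, toInv_form_mul, h, formMul_tmul, MulOpposite.op_one, one_smul,
      C.coord_of_mem hϑ]
    rfl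

theorem toInv_incl_mul_fromTensors (a : A) {n : ℕ} {t : TensorAlgebra ℂ Γ}
    (ht : t ∈ C.invTensors n) : C.toInv (incl A Γ a * fromTensors A Γ t) = a ⊗ₜ t := by
  rw [toInv_incl_mul, C.toInv_fromTensors ht]
  simp

theorem tensorCoactL_incl (a : A) : C.tensorCoactL (incl A Γ a) =
    (incl A Γ).toLinearMap.lTensor A (Coalgebra.comul a) := by
  rw [tensorCoactL, lift_incl]
  rfl

theorem tensorCoactL_form (ξ : Γ) : C.tensorCoactL (form A Γ ξ) =
    (form A Γ).lTensor A (C.coactL ξ) := by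
  rw [tensorCoactL, lift_form]
  rfl

theorem tensorCoactL_fromTensors {n : ℕ} {t : TensorAlgebra ℂ Γ} (ht : t ∈ C.invTensors n) :
    C.tensorCoactL (fromTensors A Γ t) = 1 ⊗ₜ fromTensors A Γ t := by
  refine C.invTensors_induction (p := fun _ t => C.tensorCoactL (fromTensors A Γ t) =
    1 ⊗ₜ fromTensors A Γ t) ?_ ?_ ?_ ?_ n t ht
  · rw [map_one, map_one]; rfl
  · intro c n t h
    rw [map_smul, map_smul, h, TensorProduct.tmul_smul]
  · intro n x y hx hy
    rw [map_add, map_add, hx, hy, TensorProduct.tmul_add]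
  · intro n ϑ hϑ t _ h
    rw [map_mul, map_mul, h, fromTensors_ι, tensorCoactL_form, C.coactL_of_mem hϑ]
    simp

/-- The subspace of `Γ^⊗` spanned by the products `a t` with `a ∈ A` and a left-invariant tensor `t`
of degree `n`. -/
theorem degree_le (n : ℕ) : degree A Γ n ≤
    LinearMap.range (incl A Γ).toLinearMap * (C.invTensors n).map (fromTensors A Γ).toLinearMap := by
  set a : Submodule ℂ (TensorBundle A Γ) := LinearMap.range (incl A Γ).toLinearMap with ha
  set f : Submodule ℂ (TensorBundle A Γ) := LinearMap.range (form A Γ) with hf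
  have hmap : (C.invTensors n).map (fromTensors A Γ).toLinearMap =
      (C.invForms.map (form A Γ)) ^ n := by
    rw [invTensors, Submodule.map_pow]
    congr 1
    rw [← Submodule.map_comp]
    congr 1
    exact LinearMap.ext fun ξ => fromTensors_ι ξ
  set q : Submodule ℂ (TensorBundle A Γ) := C.invForms.map (form A Γ) with hq
  have haa : a * a ≤ a := by
    rw [Submodule.mul_le]
    rintro _ ⟨x, rfl⟩ _ ⟨y, rfl⟩
    exact ⟨x * y, map_mul (incl A Γ) x y⟩
  have hfa : f * a ≤ f := by
    rw [Submodule.mul_le]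
    rintro _ ⟨x, rfl⟩ _ ⟨y, rfl⟩
    exact ⟨_, (form_mul_incl A Γ y x).symm⟩
  have hfq : f ≤ a * q := by
    rintro _ ⟨ξ, rfl⟩
    have hle : Submodule.map₂ (leftAct A Γ) ⊤ C.invForms ≤ (a * q).comap (form A Γ) := by
      refine Submodule.map₂_le.2 fun x _ ϑ hϑ => ?_
      rw [Submodule.mem_comap]
      have : form A Γ (leftAct A Γ x ϑ) = incl A Γ x * form A Γ ϑ := (incl_mul_form A Γ x ϑ).symm
      rw [this]
      exact Submodule.mul_mem_mul ⟨x, rfl⟩ ⟨ϑ, hϑ, rfl⟩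
    exact hle (C.mem_map₂_invForms ξ)
  have h1 : (1 : Submodule ℂ (TensorBundle A Γ)) ≤ a := by
    rw [Submodule.one_le]
    exact ⟨1, map_one (incl A Γ)⟩
  -- Coefficients are moved to the left one factor at a time: the right action absorbs them into the
  -- next form (ΓA ⊆ Γ), and Γ ⊆ A Γ_inv extracts them again on the left.
  have hpow : ∀ n : ℕ, f ^ n ≤ a * q ^ n := by
    intro n
    induction n with
    | zero => simpa using h1
    | succ n ih =>
      calc f ^ (n + 1) = f * f ^ n := pow_succ' f n
        _ ≤ f * (a * q ^ n) := mul_le_mul' le_rfl ih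
        _ = (f * a) * q ^ n := (mul_assoc _ _ _).symm
        _ ≤ f * q ^ n := mul_le_mul' hfa le_rfl
        _ ≤ (a * q) * q ^ n := mul_le_mul' hfq le_rfl
        _ = a * q ^ (n + 1) := by rw [pow_succ', mul_assoc]
  rw [hmap, degree]
  calc a * f ^ n ≤ a * (a * q ^ n) := mul_le_mul' le_rfl (hpow n)
    _ = (a * a) * q ^ n := (mul_assoc _ _ _).symm
    _ ≤ a * q ^ n := mul_le_mul' haa le_rfl

theorem degree_induction {n : ℕ} {p : TensorBundle A Γ → Prop}
    (add : ∀ x y, p x → p y → p (x + y))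
    (mul : ∀ a : A, ∀ t ∈ C.invTensors n, p (incl A Γ a * fromTensors A Γ t))
    {x : TensorBundle A Γ} (hx : x ∈ degree A Γ n) : p x := by
  have h := C.degree_le n hx
  clear hx
  induction h using Submodule.mul_induction_on' with
  | mem_mul_mem a ha b hb =>
    obtain ⟨a, rfl⟩ := ha
    obtain ⟨t, ht, rfl⟩ := hb
    exact mul a t ht
  | add x _ y _ hx hy => exact add _ _ hx hy

/-- The left-invariant part of an element, as a tensor. -/
def invPart : TensorBundle A Γ →ₗ[ℂ] TensorAlgebra ℂ Γ :=
  (TensorProduct.lid ℂ _).toLinearMap ∘ₗ (Coalgebra.counit (R := ℂ) (A := A)).rTensor _ ∘ₗ C.toInv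

/-- The projection `x ↦ κ(x⁽⁻¹⁾) x⁽⁰⁾` onto the left-invariant elements. -/
def tensorInvProj : TensorBundle A Γ →ₗ[ℂ] TensorBundle A Γ :=
  TensorProduct.lift ((LinearMap.mul ℂ (TensorBundle A Γ)) ∘ₗ (incl A Γ).toLinearMap ∘ₗ
    HopfAlgebra.antipode ℂ) ∘ₗ C.tensorCoactL.toLinearMap

theorem invPart_incl_mul_fromTensors (a : A) {n : ℕ} {t : TensorAlgebra ℂ Γ}
    (ht : t ∈ C.invTensors n) : C.invPart (incl A Γ a * fromTensors A Γ t) =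
      Coalgebra.counit (R := ℂ) a • t := by
  simp [invPart, C.toInv_incl_mul_fromTensors a ht]

theorem tensorCoactL_incl_mul_fromTensors (a : A) {n : ℕ} {t : TensorAlgebra ℂ Γ}
    (ht : t ∈ C.invTensors n) : C.tensorCoactL (incl A Γ a * fromTensors A Γ t) =
      ((LinearMap.mulRight ℂ (fromTensors A Γ t)) ∘ₗ (incl A Γ).toLinearMap).lTensor A
        (Coalgebra.comul a) := by
  rw [map_mul, tensorCoactL_incl, C.tensorCoactL_fromTensors ht]
  induction Coalgebra.comul (R := ℂ) a with
  | zero => simp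
  | add x y hx hy => simp only [map_add, add_mul, hx, hy]
  | tmul x y => simp

theorem invPart_mem {n : ℕ} {x : TensorBundle A Γ} (hx : x ∈ degree A Γ n) :
    C.invPart x ∈ C.invTensors n := by
  refine C.degree_induction (p := fun x => C.invPart x ∈ C.invTensors n) (fun x y hx hy => ?_)
    (fun a t ht => ?_) hx
  · rw [map_add]; exact add_mem hx hy
  · rw [C.invPart_incl_mul_fromTensors a ht]
    exact Submodule.smul_mem _ _ ht

/-- On a t with t left-invariant both sides are ε(a)t, the right one by κ(a⁽¹⁾)a⁽²⁾ = ε(a)1. The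
left side is suited to the antisymmetrizers, while the right side visibly preserves a left-covariant
ideal. -/
theorem fromTensors_invPart {n : ℕ} {x : TensorBundle A Γ} (hx : x ∈ degree A Γ n) :
    fromTensors A Γ (C.invPart x) = C.tensorInvProj x := by
  refine C.degree_induction (p := fun x => fromTensors A Γ (C.invPart x) = C.tensorInvProj x)
    (fun x y hx hy => ?_) (fun a t ht => ?_) hx
  · rw [map_add, map_add, map_add, hx, hy]
  · rw [C.invPart_incl_mul_fromTensors a ht, tensorInvProj, LinearMap.comp_apply,
      AlgHom.toLinearMap_apply, C.tensorCoactL_incl_mul_fromTensors a ht, map_smul]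
    have h := congrArg (fun b => incl A Γ b * fromTensors A Γ t)
      (HopfAlgebra.mul_antipode_rTensor_comul_apply (R := ℂ) a)
    simp only [AlgHom.commutes, ← Algebra.smul_def] at h
    rw [← h]
    induction Coalgebra.comul (R := ℂ) a with
    | zero => simp
    | add x y hx hy => simp only [map_add, add_mul, hx, hy]
    | tmul x y => simp [mul_assoc]

/-- On a t both sides are a ⊗ t, since a⁽¹⁾ε(a⁽²⁾) = a. Writing the identification with A ⊗ Γ_inv^⊗
through ℓ^⊗ makes left covariance of an ideal applicable to it. -/
theorem lTensor_invPart_tensorCoactL {n : ℕ} {x : TensorBundle A Γ} (hx : x ∈ degree A Γ n) :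
    C.invPart.lTensor A (C.tensorCoactL x) = C.toInv x := by
  refine C.degree_induction (p := fun x => C.invPart.lTensor A (C.tensorCoactL x) = C.toInv x)
    (fun x y hx hy => ?_) (fun a t ht => ?_) hx
  · rw [map_add, map_add, map_add, hx, hy]
  · rw [C.tensorCoactL_incl_mul_fromTensors a ht, C.toInv_incl_mul_fromTensors a ht]
    have h := congrArg (fun z => TensorProduct.rid ℂ A z ⊗ₜ[ℂ] t)
      (Coalgebra.lTensor_counit_comul (R := ℂ) a)
    simp only [TensorProduct.rid_tmul, one_smul] at h
    rw [← h]
    induction Coalgebra.comul (R := ℂ) a with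
    | zero => simp
    | add x y hx hy => simp only [map_add, TensorProduct.add_tmul, hx, hy]
    | tmul x y => simp [C.invPart_incl_mul_fromTensors _ ht, TensorProduct.smul_tmul']

end BicovariantCalculus

end TensorContraction

/-! ### Contractions and the total antisymmetrizer -/

section Antisymmetrizer

variable {A Γ : Type*} [Ring A] [HopfAlgebra ℂ A] [AddCommGroup Γ] [Module ℂ Γ]
  [Module A Γ]
  [Module Aᵐᵒᵖ Γ] [IsScalarTower ℂ A Γ] [IsScalarTower ℂ Aᵐᵒᵖ Γ] [SMulCommClass A Aᵐᵒᵖ Γ]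

namespace BicovariantCalculus

open TensorBundle

variable (C : BicovariantCalculus A Γ)

/-- The flip-over operator after tensoring with a form from the left, on `Γ ⊗ Γ^⊗`. -/
def flipHead (ϑ : Γ) : Γ ⊗[ℂ] TensorAlgebra ℂ Γ →ₗ[ℂ] Γ ⊗[ℂ] TensorAlgebra ℂ Γ :=
  joinHead.lTensor Γ ∘ₗ (TensorProduct.assoc ℂ Γ Γ _).toLinearMap ∘ₗ
    ((C.flipOver ∘ₗ TensorProduct.mk ℂ Γ Γ ϑ).rTensor _)

theorem flipHead_tmul (ϑ η : Γ) (t : TensorAlgebra ℂ Γ) : C.flipHead ϑ (η ⊗ₜ t) =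
    joinHead.lTensor Γ (TensorProduct.assoc ℂ Γ Γ _
      ((circ ϑ).lTensor Γ (C.coactR η) ⊗ₜ t)) := rfl

theorem headTwist_ι_mul_joinHead (ϑ : Γ) (z : Γ ⊗[ℂ] TensorAlgebra ℂ Γ) :
    headTwist C.flipOver (TensorAlgebra.ι ℂ ϑ * joinHead z) = joinHead (C.flipHead ϑ z) := by
  induction z with
  | zero => simp
  | add x y hx hy => simp only [map_add, mul_add, hx, hy]
  | tmul η t => rw [joinHead_tmul, headTwist_ι_mul_ι_mul]; rfl

/-- The tensors `∑ ϑ_i ⊗ t_i` with left-invariant forms `ϑ_i` and left-invariant tensors `t_i` of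
degree `n`. -/
def splitInvTensors (n : ℕ) : Submodule ℂ (Γ ⊗[ℂ] TensorAlgebra ℂ Γ) :=
  Submodule.map₂ (TensorProduct.mk ℂ Γ _) C.invForms (C.invTensors n)

/-- ℘ keeps the first factor of a left-invariant form left-invariant, and Γ_inv is stable under ∘.
-/
theorem flipHead_mem {n : ℕ} {ϑ : Γ} (hϑ : ϑ ∈ C.invForms) {z : Γ ⊗[ℂ] TensorAlgebra ℂ Γ}
    (hz : z ∈ C.splitInvTensors n) : C.flipHead ϑ z ∈ C.splitInvTensors (n + 1) := by
  have hle : C.splitInvTensors n ≤ (C.splitInvTensors (n + 1)).comap (C.flipHead ϑ) := by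
    refine Submodule.map₂_le.2 fun η hη t ht => ?_
    rw [Submodule.mem_comap, TensorProduct.mk_apply, flipHead_tmul]
    have hle' : Submodule.map₂ (TensorProduct.mk ℂ Γ A) C.invForms ⊤ ≤
        (C.splitInvTensors (n + 1)).comap (joinHead.lTensor Γ ∘ₗ
          (TensorProduct.assoc ℂ Γ Γ _).toLinearMap ∘ₗ
            (TensorProduct.mk ℂ _ (TensorAlgebra ℂ Γ)).flip t ∘ₗ (circ ϑ).lTensor Γ) := by
      refine Submodule.map₂_le.2 fun η' hη' c _ => ?_
      exact Submodule.apply_mem_map₂ _ hη'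
        (C.ι_mul_mem_invTensors (C.circ_mem_invForms hϑ c) ht)
    exact hle' (C.coactR_mem hη)
  exact hle hz

/-- The map `η ⊗ t ↦ χ(η) t`. -/
def contractHead (χ : Γ →ₗ[ℂ] A) : Γ ⊗[ℂ] TensorAlgebra ℂ Γ →ₗ[ℂ] TensorBundle A Γ :=
  TensorProduct.lift ((LinearMap.mul ℂ (TensorBundle A Γ)).compl₁₂
    ((incl A Γ).toLinearMap ∘ₗ χ) (fromTensors A Γ).toLinearMap)

theorem contractHead_tmul (χ : Γ →ₗ[ℂ] A) (η : Γ) (t : TensorAlgebra ℂ Γ) :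
    contractHead χ (η ⊗ₜ t) = incl A Γ (χ η) * fromTensors A Γ t := rfl

-- The link between contractions and the braiding. With ℘(η) = ∑ η_k ⊗ c_k, the left side is ∑
-- χ(η_k)(ϑ ∘ c_k) followed by t. As φ(χ(η)) = ∑ χ(η_k) ⊗ c_k, and ξ a = a⁽¹⁾(ξ ∘ a⁽²⁾) in general,
-- this is ϑ χ(η) t.
variable {C} in
theorem IsContraction.contractHead_flipHead [StarRing A] {X : A →ₗ[ℂ] ℂ} {χ : Γ →ₗ[ℂ] A}
    (h : C.IsContraction X χ) (ϑ : Γ) (z : Γ ⊗[ℂ] TensorAlgebra ℂ Γ) :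
    contractHead χ (C.flipHead ϑ z) = form A Γ ϑ * contractHead χ z := by
  induction z with
  | zero => simp
  | add x y hx hy => simp only [map_add, mul_add, hx, hy]
  | tmul η t =>
    have e : form A Γ ϑ * incl A Γ (χ η) = form A Γ (TensorProduct.lift
        ((Algebra.lsmul ℂ ℂ Γ).toLinearMap.compl₂ (circ ϑ)) (χ.rTensor A (C.coactR η))) := by
      rw [form_mul_incl, ← h.comul, ← conv_apply, conv_circ]
      rfl
    rw [flipHead_tmul, contractHead_tmul, ← mul_assoc, e]
    induction C.coactR η with
    | zero => simp
    | add x y hx hy => simp only [map_add, TensorProduct.add_tmul, add_mul, hx, hy]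
    | tmul η' c =>
      simp only [LinearMap.lTensor_tmul, TensorProduct.assoc_tmul, contractHead_tmul,
        joinHead_tmul, LinearMap.rTensor_tmul, TensorProduct.lift.tmul, LinearMap.compl₂_apply,
        AlgHom.toLinearMap_apply, Algebra.lsmul_coe, ← incl_mul_form, map_mul, fromTensors_ι,
        mul_assoc]

/-- The contraction of left-invariant tensors in terms of the sum over the cycles. -/
theorem contraction_fromTensors [StarRing A] (n : ℕ) : ∀ t ∈ C.invTensors (n + 1),
    t ∈ LinearMap.range (joinHead (V := Γ)) ∧
    splitHead (cycleSum C.flipOver (n + 1) t) ∈ C.splitInvTensors n ∧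
    ∀ (X : A →ₗ[ℂ] ℂ) (χ : Γ →ₗ[ℂ] A) (h : C.IsContraction X χ),
      contraction χ h.map_smul h.map_op_smul (fromTensors A Γ t) =
        contractHead χ (splitHead (cycleSum C.flipOver (n + 1) t)) := by
  -- All three assertions are linear in the tensor, so that products of a left-invariant form with a
  -- left-invariant tensor suffice.
  have red : ∀ n, (∀ ϑ ∈ C.invForms, ∀ t ∈ C.invTensors n,
      splitHead (cycleSum C.flipOver (n + 1) (TensorAlgebra.ι ℂ ϑ * t)) ∈ C.splitInvTensors n ∧
      ∀ (X : A →ₗ[ℂ] ℂ) (χ : Γ →ₗ[ℂ] A) (h : C.IsContraction X χ),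
        contraction χ h.map_smul h.map_op_smul (form A Γ ϑ * fromTensors A Γ t) =
          contractHead χ (splitHead (cycleSum C.flipOver (n + 1) (TensorAlgebra.ι ℂ ϑ * t)))) →
      ∀ t ∈ C.invTensors (n + 1), t ∈ LinearMap.range (joinHead (V := Γ)) ∧
        splitHead (cycleSum C.flipOver (n + 1) t) ∈ C.splitInvTensors n ∧
        ∀ (X : A →ₗ[ℂ] ℂ) (χ : Γ →ₗ[ℂ] A) (h : C.IsContraction X χ),
          contraction χ h.map_smul h.map_op_smul (fromTensors A Γ t) =
            contractHead χ (splitHead (cycleSum C.flipOver (n + 1) t)) := by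
    intro n hs t ht
    rw [invTensors, pow_succ'] at ht
    induction ht using Submodule.mul_induction_on' with
    | mem_mul_mem a ha b hb =>
      obtain ⟨ϑ, hϑ, rfl⟩ := ha
      refine ⟨⟨ϑ ⊗ₜ b, rfl⟩, (hs ϑ hϑ b hb).1, fun X χ h => ?_⟩
      rw [map_mul, fromTensors_ι]
      exact (hs ϑ hϑ b hb).2 X χ h
    | add x _ y _ hx hy =>
      refine ⟨add_mem hx.1 hy.1, ?_, fun X χ h => ?_⟩
      · rw [map_add, map_add]; exact add_mem hx.2.1 hy.2.1
      · rw [map_add, map_add, map_add, map_add, map_add, hx.2.2 X χ h, hy.2.2 X χ h]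
  refine red n ?_
  induction n with
  | zero =>
    intro ϑ hϑ t ht
    -- In degree one the sum consists of the trivial cycle alone, as the sum for 0 is empty.
    have e : splitHead (cycleSum C.flipOver (0 + 1) (TensorAlgebra.ι ℂ ϑ * t)) = ϑ ⊗ₜ t := by
      rw [cycleSum_succ]
      simp [cycleSum, splitHead_ι_mul]
    rw [e]
    refine ⟨Submodule.apply_mem_map₂ _ hϑ ht, fun X χ h => ?_⟩
    rw [invTensors, pow_zero, Submodule.mem_one] at ht
    obtain ⟨c, rfl⟩ := ht
    rw [contractHead_tmul, contraction_mul, contraction_form, AlgHom.commutes,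
      ← (incl A Γ).commutes, contraction_incl, mul_zero, add_zero]
  | succ n ih =>
    intro ϑ hϑ t ht
    obtain ⟨hj, hz, hc⟩ := red n ih t ht
    -- This recursion has to be matched with ι(ϑ t) = χ(ϑ)t − ϑ ι(t); `contractHead_flipHead`
    -- identifies the second terms.
    have e : splitHead (cycleSum C.flipOver (n + 1 + 1) (TensorAlgebra.ι ℂ ϑ * t)) =
        ϑ ⊗ₜ t - C.flipHead ϑ (splitHead (cycleSum C.flipOver (n + 1) t)) := by
      rw [cycleSum_succ, map_sub, splitHead_ι_mul]
      congr 1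
      conv_lhs => rw [← joinHead_splitHead (cycleSum_mem C.flipOver (n + 1) hj)]
      rw [headTwist_ι_mul_joinHead, splitHead_joinHead]
    rw [e]
    refine ⟨sub_mem (Submodule.apply_mem_map₂ _ hϑ ht) (C.flipHead_mem hϑ hz), fun X χ h => ?_⟩
    rw [contraction_mul, contraction_form, hc X χ h, map_sub, h.contractHead_flipHead,
      contractHead_tmul, parity_form, neg_mul, sub_eq_add_neg]

theorem eq_zero_of_forall_lTensor {V W : Type*} [AddCommGroup V] [Module ℂ V] [AddCommGroup W]
    [Module ℂ W] {z : V ⊗[ℂ] W}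
    (h : ∀ l : W →ₗ[ℂ] ℂ, TensorProduct.rid ℂ V (l.lTensor V z) = 0) : z = 0 := by
  classical
  let b := Module.Basis.ofVectorSpace ℂ W
  have key : ∀ (z : V ⊗[ℂ] W) i, TensorProduct.equivFinsuppOfBasisRight b z i =
      TensorProduct.rid ℂ V ((b.coord i).lTensor V z) := by
    intro z i
    induction z with
    | zero => simp
    | add x y hx hy => simp only [map_add, Finsupp.add_apply, hx, hy]
    | tmul v w => simp
  apply (TensorProduct.equivFinsuppOfBasisRight b).injective
  ext i
  rw [key, h, map_zero, Finsupp.zero_apply]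

variable [StarRing A]

-- A functional on W commutes with χ and reduces the claim to a single left-invariant form, where
-- `eq_zero_of_contractions` applies.
variable {C} in
theorem eq_zero_of_rTensor_contractions (hC : C.IsMinimalAdmissible) {W : Type*} [AddCommGroup W]
    [Module ℂ W] {z : Γ ⊗[ℂ] W} (hz : z ∈ Submodule.map₂ (TensorProduct.mk ℂ Γ W) C.invForms ⊤)
    (h : ∀ X : A →ₗ[ℂ] ℂ, IsClassicalLie X → ∀ χ : Γ →ₗ[ℂ] A, C.IsContraction X χ →
      χ.rTensor W z = 0) : z = 0 := by
  refine eq_zero_of_forall_lTensor fun l => eq_zero_of_contractions hC ?_ fun X hX χ hχ => ?_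
  · have hle : Submodule.map₂ (TensorProduct.mk ℂ Γ W) C.invForms ⊤ ≤
        C.invForms.comap ((TensorProduct.rid ℂ Γ).toLinearMap ∘ₗ l.lTensor Γ) := by
      refine Submodule.map₂_le.2 fun ϑ hϑ w _ => ?_
      simpa using C.invForms.smul_mem _ hϑ
    exact hle hz
  · have e : ∀ z : Γ ⊗[ℂ] W, χ (TensorProduct.rid ℂ Γ (l.lTensor Γ z)) =
        TensorProduct.rid ℂ A (l.lTensor A (χ.rTensor W z)) := by
      intro z
      induction z with
      | zero => simp
      | add x y hx hy => simp only [map_add, hx, hy]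
      | tmul v w => simp
    rw [e, h X hX χ hχ, map_zero, map_zero]

variable {C}

section Ideal

variable {N : Submodule ℂ (TensorBundle A Γ)}

theorem IsBicovariantGradedIdeal.induction (hN : C.IsBicovariantGradedIdeal N)
    {p : TensorBundle A Γ → Prop} (zero : p 0)
    (add : ∀ x y, p x → p y → p (x + y))
    (mem : ∀ k, ∀ x ∈ N, x ∈ degree A Γ k → p x) {x : TensorBundle A Γ} (hx : x ∈ N) : p x := by
  rw [hN.graded] at hx
  induction hx using Submodule.iSup_induction' with
  | mem i x hx => exact mem i x hx.1 hx.2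
  | zero => exact zero
  | add x y _ _ hx hy => exact add x y hx hy

theorem IsBicovariantGradedIdeal.tensorInvProj_mem (hN : C.IsBicovariantGradedIdeal N)
    {x : TensorBundle A Γ} (hx : x ∈ N) :
    C.tensorInvProj x ∈ N := by
  obtain ⟨w, hw⟩ := hN.left_covariant x hx
  rw [tensorInvProj, LinearMap.comp_apply, AlgHom.toLinearMap_apply, ← hw]
  clear hw
  induction w with
  | zero => simp
  | add x y hx hy => rw [map_add, map_add]; exact add_mem hx hy
  | tmul a y => exact hN.mul_mem_left _ _ y.2

/-- `toInv` is (id ⊗ invPart) ℓ^⊗ and ℓ^⊗(N) ⊆ A ⊗ N, so a map which kills the left-invariant parts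
of N kills the second tensor factor. -/
theorem IsBicovariantGradedIdeal.lTensor_toInv (hN : C.IsBicovariantGradedIdeal N)
    {W : Type*} [AddCommGroup W] [Module ℂ W]
    {f : TensorAlgebra ℂ Γ →ₗ[ℂ] W} (hf : ∀ y ∈ N, f (C.invPart y) = 0) {x : TensorBundle A Γ}
    (hx : x ∈ N) : f.lTensor A (C.toInv x) = 0 := by
  have e : C.invPart.lTensor A (C.tensorCoactL x) = C.toInv x := by
    refine hN.induction (p := fun x => C.invPart.lTensor A (C.tensorCoactL x) = C.toInv x) ?_
      (fun x y hx hy => ?_) (fun k x _ hx => C.lTensor_invPart_tensorCoactL hx) hx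
    · simp
    · simp only [map_add, hx, hy]
  obtain ⟨w, hw⟩ := hN.left_covariant x hx
  have h0 : f ∘ₗ C.invPart ∘ₗ N.subtype = 0 := LinearMap.ext fun y => hf y y.2
  rw [← e, ← hw, ← LinearMap.comp_apply, ← LinearMap.comp_apply, ← LinearMap.lTensor_comp,
    ← LinearMap.lTensor_comp, LinearMap.comp_assoc, h0, LinearMap.lTensor_zero,
    LinearMap.zero_apply]

/-- Induction on the degree. By the factorization of the antisymmetrizer it is enough that id ⊗ A_n
kills the cycle sum z of the left-invariant part of y. Its first factor is left-invariant, so this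
can be tested by contractions, and (χ ⊗ id)z represents a contraction of an element of N, to which
the hypothesis in degree n applies. -/
theorem IsBicovariantGradedIdeal.degreeAntisymmetrizer_eq_zero (hN : C.IsBicovariantGradedIdeal N)
    (hC : C.IsMinimalAdmissible)
    (hN0 : N ⊓ degree A Γ 0 = ⊥)
    (hcontr : ∀ X : A →ₗ[ℂ] ℂ, IsClassicalLie X → ∀ (χ : Γ →ₗ[ℂ] A) (h : C.IsContraction X χ),
      ∀ x ∈ N, contraction χ h.map_smul h.map_op_smul x ∈ N) (n : ℕ) :
    ∀ y ∈ N, y ∈ degree A Γ n → degreeAntisymmetrizer C.flipOver n (C.invPart y) = 0 := by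
  induction n with
  | zero =>
    intro y hy hd
    have : y ∈ N ⊓ degree A Γ 0 := ⟨hy, hd⟩
    rw [hN0, Submodule.mem_bot] at this
    rw [this, map_zero, map_zero]
  | succ n ih =>
    intro y hy hd
    obtain ⟨⟨z₀, hz₀⟩, hz, hc⟩ := C.contraction_fromTensors n _ (C.invPart_mem hd)
    rw [← hz₀, degreeAntisymmetrizer_succ, hz₀]
    set z := splitHead (cycleSum C.flipOver (n + 1) (C.invPart y)) with hzdef
    -- `lTensor_toInv` needs a map which vanishes on the left-invariant parts of all of N, whereas
    -- the induction hypothesis concerns degree n only. Projecting to degree n first makes A_n such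
    -- a map and does not change it on the tensors that occur in z.
    let pr : TensorAlgebra ℂ Γ →ₗ[ℂ] TensorAlgebra ℂ Γ := GradedAlgebra.proj
      (fun n : ℕ => LinearMap.range (TensorAlgebra.ι ℂ : Γ →ₗ[ℂ] TensorAlgebra ℂ Γ) ^ n) n
    have hpr : ∀ t ∈ C.invTensors n, pr t = t := fun t ht =>
      DirectSum.decompose_of_mem_same _ (C.invTensors_le n ht)
    have hpr' : ∀ m ≠ n, ∀ t ∈ C.invTensors m, pr t = 0 := fun m hm t ht =>
      DirectSum.decompose_of_mem_ne _ (C.invTensors_le m ht) hm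
    set f := degreeAntisymmetrizer C.flipOver n ∘ₗ pr with hf
    have hfN : ∀ y ∈ N, f (C.invPart y) = 0 := by
      intro y hy
      refine hN.induction (p := fun y => f (C.invPart y) = 0) (by simp)
        (fun x y hx hy => by rw [map_add, map_add, hx, hy, add_zero]) (fun k x hx hk => ?_) hy
      rw [hf, LinearMap.comp_apply]
      by_cases e : k = n
      · subst e
        rw [hpr _ (C.invPart_mem hk), ih x hx hk]
      · rw [hpr' k e _ (C.invPart_mem hk), map_zero]
    have hfz : (degreeAntisymmetrizer C.flipOver n).lTensor Γ z = f.lTensor Γ z := by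
      have hle : C.splitInvTensors n ≤ LinearMap.eqLocus
          ((degreeAntisymmetrizer C.flipOver n).lTensor Γ) (f.lTensor Γ) := by
        refine Submodule.map₂_le.2 fun ϑ hϑ t ht => ?_
        rw [LinearMap.mem_eqLocus]
        simp [hf, hpr t ht]
      exact hle hz
    have hmem : f.lTensor Γ z ∈ Submodule.map₂ (TensorProduct.mk ℂ Γ _) C.invForms ⊤ := by
      have hle : C.splitInvTensors n ≤
          (Submodule.map₂ (TensorProduct.mk ℂ Γ (TensorAlgebra ℂ Γ)) C.invForms ⊤).comap
            (f.lTensor Γ) := by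
        refine Submodule.map₂_le.2 fun ϑ hϑ t ht => ?_
        exact Submodule.apply_mem_map₂ _ hϑ trivial
      exact hle hz
    have h0 : f.lTensor Γ z = 0 := by
      refine eq_zero_of_rTensor_contractions hC hmem fun X hX χ hχ => ?_
      -- The left-invariant part of y is again in N, hence so is its contraction, whose coordinates
      -- in A ⊗ Γ_inv^⊗ are (χ ⊗ id)z.
      have hmemN := hcontr X hX χ hχ _ (hN.tensorInvProj_mem hy)
      rw [← C.fromTensors_invPart hd, hc X χ hχ] at hmemN
      have hinv : C.toInv (contractHead χ z) = χ.rTensor _ z := by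
        have hle : C.splitInvTensors n ≤ LinearMap.eqLocus
            (C.toInv ∘ₗ contractHead χ) (χ.rTensor _) := by
          refine Submodule.map₂_le.2 fun ϑ hϑ t ht => ?_
          rw [LinearMap.mem_eqLocus, TensorProduct.mk_apply, LinearMap.comp_apply,
            contractHead_tmul, C.toInv_incl_mul_fromTensors _ ht, LinearMap.rTensor_tmul]
        exact hle hz
      have := hN.lTensor_toInv hfN hmemN
      rw [hinv] at this
      rw [← LinearMap.comp_apply, LinearMap.rTensor_comp_lTensor, ← LinearMap.lTensor_comp_rTensor]
      exact this
    rw [hfz, h0, map_zero]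

/-- A bicovariant graded ideal which is stable under all contractions, and trivial in degree `0`, is
contained in the kernel of the total antisymmetrizer. -/
theorem IsBicovariantGradedIdeal.le_exteriorIdeal (hN : C.IsBicovariantGradedIdeal N)
    (hC : C.IsMinimalAdmissible)
    (hN0 : N ⊓ degree A Γ 0 = ⊥)
    (hcontr : ∀ X : A →ₗ[ℂ] ℂ, IsClassicalLie X → ∀ (χ : Γ →ₗ[ℂ] A) (h : C.IsContraction X χ),
      ∀ x ∈ N, contraction χ h.map_smul h.map_op_smul x ∈ N) :
    N ≤ C.exteriorIdeal := by
  intro x hx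
  rw [exteriorIdeal, LinearMap.mem_ker, antisymmetrizer, LinearMap.comp_apply,
    LinearMap.comp_apply, hN.lTensor_toInv (fun y hy => ?_) hx, map_zero]
  refine hN.induction (p := fun y => tensorAntisymmetrizer C.flipOver (C.invPart y) = 0) (by simp)
    (fun x y hx hy => by rw [map_add, map_add, hx, hy, add_zero]) (fun k x hx hk => ?_) hy
  rw [tensorAntisymmetrizer_of_mem _ (C.invTensors_le k (C.invPart_mem hk))]
  exact hN.degreeAntisymmetrizer_eq_zero hC hN0 hcontr k x hx hk

end Ideal

end BicovariantCalculus

end Antisymmetrizer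

/-! ### One-parameter groups of characters exp(tX) -/

section Exponential

variable {A : Type*} [Ring A] [HopfAlgebra ℂ A]

/-- The coefficients `ε(R_X^n a)` of the exponential of a vector field. -/
def expCoeff (X : A →ₗ[ℂ] ℂ) (n : ℕ) : A →ₗ[ℂ] ℂ :=
  Coalgebra.counit (R := ℂ) ∘ₗ ((vectorField X : Module.End ℂ A) ^ n)

theorem expCoeff_zero (X : A →ₗ[ℂ] ℂ) : expCoeff X 0 = Coalgebra.counit (R := ℂ) := rfl

theorem expCoeff_vectorField (X : A →ₗ[ℂ] ℂ) (n : ℕ) (a : A) :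
    expCoeff X n (vectorField X a) = expCoeff X (n + 1) a := by
  rw [expCoeff, expCoeff, pow_succ]
  rfl

/-- The derivation R_X satisfies R_X ∘ m = m ∘ (R_X ⊗ id + id ⊗ R_X) for the product m. The two
summands commute, so the binomial theorem applies, and ε is multiplicative. -/
theorem expCoeff_mul {X : A →ₗ[ℂ] ℂ} (hX : ∀ a b : A,
    X (a * b) = Coalgebra.counit (R := ℂ) a * X b + X a * Coalgebra.counit (R := ℂ) b) (n : ℕ)
    (a b : A) : expCoeff X n (a * b) = ∑ m ∈ Finset.HasAntidiagonal.antidiagonal n,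
      (n.choose m.1 : ℂ) * (expCoeff X m.1 a * expCoeff X m.2 b) := by
  set R : Module.End ℂ A := vectorField X with hR
  have h1 : ∀ (n : ℕ) (z : A ⊗[ℂ] A), (R ^ n) (LinearMap.mul' ℂ A z) =
      LinearMap.mul' ℂ A (((R.rTensor A + R.lTensor A : Module.End ℂ (A ⊗[ℂ] A)) ^ n) z) := by
    intro n
    induction n with
    | zero => intro z; rfl
    | succ n ih =>
      intro z
      rw [pow_succ, pow_succ, Module.End.mul_apply, Module.End.mul_apply, ← ih]
      congr 1
      induction z with
      | zero => simp
      | add x y hx hy => simp only [map_add, hx, hy]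
      | tmul x y => simp [hR, vectorField_mul hX, add_comm]
  have hc : Commute (R.rTensor A : Module.End ℂ (A ⊗[ℂ] A)) (R.lTensor A) := by
    refine TensorProduct.ext' fun x y => ?_
    simp
  have hr : ∀ (k l : ℕ), ((R.rTensor A : Module.End ℂ (A ⊗[ℂ] A)) ^ k *
      (R.lTensor A : Module.End ℂ (A ⊗[ℂ] A)) ^ l) (a ⊗ₜ b) = (R ^ k) a ⊗ₜ (R ^ l) b := by
    intro k l
    rw [Module.End.mul_apply, LinearMap.lTensor_pow, LinearMap.rTensor_pow]
    simp
  have h2 := h1 n (a ⊗ₜ b)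
  rw [LinearMap.mul'_apply, hc.add_pow', LinearMap.sum_apply, map_sum] at h2
  rw [expCoeff, LinearMap.comp_apply, h2, map_sum]
  refine Finset.sum_congr rfl fun m _ => ?_
  rw [LinearMap.smul_apply, hr, map_nsmul, map_nsmul, nsmul_eq_mul, LinearMap.mul'_apply,
    Bialgebra.counit_mul]
  rfl

theorem expCoeff_algebraMap {X : A →ₗ[ℂ] ℂ} (hX : ∀ a b : A,
    X (a * b) = Coalgebra.counit (R := ℂ) a * X b + X a * Coalgebra.counit (R := ℂ) b) (n : ℕ)
    (c : ℂ) : expCoeff X n (algebraMap ℂ A c) = if n = 0 then c else 0 := by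
  cases n with
  | zero => simp [expCoeff_zero]
  | succ n =>
    rw [← expCoeff_vectorField, Algebra.algebraMap_eq_smul_one, map_smul, vectorField_one hX]
    simp

/-- The exponential `E_t(a) = ∑ tⁿ/n! ε(R_X^n a)` of a vector field, evaluated at the neutral
element. -/
def expChar (X : A →ₗ[ℂ] ℂ) (a : A) (t : ℝ) : ℂ :=
  ∑' n : ℕ, ((t ^ n / n.factorial : ℝ) : ℂ) * expCoeff X n a

/-- Exponential growth of the coefficients. -/
def HasExpGrowth (X : A →ₗ[ℂ] ℂ) (a : A) : Prop :=
  ∃ K r : ℝ, 0 ≤ K ∧ 0 ≤ r ∧ ∀ n, ‖expCoeff X n a‖ ≤ K * r ^ n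

theorem HasExpGrowth.add {X : A →ₗ[ℂ] ℂ} {a b : A} (ha : HasExpGrowth X a)
    (hb : HasExpGrowth X b) : HasExpGrowth X (a + b) := by
  obtain ⟨K, r, hK, hr, h⟩ := ha
  obtain ⟨K', r', hK', hr', h'⟩ := hb
  refine ⟨K + K', r + r', by positivity, by positivity, fun n => ?_⟩
  rw [map_add]
  calc ‖expCoeff X n a + expCoeff X n b‖ ≤ K * r ^ n + K' * r' ^ n :=
        (norm_add_le _ _).trans (add_le_add (h n) (h' n))
    _ ≤ K * (r + r') ^ n + K' * (r + r') ^ n := by gcongr <;> linarith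
    _ = (K + K') * (r + r') ^ n := by ring

/-- The Leibniz expansion of the coefficients is dominated by the binomial expansion of (r + r')ⁿ.
-/
theorem HasExpGrowth.mul {X : A →ₗ[ℂ] ℂ} (hX : ∀ a b : A,
    X (a * b) = Coalgebra.counit (R := ℂ) a * X b + X a * Coalgebra.counit (R := ℂ) b)
    {a b : A} (ha : HasExpGrowth X a) (hb : HasExpGrowth X b) : HasExpGrowth X (a * b) := by
  obtain ⟨K, r, hK, hr, h⟩ := ha
  obtain ⟨K', r', hK', hr', h'⟩ := hb
  refine ⟨K * K', r + r', by positivity, by positivity, fun n => ?_⟩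
  rw [expCoeff_mul hX, (Commute.all r r').add_pow', Finset.mul_sum]
  refine (norm_sum_le _ _).trans (Finset.sum_le_sum fun m _ => ?_)
  rw [norm_mul, norm_mul, Complex.norm_natCast, nsmul_eq_mul]
  calc (n.choose m.1 : ℝ) * (‖expCoeff X m.1 a‖ * ‖expCoeff X m.2 b‖)
      ≤ n.choose m.1 * ((K * r ^ m.1) * (K' * r' ^ m.2)) := by gcongr <;> simp [h, h']
    _ = K * K' * (n.choose m.1 * (r ^ m.1 * r' ^ m.2)) := by ring

theorem HasExpGrowth.vectorField {X : A →ₗ[ℂ] ℂ} {a : A} (ha : HasExpGrowth X a) :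
    HasExpGrowth X (vectorField X a) := by
  obtain ⟨K, r, hK, hr, h⟩ := ha
  refine ⟨K * r, r, by positivity, hr, fun n => ?_⟩
  rw [expCoeff_vectorField]
  exact (h (n + 1)).trans (le_of_eq (by ring))

theorem HasExpGrowth.norm_term_le {X : A →ₗ[ℂ] ℂ} {a : A} {K r : ℝ}
    (h : ∀ n, ‖expCoeff X n a‖ ≤ K * r ^ n) {t s : ℝ} (ht : |t| ≤ s) (n : ℕ) :
    ‖((t ^ n / n.factorial : ℝ) : ℂ) * expCoeff X n a‖ ≤ K * ((s * r) ^ n / n.factorial) := by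
  rw [norm_mul, Complex.norm_real, norm_div, norm_pow, Real.norm_eq_abs, RCLike.norm_natCast]
  calc |t| ^ n / n.factorial * ‖expCoeff X n a‖
      ≤ s ^ n / n.factorial * (K * r ^ n) := by
        have : 0 ≤ s := (abs_nonneg t).trans ht
        gcongr
        exact h n
    _ = K * ((s * r) ^ n / n.factorial) := by rw [mul_pow]; ring

theorem HasExpGrowth.summable_norm {X : A →ₗ[ℂ] ℂ} {a : A} (ha : HasExpGrowth X a) (t : ℝ) :
    Summable fun n : ℕ => ‖((t ^ n / n.factorial : ℝ) : ℂ) * expCoeff X n a‖ := by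
  obtain ⟨K, r, hK, hr, h⟩ := ha
  exact Summable.of_nonneg_of_le (fun n => norm_nonneg _)
    (HasExpGrowth.norm_term_le h le_rfl)
    ((Real.summable_pow_div_factorial (|t| * r)).mul_left K)

/-- The constant term is split off, because the derivative of term n + 1 is term n of the series of
R_X a. Termwise differentiation is justified by the growth bound, uniformly on the ball of radius
|t| + 1. -/
theorem HasExpGrowth.hasDerivAt {X : A →ₗ[ℂ] ℂ} {a : A} (ha : HasExpGrowth X a) (t : ℝ) :
    HasDerivAt (expChar X a) (expChar X (QPB.vectorField X a) t) t := by
  obtain ⟨K, r, hK, hr, h⟩ := ha.vectorField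
  have hd : ∀ (n : ℕ) (y : ℝ), HasDerivAt
      (fun y : ℝ => ((y ^ (n + 1) / (n + 1).factorial : ℝ) : ℂ) * expCoeff X (n + 1) a)
      (((y ^ n / n.factorial : ℝ) : ℂ) * expCoeff X n (QPB.vectorField X a)) y := by
    intro n y
    rw [expCoeff_vectorField]
    refine HasDerivAt.mul_const (HasDerivAt.ofReal_comp ?_) _
    have := (hasDerivAt_pow (n + 1) y).div_const ((n + 1).factorial : ℝ)
    have e : y ^ n / n.factorial = ((n + 1 : ℕ) : ℝ) * y ^ (n + 1 - 1) / (n + 1).factorial := by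
      rw [Nat.factorial_succ]
      push_cast
      field_simp
    rw [e]
    exact this
  have hs := (hasDerivAt_tsum_of_isPreconnected (t := Metric.ball (0 : ℝ) (|t| + 1)) (y₀ := t)
    (y := t) ((Real.summable_pow_div_factorial ((|t| + 1) * r)).mul_left K) Metric.isOpen_ball
    (convex_ball _ _).isPreconnected (fun n y _ => hd n y)
    (fun n y hy => HasExpGrowth.norm_term_le h
      (by have := mem_ball_zero_iff.1 hy; exact this.le) n)
    (by simp) ((summable_nat_add_iff 1).2 (ha.summable_norm t).of_norm) (by simp))
  have e : expChar X a = fun t => expCoeff X 0 a +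
      ∑' n : ℕ, ((t ^ (n + 1) / (n + 1).factorial : ℝ) : ℂ) * expCoeff X (n + 1) a := by
    funext t
    rw [expChar, (ha.summable_norm t).of_norm.tsum_eq_zero_add]
    simp
  rw [e]
  exact hs.const_add _

variable [StarRing A]

variable [StarModule ℂ A]

/-- Since φ is a *-map, the complex conjugate of ε(a*) is a left counit as a function of a, and a
left counit coincides with the right counit ε. -/
theorem counit_star (hA : ∀ a : A, Coalgebra.comul (R := ℂ) (star a) =
    star (Coalgebra.comul (R := ℂ) a)) (a : A) :
    Coalgebra.counit (R := ℂ) (star a) = star (Coalgebra.counit (R := ℂ) a) := by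
  have h1 : ∀ z : A ⊗[ℂ] A, star (TensorProduct.lid ℂ A
      ((Coalgebra.counit (R := ℂ) (A := A)).rTensor A (star z))) = TensorProduct.lift
        (LinearMap.mk₂ ℂ (fun x y : A => star (Coalgebra.counit (R := ℂ) (star x)) • y)
          (by intros; rw [star_add, map_add, star_add, add_smul])
          (by intros; rw [star_smul, map_smul, star_smul, star_star, smul_assoc])
          (by intros; rw [smul_add])
          (by intros; rw [smul_comm])) z := by
    intro z
    induction z with
    | zero => rw [star_zero, map_zero, map_zero, star_zero, map_zero]
    | add x y hx hy => simp only [star_add, map_add, hx, hy]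
    | tmul x y =>
      rw [TensorProduct.star_tmul, LinearMap.rTensor_tmul, TensorProduct.lid_tmul, star_smul,
        star_star]
      rfl
  have h2 := h1 (Coalgebra.comul a)
  rw [← hA, lid_counit_comul, star_star] at h2
  have h3 := congrArg (fun z => star (Coalgebra.counit (R := ℂ) (star (TensorProduct.rid ℂ A z))))
    (Coalgebra.lTensor_counit_comul (R := ℂ) a)
  simp only [TensorProduct.rid_tmul, one_smul] at h3
  rw [← star_inj, star_star, ← h3]
  conv_rhs => rw [h2]
  induction Coalgebra.comul (R := ℂ) a with
  | zero => simp
  | add x y hx hy => simp only [map_add, star_add, hx, hy]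
  | tmul x y => simp [mul_comm]

theorem vectorField_star (hA : ∀ a : A, Coalgebra.comul (R := ℂ) (star a) =
    star (Coalgebra.comul (R := ℂ) a)) {X : A →ₗ[ℂ] ℂ} (hX : IsClassicalLie X) (a : A) :
    vectorField X (star a) = star (vectorField X a) := by
  rw [vectorField_apply, vectorField_apply, hA]
  induction Coalgebra.comul (R := ℂ) a with
  | zero => simp
  | add x y hx hy => simp only [star_add, map_add, hx, hy]
  | tmul x y => simp [hX.map_star]

theorem expCoeff_star (hA : ∀ a : A, Coalgebra.comul (R := ℂ) (star a) =
    star (Coalgebra.comul (R := ℂ) a)) {X : A →ₗ[ℂ] ℂ} (hX : IsClassicalLie X) (n : ℕ) (a : A) :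
    expCoeff X n (star a) = star (expCoeff X n a) := by
  induction n generalizing a with
  | zero => exact counit_star hA a
  | succ n ih => rw [← expCoeff_vectorField, vectorField_star hA hX, ih, expCoeff_vectorField]

/-- For the fundamental corepresentation u, the coefficients of u_ij are the (i, j) entries of the
powers of the matrix X(u), and so they grow geometrically. The bound passes to sums, products and
adjoints, hence to all of A. -/
theorem IsCompactMatrixQuantumGroup.hasExpGrowth (hA : IsCompactMatrixQuantumGroup A)
    {X : A →ₗ[ℂ] ℂ} (hX : IsClassicalLie X) (a : A) : HasExpGrowth X a := by
  obtain ⟨m, u, hu, hu', -, hgen⟩ := hA.exists_fundamental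
  have hmem : a ∈ StarAlgebra.adjoin ℂ {a : A | ∃ i j, a = u i j} := by rw [hgen]; trivial
  induction hmem using StarAlgebra.adjoin_induction with
  | mem a h =>
    obtain ⟨i, j, rfl⟩ := h
    -- K bounds every row sum of the matrix X(u), so each power of this matrix contributes at most
    -- one factor K to its entries.
    set K : ℝ := ∑ i, ∑ k, ‖X (u i k)‖ with hK
    have hK0 : 0 ≤ K := Finset.sum_nonneg fun i _ => Finset.sum_nonneg fun k _ => norm_nonneg _
    refine ⟨1, K, zero_le_one, hK0, fun n => ?_⟩
    rw [one_mul]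
    induction n generalizing i with
    | zero =>
      rw [expCoeff_zero, hu', pow_zero]
      split_ifs <;> simp
    | succ n ih =>
      rw [← expCoeff_vectorField, vectorField_apply, hu]
      simp only [map_sum, LinearMap.rTensor_tmul, TensorProduct.lid_tmul, map_smul, smul_eq_mul]
      calc ‖∑ k, X (u i k) * expCoeff X n (u k j)‖ ≤ ∑ k, ‖X (u i k)‖ * K ^ n := by
            refine (norm_sum_le _ _).trans (Finset.sum_le_sum fun k _ => ?_)
            rw [norm_mul]
            gcongr
            exact ih k
        _ = (∑ k, ‖X (u i k)‖) * K ^ n := (Finset.sum_mul _ _ _).symm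
        _ ≤ K * K ^ n := by
            gcongr
            exact Finset.single_le_sum (f := fun i => ∑ k, ‖X (u i k)‖)
              (fun i _ => Finset.sum_nonneg fun k _ => norm_nonneg _) (Finset.mem_univ i)
        _ = K ^ (n + 1) := (pow_succ' K n).symm
  | algebraMap c =>
    refine ⟨‖c‖, 1, norm_nonneg _, zero_le_one, fun n => ?_⟩
    rw [expCoeff_algebraMap hX.map_mul]
    split_ifs <;> simp
  | add x y _ _ hx hy => exact hx.add hy
  | mul x y _ _ hx hy => exact hx.mul hX.map_mul hy
  | star x _ h =>
    obtain ⟨K, r, hK, hr, h⟩ := h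
    exact ⟨K, r, hK, hr, fun n => by rw [expCoeff_star hA.comul_star hX, norm_star]; exact h n⟩

section

variable (hA : IsCompactMatrixQuantumGroup A) {X : A →ₗ[ℂ] ℂ} (hX : IsClassicalLie X)

theorem expChar_zero_right (X : A →ₗ[ℂ] ℂ) (a : A) :
    expChar X a 0 = Coalgebra.counit (R := ℂ) a := by
  rw [expChar, tsum_eq_single 0 fun n hn => by simp [hn]]
  simp [expCoeff_zero]

theorem expChar_star (hA : IsCompactMatrixQuantumGroup A) {X : A →ₗ[ℂ] ℂ} (hX : IsClassicalLie X)
    (a : A) (t : ℝ) : expChar X (star a) t = star (expChar X a t) := by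
  rw [expChar, expChar, Complex.star_def, Complex.conj_tsum]
  refine tsum_congr fun n => ?_
  rw [map_mul, Complex.conj_ofReal, expCoeff_star hA.comul_star hX]
  rfl

theorem expChar_add (hA : IsCompactMatrixQuantumGroup A) {X : A →ₗ[ℂ] ℂ} (hX : IsClassicalLie X)
    (a b : A) (t : ℝ) : expChar X (a + b) t = expChar X a t + expChar X b t := by
  rw [expChar, expChar, expChar,
    ← (((hA.hasExpGrowth hX a).summable_norm t).of_norm).tsum_add
      ((hA.hasExpGrowth hX b).summable_norm t).of_norm]
  exact tsum_congr fun n => by rw [map_add, mul_add]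

theorem expChar_algebraMap {X : A →ₗ[ℂ] ℂ} (hX : IsClassicalLie X) (c : ℂ) (t : ℝ) :
    expChar X (algebraMap ℂ A c) t = c := by
  rw [expChar, tsum_eq_single 0 fun n hn => by simp [expCoeff_algebraMap hX.map_mul, hn]]
  simp [expCoeff_algebraMap hX.map_mul]

/-- Cauchy product of two absolutely convergent series; the binomial coefficients of `expCoeff_mul`
convert 1/n! into the products of the two inverse factorials. -/
theorem expChar_mul (hA : IsCompactMatrixQuantumGroup A) {X : A →ₗ[ℂ] ℂ} (hX : IsClassicalLie X)
    (a b : A) (t : ℝ) : expChar X (a * b) t = expChar X a t * expChar X b t := by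
  rw [expChar, expChar, expChar, tsum_mul_tsum_eq_tsum_sum_antidiagonal_of_summable_norm
    ((hA.hasExpGrowth hX a).summable_norm t) ((hA.hasExpGrowth hX b).summable_norm t)]
  refine tsum_congr fun n => ?_
  rw [expCoeff_mul hX.map_mul, Finset.mul_sum]
  refine Finset.sum_congr rfl fun m hm => ?_
  obtain rfl := Finset.HasAntidiagonal.mem_antidiagonal.1 hm
  have h := Nat.add_choose_mul_factorial_mul_factorial m.1 m.2
  rw [← Nat.choose_symm_add] at h
  have h' : ((m.1 + m.2).choose m.1 : ℂ) * m.1.factorial * m.2.factorial =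
      (m.1 + m.2).factorial := by exact_mod_cast h
  have h1 : (m.1.factorial : ℂ) ≠ 0 := by exact_mod_cast m.1.factorial_ne_zero
  have h2 : (m.2.factorial : ℂ) ≠ 0 := by exact_mod_cast m.2.factorial_ne_zero
  have h3 : ((m.1 + m.2).factorial : ℂ) ≠ 0 := by exact_mod_cast (m.1 + m.2).factorial_ne_zero
  push_cast
  field_simp
  rw [← h', pow_add]
  ring

/-- The derivative is the same kind of function, for R_X a in place of a, so the order of
differentiability rises by induction. -/
theorem contDiff_expChar (hA : IsCompactMatrixQuantumGroup A) {X : A →ₗ[ℂ] ℂ}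
    (hX : IsClassicalLie X) (a : A) : ContDiff ℝ ∞ (expChar X a) := by
  rw [contDiff_infty]
  intro n
  induction n generalizing a with
  | zero =>
    rw [Nat.cast_zero, contDiff_zero]
    exact continuous_iff_continuousAt.2 fun t =>
      ((hA.hasExpGrowth hX a).hasDerivAt t).continuousAt
  | succ n ih =>
    rw [Nat.cast_succ, contDiff_succ_iff_deriv]
    refine ⟨fun t => ((hA.hasExpGrowth hX a).hasDerivAt t).differentiableAt, by simp, ?_⟩
    have : deriv (expChar X a) = expChar X (vectorField X a) :=
      funext fun t => ((hA.hasExpGrowth hX a).hasDerivAt t).deriv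
    rw [this]
    exact ih _

end

end Exponential

/-! ### Twisting S ⊗ A by a family of characters -/

section Twist

variable {A S S' : Type*} [Ring A] [HopfAlgebra ℂ A] [CommRing S] [Algebra ℂ S] [CommRing S']
  [Algebra ℂ S']

/-- The homomorphism `s ⊗ a ↦ r(s) g(a⁽¹⁾) ⊗ a⁽²⁾`. -/
def twistHom (r : S →ₐ[ℂ] S') (g : A →ₐ[ℂ] S') : S ⊗[ℂ] A →ₐ[ℂ] S' ⊗[ℂ] A :=
  Algebra.TensorProduct.lift (Algebra.TensorProduct.includeLeft.comp r)
    ((Algebra.TensorProduct.map g (AlgHom.id ℂ A)).comp (Bialgebra.comulAlgHom ℂ A))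
    (fun s a => by
      simp only [AlgHom.comp_apply, Bialgebra.comulAlgHom_apply]
      induction Coalgebra.comul (R := ℂ) a with
      | zero => simp
      | add x y hx hy => rw [map_add]; exact hx.add_right hy
      | tmul x y => simp [Commute, SemiconjBy, mul_comm])

theorem twistHom_tmul (r : S →ₐ[ℂ] S') (g : A →ₐ[ℂ] S') (s : S) (a : A) :
    twistHom r g (s ⊗ₜ a) = r s ⊗ₜ 1 * g.toLinearMap.rTensor A (Coalgebra.comul a) := by
  rw [twistHom, Algebra.TensorProduct.lift_tmul]
  rfl

/-- The action of `A` on `S' ⊗ A` through multiplication by the values of a homomorphism. -/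
def valueRep (g : A →ₐ[ℂ] S') : A →ₐ[ℂ] Module.End ℂ (S' ⊗[ℂ] A) :=
  firstRep A ((Algebra.lmul ℂ S').comp g)

theorem valueRep_apply (g : A →ₐ[ℂ] S') (a : A) (z : S' ⊗[ℂ] A) :
    valueRep g a z = (g a ⊗ₜ 1) * z := by
  induction z with
  | zero => simp
  | add x y hx hy => simp only [map_add, mul_add, hx, hy]
  | tmul s b =>
    rw [valueRep, firstRep_tmul]
    simp

theorem rTensor_comul_eq_conv (g : A →ₐ[ℂ] S') (a : A) :
    g.toLinearMap.rTensor A (Coalgebra.comul a) =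
      conv (valueRep g) (TensorProduct.mk ℂ S' A 1) a := by
  rw [conv_apply]
  induction Coalgebra.comul (R := ℂ) a with
  | zero => simp
  | add x y hx hy => simp only [map_add, hx, hy]
  | tmul x y => simp [valueRep_apply]

/-- The inverse of a twist, up to the restriction `r`. -/
def untwist (g : A →ₐ[ℂ] S') : S' ⊗[ℂ] A →ₗ[ℂ] S' ⊗[ℂ] A :=
  TensorProduct.lift ((LinearMap.mul ℂ (S' ⊗[ℂ] A)).compl₁₂
    (Algebra.TensorProduct.includeLeft (R := ℂ) (S := ℂ) (A := S') (B := A)).toLinearMap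
    (antiConv (valueRep g) (TensorProduct.mk ℂ S' A 1)))

theorem untwist_mul (g : A →ₐ[ℂ] S') (s : S') (z : S' ⊗[ℂ] A) :
    untwist g (s ⊗ₜ 1 * z) = s ⊗ₜ 1 * untwist g z := by
  induction z with
  | zero => simp
  | add x y hx hy => simp only [map_add, mul_add, hx, hy]
  | tmul s' b => simp [untwist, ← mul_assoc]

theorem untwist_twistHom (r : S →ₐ[ℂ] S') (g : A →ₐ[ℂ] S') (z : S ⊗[ℂ] A) :
    untwist g (twistHom r g z) = r.toLinearMap.rTensor A z := by
  induction z with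
  | zero => simp
  | add x y hx hy => simp only [map_add, hx, hy]
  | tmul s a =>
    have h := LinearMap.congr_fun (conv_antiConv (valueRep g) (TensorProduct.mk ℂ S' A 1)) a
    have e : untwist g (g.toLinearMap.rTensor A (Coalgebra.comul a)) =
        conv (valueRep g) (antiConv (valueRep g) (TensorProduct.mk ℂ S' A 1)) a := by
      rw [conv_apply]
      induction Coalgebra.comul (R := ℂ) a with
      | zero => simp
      | add x y hx hy => simp only [map_add, hx, hy]
      | tmul x y => simp [untwist, valueRep_apply]
    rw [twistHom_tmul, untwist_mul, e, h]
    simp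

/-- The twist by g is undone by the twist by g ∘ κ. The values of the latter, multiplied by s, need
only lift through r to S; this is the role of k. -/
theorem twistHom_surjective_aux (r : S →ₐ[ℂ] S') (g : A →ₐ[ℂ] S') (s : S') (k : A →ₗ[ℂ] S)
    (hk : ∀ a, r (k a) = s * g (HopfAlgebra.antipode ℂ a)) (a : A) :
    twistHom r g (k.rTensor A (Coalgebra.comul a)) = s ⊗ₜ a := by
  have h := LinearMap.congr_fun (antiConv_conv (valueRep g) (TensorProduct.mk ℂ S' A 1)) a
  have e : twistHom r g (k.rTensor A (Coalgebra.comul a)) =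
      s ⊗ₜ 1 * antiConv (valueRep g) (conv (valueRep g) (TensorProduct.mk ℂ S' A 1)) a := by
    rw [antiConv_apply]
    induction Coalgebra.comul (R := ℂ) a with
    | zero => simp
    | add x y hx hy => simp only [map_add, mul_add, hx, hy]
    | tmul x y =>
      rw [LinearMap.rTensor_tmul, twistHom_tmul, rTensor_comul_eq_conv, hk,
        TensorProduct.lift.tmul, LinearMap.compl₂_apply, LinearMap.comp_apply,
        AlgHom.toLinearMap_apply, valueRep_apply, ← mul_assoc,
        Algebra.TensorProduct.tmul_mul_tmul, one_mul]
  rw [e, h]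
  simp

theorem twistHom_covariant (r : S →ₐ[ℂ] S') (g : A →ₐ[ℂ] S') (z : S ⊗[ℂ] A) :
    (Coalgebra.comul (R := ℂ) (A := A)).lTensor S' (twistHom r g z) =
      TensorProduct.assoc ℂ S' A A ((twistHom r g).toLinearMap.rTensor A
        ((TensorProduct.assoc ℂ S A A).symm
          ((Coalgebra.comul (R := ℂ) (A := A)).lTensor S z))) := by
  induction z with
  | zero => simp
  | add x y hx hy => simp only [map_add, hx, hy]
  | tmul s a =>
    have h := congrArg (TensorProduct.map (LinearMap.mulLeft ℂ (r s) ∘ₗ g.toLinearMap)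
      (LinearMap.id (R := ℂ) (M := A ⊗[ℂ] A))) (Coalgebra.coassoc_apply (R := ℂ) a)
    have h1 : (Coalgebra.comul (R := ℂ) (A := A)).lTensor S' (twistHom r g (s ⊗ₜ a)) =
        TensorProduct.map (LinearMap.mulLeft ℂ (r s) ∘ₗ g.toLinearMap)
          (LinearMap.id (R := ℂ) (M := A ⊗[ℂ] A))
          ((Coalgebra.comul (R := ℂ) (A := A)).lTensor A (Coalgebra.comul a)) := by
      rw [twistHom_tmul]
      induction Coalgebra.comul (R := ℂ) a with
      | zero => simp
      | add x y hx hy => simp only [map_add, mul_add, hx, hy]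
      | tmul x y => simp
    have h2 : ∀ w : A ⊗[ℂ] A, TensorProduct.assoc ℂ S' A A
        ((twistHom r g).toLinearMap.rTensor A ((TensorProduct.assoc ℂ S A A).symm (s ⊗ₜ w))) =
        TensorProduct.map (LinearMap.mulLeft ℂ (r s) ∘ₗ g.toLinearMap)
          (LinearMap.id (R := ℂ) (M := A ⊗[ℂ] A)) (TensorProduct.assoc ℂ A A A
            ((Coalgebra.comul (R := ℂ) (A := A)).rTensor A w)) := by
      intro w
      induction w with
      | zero => simp
      | add x y hx hy => simp only [TensorProduct.tmul_add, map_add, hx, hy]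
      | tmul x y =>
        simp only [TensorProduct.assoc_symm_tmul, LinearMap.rTensor_tmul, AlgHom.toLinearMap_apply,
          twistHom_tmul]
        induction Coalgebra.comul (R := ℂ) x with
        | zero => simp
        | add x y hx hy => simp only [map_add, mul_add, TensorProduct.add_tmul, hx, hy]
        | tmul x y => simp
    rw [h1, LinearMap.lTensor_tmul, h2]
    exact h.symm

/-- Untwisting shows that z vanishes after applying r to the first factor, and multiplication by s
factors linearly through r. -/
theorem tmul_mul_eq_zero_of_twistHom (r : S →ₐ[ℂ] S') (g : A →ₐ[ℂ] S') (s : S)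
    (hs : ∀ k : S, r k = 0 → s * k = 0) {z : S ⊗[ℂ] A} (hz : twistHom r g z = 0) :
    (s ⊗ₜ[ℂ] (1 : A)) * z = 0 := by
  have h0 : r.toLinearMap.rTensor A z = 0 := by
    rw [← untwist_twistHom r g, hz, map_zero]
  obtain ⟨L, hL⟩ := BicovariantCalculus.exists_comp_eq_of_ker_le r.toLinearMap
    (LinearMap.mulLeft ℂ s) hs
  have h1 : (LinearMap.mulLeft ℂ s).rTensor A z = (s ⊗ₜ 1) * z := by
    clear hz h0
    induction z with
    | zero => simp
    | add x y hx hy => simp only [map_add, mul_add, hx, hy]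
    | tmul s a => simp
  rw [← h1, ← hL, LinearMap.rTensor_comp, LinearMap.comp_apply, h0, map_zero]

theorem twistHom_tmul_one (r : S →ₐ[ℂ] S') (g : A →ₐ[ℂ] S') (s : S) :
    twistHom r g (s ⊗ₜ 1) = r s ⊗ₜ 1 := by
  rw [twistHom_tmul, Bialgebra.comul_one, Algebra.TensorProduct.one_def, LinearMap.rTensor_tmul]
  simp

variable [StarRing A] [StarModule ℂ A] [StarRing S] [StarModule ℂ S]

theorem exists_twistHom_eq {B : Type*} [Ring B] [StarRing B] [Algebra ℂ B]
    (π : B →⋆ₐ[ℂ] S ⊗[ℂ] A) (r : S →ₐ[ℂ] S') (g : A →ₐ[ℂ] S') (s : S') (k : A →ₗ[ℂ] S)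
    (hk : ∀ a, r (k a) = s * g (HopfAlgebra.antipode ℂ a)) (h : ∀ x y, ∃ b, π b = k x ⊗ₜ y)
    (a : A) : ∃ b, twistHom r g (π b) = s ⊗ₜ a := by
  have key : ∀ w : A ⊗[ℂ] A, ∃ b, π b = k.rTensor A w := fun w => by
    induction w with
    | zero => exact ⟨0, by simp⟩
    | add x y hx hy =>
      obtain ⟨b, hb⟩ := hx
      obtain ⟨c, hc⟩ := hy
      exact ⟨b + c, by rw [map_add, map_add, hb, hc]⟩
    | tmul x y => exact h x y
  obtain ⟨b, hb⟩ := key (Coalgebra.comul a)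
  exact ⟨b, by rw [hb, twistHom_surjective_aux r g s k hk]⟩

variable [StarRing S'] [StarModule ℂ S']

/-- The `*`-homomorphism `s ⊗ a ↦ r(s) g(a⁽¹⁾) ⊗ a⁽²⁾`. -/
def twist (hA : ∀ a : A, Coalgebra.comul (R := ℂ) (star a) = star (Coalgebra.comul (R := ℂ) a))
    (r : S →⋆ₐ[ℂ] S') (g : A →⋆ₐ[ℂ] S') : S ⊗[ℂ] A →⋆ₐ[ℂ] S' ⊗[ℂ] A where
  __ := twistHom r.toAlgHom g.toAlgHom
  map_star' z := by
    change twistHom r.toAlgHom g.toAlgHom (star z) = star (twistHom r.toAlgHom g.toAlgHom z)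
    induction z with
    | zero => rw [star_zero, map_zero, star_zero]
    | add x y hx hy => simp only [map_add, star_add, hx, hy]
    | tmul s a =>
      have h : ∀ w : A ⊗[ℂ] A, g.toAlgHom.toLinearMap.rTensor A (star w) =
          star (g.toAlgHom.toLinearMap.rTensor A w) := by
        intro w
        induction w with
        | zero => rw [star_zero, map_zero, star_zero]
        | add x y hx hy => simp only [map_add, star_add, hx, hy]
        | tmul x y =>
          have : g (star x) = star (g x) := map_star g x
          rw [TensorProduct.star_tmul, LinearMap.rTensor_tmul, LinearMap.rTensor_tmul,
            TensorProduct.star_tmul]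
          exact congrArg (· ⊗ₜ[ℂ] star y) this
      have h' : ∀ (s : S') (w : S' ⊗[ℂ] A), star (s ⊗ₜ[ℂ] (1 : A) * w) =
          star s ⊗ₜ[ℂ] (1 : A) * star w := by
        intro s w
        induction w with
        | zero => rw [star_zero, mul_zero, mul_zero, star_zero]
        | add x y hx hy => simp only [mul_add, star_add, hx, hy]
        | tmul x y =>
          simp only [Algebra.TensorProduct.tmul_mul_tmul, TensorProduct.star_tmul, star_mul',
            one_mul]
      have hr : r.toAlgHom (star s) = star (r.toAlgHom s) := map_star r s
      rw [TensorProduct.star_tmul, twistHom_tmul, twistHom_tmul, hA, h, h', hr]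

end Twist

/-! ### Twisted local trivializations -/

section Flow

variable (n : ℕ) {N : Type*} [TopologicalSpace N] [ChartedSpace (EuclideanSpace ℝ (Fin n)) N]
  {A : Type*} [Ring A] [StarRing A] [HopfAlgebra ℂ A] [StarModule ℂ A]

/-- The family of characters `x ↦ exp(h(x) X)`, as a homomorphism `A → S(N)`. -/
def flowChar (hA : IsCompactMatrixQuantumGroup A) {X : A →ₗ[ℂ] ℂ} (hX : IsClassicalLie X)
    (h : N → ℝ) (hh : ContMDiff (𝓡 n) 𝓘(ℝ, ℝ) ∞ h) : A →⋆ₐ[ℂ] Smooth n N where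
  toFun a := ⟨fun x => expChar X a (h x), (contDiff_expChar hA hX a).contMDiff.comp hh⟩
  map_one' := Subtype.ext <| funext fun x => by
    have := expChar_algebraMap (A := A) hX 1 (h x)
    rw [map_one] at this
    exact this
  map_mul' a b := Subtype.ext <| funext fun x => expChar_mul hA hX a b (h x)
  map_zero' := Subtype.ext <| funext fun x => by
    have := expChar_algebraMap (A := A) hX 0 (h x)
    rw [map_zero] at this
    exact this
  map_add' a b := Subtype.ext <| funext fun x => expChar_add hA hX a b (h x)
  commutes' c := Subtype.ext <| funext fun x => expChar_algebraMap hX c (h x)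
  map_star' a := Subtype.ext <| funext fun x => expChar_star hA hX a (h x)

open TopologicalSpace (Opens)

variable {M : Type*} [TopologicalSpace M] [ChartedSpace (EuclideanSpace ℝ (Fin n)) M]

/-- The restriction of functions to a smaller open set, as a `*`-homomorphism. -/
def resStar {U V : Opens M} (h : U ≤ V) : Smooth n V →⋆ₐ[ℂ] Smooth n U where
  __ := resLE n h
  map_star' _ := rfl

theorem contMDiff_restrict {h : M → ℝ} (hh : ContMDiff (𝓡 n) 𝓘(ℝ, ℝ) ∞ h) (U : Opens M) :
    ContMDiff (𝓡 n) 𝓘(ℝ, ℝ) ∞ fun x : U => h x :=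
  hh.comp contMDiff_subtype_val

/-- A smooth function which is equal to `1` on a given support, with support in an open set. -/
theorem exists_smooth_mul_eq [IsManifold (𝓡 n) ∞ M] [T2Space M] [CompactSpace M] (U : Opens M)
    (f : Smooth n M) (hf : tsupport (f : M → ℂ) ⊆ U) :
    ∃ k : Smooth n M, tsupport (k : M → ℂ) ⊆ U ∧ k * f = f := by
  obtain ⟨u, hu, hfu, huU⟩ := normal_exists_closure_subset (isClosed_tsupport (f : M → ℂ)) U.2 hf
  obtain ⟨k, hk1, hk0, -⟩ := exists_contMDiffMap_one_nhds_of_subset_interior (n := ⊤) (𝓡 n)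
    (isClosed_tsupport (f : M → ℂ)) (hfu.trans (interior_maximal subset_closure hu))
  refine ⟨⟨fun x => (k x : ℂ), (Complex.ofRealCLM.contDiff.contMDiff).comp k.contMDiff⟩, ?_, ?_⟩
  · refine Set.Subset.trans (closure_minimal (fun x hx => ?_) isClosed_closure) huU
    by_contra hx'
    exact hx (by simp [hk0 x hx'])
  · refine Subtype.ext (funext fun x => ?_)
    change (k x : ℂ) * (f : M → ℂ) x = (f : M → ℂ) x
    by_cases hx : x ∈ tsupport (f : M → ℂ)
    · rw [hk1.self_of_nhdsSet x hx]; simp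
    · rw [image_eq_zero_of_notMem_tsupport hx, mul_zero]

variable {B : Type*} [Ring B] [StarRing B] [Algebra ℂ B] [StarModule ℂ B]

variable {n} in
/-- Twisted restrictions of local trivializations are local trivializations. -/
theorem IsLocalTrivialization.twist [IsManifold (𝓡 n) ∞ M] [T2Space M] [CompactSpace M]
    {P : QuantumPrincipalBundle n M A B} (hA : IsCompactMatrixQuantumGroup A) {X : A →ₗ[ℂ] ℂ}
    (hX : IsClassicalLie X) {h : M → ℝ} (hh : ContMDiff (𝓡 n) 𝓘(ℝ, ℝ) ∞ h) {U V : Opens M}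
    (hUV : U ≤ V) {π : B →⋆ₐ[ℂ] Smooth n V ⊗[ℂ] A} (hπ : IsLocalTrivialization P V π) :
    IsLocalTrivialization P U ((QPB.twist hA.comul_star (resStar n hUV)
      (flowChar n hA hX (fun x : U => h x) (contMDiff_restrict n hh U))).comp π) := by
  set g := flowChar n hA hX (fun x : U => h x) (contMDiff_restrict n hh U) with hg
  have happ : ∀ b, ((QPB.twist hA.comul_star (resStar n hUV) g).comp π) b =
      twistHom (resLE n hUV) g.toAlgHom (π b) := fun b => rfl
  refine ⟨fun f => ?_, fun b => ?_, fun f hf b hb => ?_, fun f hf a => ?_⟩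
  · rw [happ, hπ.base]
    exact twistHom_tmul_one _ _ _
  · rw [happ, twistHom_covariant, hπ.covariant, LinearEquiv.symm_apply_apply,
      ← LinearMap.comp_apply ((twistHom (resLE n hUV) g.toAlgHom).toLinearMap.rTensor A),
      ← LinearMap.rTensor_comp]
    rfl
  · rw [happ] at hb
    -- The hypothesis controls π(b) over U only. As f is supported in U, multiplication by f
    -- annihilates every function on V which vanishes on U.
    have h1 : (res n V f ⊗ₜ[ℂ] (1 : A)) * π b = 0 := by
      refine tmul_mul_eq_zero_of_twistHom _ _ _ (fun k hk => ?_) hb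
      refine Subtype.ext (funext fun x => ?_)
      change (f : M → ℂ) x * (k : V → ℂ) x = 0
      by_cases hx : (x : M) ∈ tsupport (f : M → ℂ)
      · have : (k : V → ℂ) x = 0 := congrFun (congrArg Subtype.val hk) (⟨x, hf hx⟩ : U)
        exact mul_eq_zero_of_right _ this
      · exact mul_eq_zero_of_left (image_eq_zero_of_notMem_tsupport hx) _
    have h2 : π (P.i f * b) = 0 := by
      rw [map_mul, hπ.base]
      exact h1
    -- Injectivity of π gives only i(k)i(f)b = 0 for k supported in V; a cut-off with kf = f removes
    -- the extra factor.
    obtain ⟨k, hk, hkf⟩ := exists_smooth_mul_eq n V f (hf.trans hUV)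
    have h3 := hπ.injective k hk _ h2
    rwa [← mul_assoc, ← map_mul, hkf] at h3
  -- As h is defined on all of M, the functions f exp(hX)(κ(x)) are smooth on M with support in that
  -- of f, and thus they are available for the surjectivity of π.
  · refine exists_twistHom_eq π (resLE n hUV) g.toAlgHom (res n U f)
      ((res n V).toLinearMap ∘ₗ LinearMap.mulLeft ℂ f ∘ₗ
        (flowChar n hA hX h hh).toAlgHom.toLinearMap ∘ₗ HopfAlgebra.antipode ℂ)
      (fun a => Subtype.ext (funext fun x => rfl)) (fun x y => ?_) a
    exact hπ.surjective (f * flowChar n hA hX h hh (HopfAlgebra.antipode ℂ x))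
      ((tsupport_mul_subset_left (f := (f : M → ℂ))).trans (hf.trans hUV)) y

end Flow

/-! ### Extension of twists to differential forms -/

section FormExtension

variable {A Γ : Type*} [Ring A] [HopfAlgebra ℂ A] [AddCommGroup Γ] [Module ℂ Γ]
  [Module A Γ]
  [Module Aᵐᵒᵖ Γ] [IsScalarTower ℂ A Γ] [IsScalarTower ℂ Aᵐᵒᵖ Γ] [SMulCommClass A Aᵐᵒᵖ Γ]
  {O : Type*} [Ring O] [Algebra ℂ O] {θ : O →ₐ[ℂ] O} [GradedAlgebra (parityPart θ)]

open TensorBundle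

variable (A Γ θ) in
/-- The elements of an algebraic tensor product as elements of a graded tensor product with `Γ^⊗`. -/
def toGraded : O ⊗[ℂ] TensorBundle A Γ ≃ₗ[ℂ]
    GradedTensorProduct ℂ (parityPart θ) (parityPart (parity A Γ)) :=
  GradedTensorProduct.of ℂ (parityPart θ) (parityPart (parity A Γ))

theorem exists_parity_add (x : TensorBundle A Γ) : ∃ y z : TensorBundle A Γ,
    y ∈ parityPart (parity A Γ) 0 ∧ z ∈ parityPart (parity A Γ) 1 ∧ x = y + z := by
  refine ⟨_, _, (evenPart (parity A Γ) (parity_parity A Γ) x).2,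
    (oddPart (parity A Γ) (parity_parity A Γ) x).2, ?_⟩
  rw [coe_evenPart, coe_oddPart, ← smul_add, add_add_sub_cancel, ← two_smul ℂ x, smul_smul]
  norm_num

theorem toGraded_mul_even (s t : O) (ht : θ t = t) (x y : TensorBundle A Γ) :
    toGraded A Γ θ (s ⊗ₜ x) * toGraded A Γ θ (t ⊗ₜ y) = toGraded A Γ θ ((s * t) ⊗ₜ (x * y)) := by
  obtain ⟨u, v, hu, hv, rfl⟩ := exists_parity_add x
  have h0 := GradedTensorProduct.tmul_coe_mul_zero_coe_tmul (R := ℂ) (parityPart θ)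
    (parityPart (parity A Γ)) s ⟨u, hu⟩ ⟨t, mem_parityPart_zero.2 ht⟩ y
  have h1 := GradedTensorProduct.tmul_coe_mul_zero_coe_tmul (R := ℂ) (parityPart θ)
    (parityPart (parity A Γ)) s ⟨v, hv⟩ ⟨t, mem_parityPart_zero.2 ht⟩ y
  rw [TensorProduct.tmul_add, map_add, add_mul, add_mul, TensorProduct.tmul_add, map_add]
  exact congrArg₂ (· + ·) h0 h1

theorem toGraded_mul_odd (s t : O) (ht : θ t = -t) (x y : TensorBundle A Γ) :
    toGraded A Γ θ (s ⊗ₜ x) * toGraded A Γ θ (t ⊗ₜ y) =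
      toGraded A Γ θ ((s * t) ⊗ₜ (parity A Γ x * y)) := by
  obtain ⟨u, v, hu, hv, rfl⟩ := exists_parity_add x
  have h0 := GradedTensorProduct.tmul_zero_coe_mul_coe_tmul (R := ℂ) (parityPart θ)
    (parityPart (parity A Γ)) s ⟨u, hu⟩ ⟨t, mem_parityPart_one.2 ht⟩ y
  have h1 := GradedTensorProduct.tmul_coe_mul_coe_tmul (R := ℂ) (parityPart θ)
    (parityPart (parity A Γ)) s ⟨v, hv⟩ ⟨t, mem_parityPart_one.2 ht⟩ y
  rw [mul_one, uzpow_one, Units.neg_smul, one_smul] at h1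
  rw [TensorProduct.tmul_add, map_add, add_mul, map_add, mem_parityPart_zero.1 hu,
    mem_parityPart_one.1 hv, add_mul, TensorProduct.tmul_add, map_add, neg_mul,
    TensorProduct.tmul_neg, map_neg]
  exact congrArg₂ (· + ·) h0 h1

variable (C : BicovariantCalculus A Γ)

variable (Γ) in
/-- The homomorphism `a ⊗ x ↦ F(a) ⊗ x`, where `F` has even values. -/
def evenHom (F : A →ₐ[ℂ] O) (hF : ∀ a, θ (F a) = F a) : A ⊗[ℂ] TensorBundle A Γ →ₐ[ℂ]
    GradedTensorProduct ℂ (parityPart θ) (parityPart (parity A Γ)) :=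
  AlgHom.ofLinearMap ((toGraded A Γ θ).toLinearMap ∘ₗ F.toLinearMap.rTensor (TensorBundle A Γ))
    (by
      change toGraded A Γ θ (F 1 ⊗ₜ 1) = 1
      rw [map_one]
      rfl)
    (fun x y => by
      induction x with
      | zero => simp
      | add x x' hx hx' => rw [add_mul, map_add, map_add, add_mul, hx, hx']
      | tmul a x =>
        induction y with
        | zero => simp
        | add y y' hy hy' => rw [mul_add, map_add, map_add, mul_add, hy, hy']
        | tmul b y =>
          rw [Algebra.TensorProduct.tmul_mul_tmul]
          change toGraded A Γ θ (F (a * b) ⊗ₜ (x * y)) =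
            toGraded A Γ θ (F a ⊗ₜ x) * toGraded A Γ θ (F b ⊗ₜ y)
          rw [map_mul, toGraded_mul_even _ _ (hF b)])

variable {F : A →ₐ[ℂ] O} (hF : ∀ a, θ (F a) = F a)

theorem evenHom_mul_odd {η : O} (hη : θ η = -η) (hFη : ∀ a, F a * η = η * F a)
    (z : A ⊗[ℂ] TensorBundle A Γ) :
    evenHom Γ F hF z * toGraded A Γ θ (η ⊗ₜ 1) =
      toGraded A Γ θ (η ⊗ₜ 1) * evenHom Γ F hF ((parity A Γ).toLinearMap.lTensor A z) := by
  induction z with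
  | zero => simp
  | add z w hz hw => rw [map_add, map_add, map_add, add_mul, mul_add, hz, hw]
  | tmul a x =>
    change toGraded A Γ θ (F a ⊗ₜ x) * _ = _ * toGraded A Γ θ (F a ⊗ₜ parity A Γ x)
    rw [toGraded_mul_odd _ _ hη, toGraded_mul_even _ _ (hF a), hFη, mul_one, one_mul]

theorem tensorCoactL_parity (x : TensorBundle A Γ) : C.tensorCoactL (parity A Γ x) =
    (parity A Γ).toLinearMap.lTensor A (C.tensorCoactL x) := by
  have h : C.tensorCoactL.comp (parity A Γ) =
      (Algebra.TensorProduct.map (AlgHom.id ℂ A) (parity A Γ)).comp C.tensorCoactL := by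
    refine algHom_ext (fun a => ?_) (fun ξ => ?_)
    · rw [AlgHom.comp_apply, AlgHom.comp_apply, parity_incl, C.tensorCoactL_incl]
      induction Coalgebra.comul (R := ℂ) a with
      | zero => simp
      | add x y hx hy => simp only [map_add, ← hx, ← hy]
      | tmul a b => simp [parity_incl]
    · rw [AlgHom.comp_apply, AlgHom.comp_apply, parity_form, map_neg, C.tensorCoactL_form]
      induction C.coactL ξ with
      | zero => simp
      | add x y hx hy => simp only [map_add, neg_add, ← hx, ← hy]
      | tmul a b => simp [parity_form, TensorProduct.tmul_neg]
  exact AlgHom.congr_fun h x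

theorem counit_tensorCoactL (x : TensorBundle A Γ) : TensorProduct.lid ℂ _
    ((Coalgebra.counit (R := ℂ) (A := A)).rTensor _ (C.tensorCoactL x)) = x := by
  have h : ((Algebra.TensorProduct.lid ℂ (TensorBundle A Γ)).toAlgHom.comp
      (Algebra.TensorProduct.map (Bialgebra.counitAlgHom ℂ A) (AlgHom.id ℂ _))).comp C.tensorCoactL =
      AlgHom.id ℂ _ := by
    refine algHom_ext (fun a => ?_) (fun ξ => ?_)
    · conv_rhs => rw [← lid_counit_comul a]
      rw [AlgHom.comp_apply, C.tensorCoactL_incl]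
      induction Coalgebra.comul (R := ℂ) a with
      | zero => simp
      | add x y hx hy => simp only [map_add, hx, hy]
      | tmul a b => simp
    · conv_rhs => rw [← C.counit_coactL ξ]
      rw [AlgHom.comp_apply, C.tensorCoactL_form]
      induction C.coactL ξ with
      | zero => simp
      | add x y hx hy => simp only [map_add, hx, hy]
      | tmul a b => simp
  exact AlgHom.congr_fun h x

/-- The homomorphism `x ↦ G(x) + η G(χ ⌟ x)`, where `G(x) = F(x⁽⁻¹⁾) ⊗ x⁽⁰⁾`. -/
def formExtension (χ : Γ →ₗ[ℂ] A) (hl : ∀ (a : A) (ξ : Γ), χ (a • ξ) = a * χ ξ)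
    (hr : ∀ (a : A) (ξ : Γ), χ (MulOpposite.op a • ξ) = χ ξ * a) {η : O} (hη : θ η = -η)
    (hηη : η * η = 0) (hFη : ∀ a, F a * η = η * F a) : TensorBundle A Γ →ₐ[ℂ]
    GradedTensorProduct ℂ (parityPart θ) (parityPart (parity A Γ)) :=
  AlgHom.ofLinearMap (((evenHom Γ F hF).comp C.tensorCoactL).toLinearMap +
      LinearMap.mulLeft ℂ (toGraded A Γ θ (η ⊗ₜ 1)) ∘ₗ
        ((evenHom Γ F hF).comp C.tensorCoactL).toLinearMap ∘ₗ contraction χ hl hr)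
    (by
      have : contraction χ hl hr (1 : TensorBundle A Γ) = 0 := by
        rw [← map_one (incl A Γ), contraction_incl]
      simp [this])
    (fun x y => by
      set e := toGraded A Γ θ (η ⊗ₜ[ℂ] (1 : TensorBundle A Γ)) with he
      have hee : e * e = 0 := by
        rw [he, toGraded_mul_odd _ _ hη, hηη, TensorProduct.zero_tmul, map_zero]
      set G := (evenHom Γ F hF).comp C.tensorCoactL with hG
      -- The sign from moving the odd element e past G(x) is the sign in the antiderivation rule,
      -- and e² = 0 removes the quadratic term; together these give multiplicativity.
      have hGe : ∀ z, G z * e = e * G (parity A Γ z) := fun z => by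
        rw [hG, AlgHom.comp_apply, AlgHom.comp_apply, tensorCoactL_parity]
        exact evenHom_mul_odd hF hη hFη _
      simp only [LinearMap.add_apply, LinearMap.comp_apply, AlgHom.toLinearMap_apply,
        LinearMap.mulLeft_apply, contraction_mul, map_add, map_mul]
      have h1 : G x * (e * G (contraction χ hl hr y)) =
          e * (G (parity A Γ x) * G (contraction χ hl hr y)) := by
        rw [← mul_assoc, hGe, mul_assoc]
      have h2 : e * G (contraction χ hl hr x) * (e * G (contraction χ hl hr y)) = 0 := by
        rw [mul_assoc, ← mul_assoc (G _), hGe, mul_assoc, ← mul_assoc e, hee, zero_mul]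
      rw [add_mul, mul_add, mul_add, h1, h2, mul_assoc e]
      abel)

variable {χ : Γ →ₗ[ℂ] A} {hl : ∀ (a : A) (ξ : Γ), χ (a • ξ) = a * χ ξ}
    {hr : ∀ (a : A) (ξ : Γ), χ (MulOpposite.op a • ξ) = χ ξ * a} {η : O} (hη : θ η = -η)
    (hηη : η * η = 0) (hFη : ∀ a, F a * η = η * F a)

theorem toGraded_mul_evenHom (η : O) (z : A ⊗[ℂ] TensorBundle A Γ) :
    toGraded A Γ θ (η ⊗ₜ 1) * evenHom Γ F hF z =
      toGraded A Γ θ ((LinearMap.mulLeft ℂ η ∘ₗ F.toLinearMap).rTensor _ z) := by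
  induction z with
  | zero => simp
  | add z w hz hw => rw [map_add, mul_add, hz, hw, map_add, map_add]
  | tmul a x =>
    change _ * toGraded A Γ θ (F a ⊗ₜ x) = _
    rw [toGraded_mul_even _ _ (hF a), one_mul]
    rfl

theorem formExtension_apply (x : TensorBundle A Γ) :
    formExtension C hF χ hl hr hη hηη hFη x =
      toGraded A Γ θ (F.toLinearMap.rTensor _ (C.tensorCoactL x) +
        (LinearMap.mulLeft ℂ η ∘ₗ F.toLinearMap).rTensor _
          (C.tensorCoactL (contraction χ hl hr x))) := by
  rw [map_add, ← toGraded_mul_evenHom hF]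
  rfl

theorem formExtension_incl (a : A) : formExtension C hF χ hl hr hη hηη hFη (incl A Γ a) =
    toGraded A Γ θ (TensorProduct.map F.toLinearMap (incl A Γ).toLinearMap
      (Coalgebra.comul a)) := by
  rw [formExtension_apply, contraction_incl, map_zero, map_zero, add_zero, C.tensorCoactL_incl,
    ← LinearMap.comp_apply, LinearMap.rTensor_comp_lTensor]

/-- The contraction of da is R_X(a), and φ(R_X(a)) = R_X(a⁽¹⁾) ⊗ a⁽²⁾. With F = exp(hX) and η = dh
the first term will be the differential of F(a⁽¹⁾). -/
theorem formExtension_form_d {X : A →ₗ[ℂ] ℂ} (hχ : C.IsContraction X χ) (a : A) :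
    formExtension C hF χ hl hr hη hηη hFη (form A Γ (C.d a)) =
    toGraded A Γ θ (TensorProduct.map (LinearMap.mulLeft ℂ η ∘ₗ F.toLinearMap ∘ₗ vectorField X)
      (incl A Γ).toLinearMap (Coalgebra.comul a) +
      TensorProduct.map F.toLinearMap (form A Γ ∘ₗ C.d) (Coalgebra.comul a)) := by
  rw [formExtension_apply, contraction_form, hχ.map_d, C.tensorCoactL_incl, C.tensorCoactL_form,
    C.coactL_d, comul_vectorField, add_comm]
  congr 2
  · induction Coalgebra.comul (R := ℂ) a with
    | zero => simp
    | add x y hx hy => simp only [map_add, hx, hy]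
    | tmul x y => simp
  · induction Coalgebra.comul (R := ℂ) a with
    | zero => simp
    | add x y hx hy => simp only [map_add, hx, hy]
    | tmul x y => simp

/-- If the extension maps an ideal to itself, then the contraction does so. -/
theorem contraction_mem_of_formExtension {N : Submodule ℂ (TensorBundle A Γ)}
    (hN : ∀ x ∈ N, C.tensorCoactL x ∈ LinearMap.range (N.subtype.lTensor A))
    (l : O →ₗ[ℂ] ℂ) (hl' : ∀ a, l (η * F a) = Coalgebra.counit (R := ℂ) a)
    {x : TensorBundle A Γ} (hx : x ∈ N)
    (h : formExtension C hF χ hl hr hη hηη hFη x ∈ Submodule.map (toGraded A Γ θ).toLinearMap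
      (LinearMap.range (N.subtype.lTensor O))) : contraction χ hl hr x ∈ N := by
  obtain ⟨z, hz, hzx⟩ := h
  rw [formExtension_apply] at hzx
  have hzx := (toGraded A Γ θ).injective hzx
  have h1 : F.toLinearMap.rTensor _ (C.tensorCoactL x) ∈ LinearMap.range (N.subtype.lTensor O) := by
    obtain ⟨w, hw⟩ := hN x hx
    refine ⟨F.toLinearMap.rTensor _ w, ?_⟩
    rw [← hw, ← LinearMap.comp_apply, ← LinearMap.comp_apply, LinearMap.lTensor_comp_rTensor,
      LinearMap.rTensor_comp_lTensor]
  -- By left covariance the first term already lies in O ⊗ N. What remains is ηF(y⁽⁻¹⁾) ⊗ y⁽⁰⁾,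
  -- where y is the contraction of x, and l turns it into ε(y⁽⁻¹⁾)y⁽⁰⁾ = y.
  have h2 := sub_mem hz h1
  rw [hzx, add_sub_cancel_left] at h2
  obtain ⟨w, hw⟩ := h2
  have h3 : TensorProduct.lid ℂ _ (l.rTensor _ (N.subtype.lTensor O w)) =
      contraction χ hl hr x := by
    rw [hw, ← LinearMap.comp_apply, ← LinearMap.rTensor_comp]
    refine Eq.trans ?_ (counit_tensorCoactL C _)
    congr 3
    exact LinearMap.ext hl'
  rw [← h3, ← LinearMap.comp_apply, LinearMap.rTensor_comp_lTensor,
    ← LinearMap.lTensor_comp_rTensor, LinearMap.comp_apply]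
  induction l.rTensor N w with
  | zero => simp
  | add u v hu hv => rw [map_add, map_add]; exact add_mem hu hv
  | tmul c y => exact N.smul_mem c y.2

end FormExtension

/-! ### Differentials of the characters exp(hX), and coordinate functions -/

section FlowForms

variable {n : ℕ} {N : Type*} [TopologicalSpace N] [ChartedSpace (EuclideanSpace ℝ (Fin n)) N]
  {A : Type*} [Ring A] [StarRing A] [HopfAlgebra ℂ A] [StarModule ℂ A]

/-- A real smooth function as a complex smooth function. -/
def realSmooth (h : N → ℝ) (hh : ContMDiff (𝓡 n) 𝓘(ℝ, ℝ) ∞ h) : Smooth n N :=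
  ⟨fun x => (h x : ℂ), (Complex.ofRealCLM.contDiff.contMDiff).comp hh⟩

/-- The chain rule, with d/dt exp(tX)(a) = exp(tX)(R_X a). -/
theorem diffAt_flowChar (hA : IsCompactMatrixQuantumGroup A) {X : A →ₗ[ℂ] ℂ} (hX : IsClassicalLie X)
    {h : N → ℝ} (hh : ContMDiff (𝓡 n) 𝓘(ℝ, ℝ) ∞ h) (a : A) (x : N) :
    diffAt (flowChar n hA hX h hh a) x =
      (flowChar n hA hX h hh (vectorField X a) : N → ℂ) x • diffAt (realSmooth h hh) x := by
  have h1 := ((hh x).mdifferentiableAt (by simp)).hasMFDerivAt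
  have h2 : HasMFDerivAt 𝓘(ℝ, ℝ) 𝓘(ℝ, ℂ) (expChar X a) (h x) _ :=
    ((hA.hasExpGrowth hX a).hasDerivAt (h x)).hasFDerivAt.hasMFDerivAt
  have h3 : HasMFDerivAt 𝓘(ℝ, ℝ) 𝓘(ℝ, ℂ) (fun t : ℝ => (t : ℂ)) (h x) Complex.ofRealCLM :=
    Complex.ofRealCLM.hasFDerivAt.hasMFDerivAt
  have e1 : diffAt (flowChar n hA hX h hh a) x = _ := (h2.comp x h1).mfderiv
  have e2 : diffAt (realSmooth h hh) x = _ := (h3.comp x h1).mfderiv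
  rw [e1, e2]
  refine ContinuousLinearMap.ext fun v => ?_
  exact mul_comm (G := ℂ) _ _

theorem formsD_flowChar (hA : IsCompactMatrixQuantumGroup A) {X : A →ₗ[ℂ] ℂ} (hX : IsClassicalLie X)
    {h : N → ℝ} (hh : ContMDiff (𝓡 n) 𝓘(ℝ, ℝ) ∞ h) (a : A) :
    formsD n N (flowChar n hA hX h hh a) = formsD n N (realSmooth h hh) *
      formsFn n N (flowChar n hA hX h hh (vectorField X a)) := by
  refine Subtype.ext (funext fun x => ?_)
  change ExteriorAlgebra.ι ℂ (diffAt (flowChar n hA hX h hh a) x) =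
    ExteriorAlgebra.ι ℂ (diffAt (realSmooth h hh) x) *
      algebraMap ℂ _ ((flowChar n hA hX h hh (vectorField X a) : N → ℂ) x)
  rw [diffAt_flowChar, map_smul, ← Algebra.commutes, ← Algebra.smul_def]

theorem formsParity_formsFn (f : Smooth n N) : formsParity n N (formsFn n N f) = formsFn n N f :=
  Subtype.ext (funext fun _ => AlgHom.commutes _ _)

theorem formsParity_formsD (f : Smooth n N) : formsParity n N (formsD n N f) = -formsD n N f :=
  Subtype.ext (funext fun _ => CliffordAlgebra.involute_ι _)

theorem formsD_mul_self (f : Smooth n N) : formsD n N f * formsD n N f = 0 :=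
  Subtype.ext (funext fun _ => ExteriorAlgebra.ι_sq_zero _)

theorem formsFn_commute (f : Smooth n N) (w : Forms n N) : formsFn n N f * w = w * formsFn n N f :=
  Subtype.ext (funext fun x => Algebra.commutes ((f : N → ℂ) x) ((w : RoughForms n N) x))

theorem exists_exteriorAlgebra_functional {V : Type*} [AddCommGroup V] [Module ℂ V] {v : V}
    (hv : v ≠ 0) : ∃ l : ExteriorAlgebra ℂ V →ₗ[ℂ] ℂ,
      ∀ c, l (ExteriorAlgebra.ι ℂ v * algebraMap ℂ _ c) = c := by
  obtain ⟨φ, hφ⟩ : ∃ φ : Module.Dual ℂ V, φ v ≠ 0 := by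
    by_contra! H
    exact hv ((Module.forall_dual_apply_eq_zero_iff ℂ _).1 H)
  refine ⟨(φ v)⁻¹ • (φ ∘ₗ ExteriorAlgebra.ιInv), fun c => ?_⟩
  rw [← Algebra.commutes, ← Algebra.smul_def, map_smul, LinearMap.smul_apply, LinearMap.comp_apply,
    ExteriorAlgebra.ι_leftInverse, smul_eq_mul, smul_eq_mul, inv_mul_cancel₀ hφ, mul_one]

/-- A functional which evaluates the coefficients of a differential at a point. -/
theorem exists_functional (h : Smooth n N) (x : N) (hx : diffAt h x ≠ 0) :
    ∃ l : Forms n N →ₗ[ℂ] ℂ, ∀ f, l (formsD n N h * formsFn n N f) = (f : N → ℂ) x := by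
  obtain ⟨φ, hφ⟩ := exists_exteriorAlgebra_functional hx
  exact ⟨{ toFun := fun w => φ ((w : RoughForms n N) x)
           map_add' := fun w w' => map_add φ _ _
           map_smul' := fun c w => map_smul φ c _ }, fun f => hφ ((f : N → ℂ) x)⟩

open TopologicalSpace (Opens)

variable {M : Type*} [TopologicalSpace M] [ChartedSpace (EuclideanSpace ℝ (Fin n)) M]

/-- In the chart at x the function is a coordinate up to a constant, so its differential takes the
value 1 on the corresponding basis vector. The preferred chart of the open submanifold agrees with
that of M near x. -/
theorem diffAt_ne_zero_of_coordinate {h : M → ℝ} (W : Opens M) (x : W) (i : Fin n) (c : ℝ)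
    (hh : ContMDiff (𝓡 n) 𝓘(ℝ, ℝ) ∞ fun y : W => h y)
    (hc : ∀ᶠ z in nhds (chartAt (EuclideanSpace ℝ (Fin n)) (x : M) x),
      h ((chartAt (EuclideanSpace ℝ (Fin n)) (x : M)).symm z) = z i - c) :
    diffAt (realSmooth (fun y : W => h y) hh) x ≠ 0 := by
  set f := realSmooth (fun y : W => h y) hh with hf
  have h1 : diffAt f x = fderivWithin ℝ (writtenInExtChartAt (𝓡 n) 𝓘(ℝ, ℂ) x (f : W → ℂ))
      (Set.range (𝓡 n)) (extChartAt (𝓡 n) x x) := ((f.2 x).mdifferentiableAt (by simp)).mfderiv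
  have h2 := W.chartAt_subtype_val_symm_eventuallyEq (H := EuclideanSpace ℝ (Fin n)) (x := x)
  have h3 : writtenInExtChartAt (𝓡 n) 𝓘(ℝ, ℂ) x (f : W → ℂ) =ᶠ[nhds (extChartAt (𝓡 n) x x)]
      fun z : EuclideanSpace ℝ (Fin n) => ((z i - c : ℝ) : ℂ) := by
    filter_upwards [h2, hc] with z hz hz'
    rw [← hz', hz]
    rfl
  have h4 : HasFDerivAt (fun z : EuclideanSpace ℝ (Fin n) => ((z i - c : ℝ) : ℂ))
      (Complex.ofRealCLM.comp (EuclideanSpace.proj (𝕜 := ℝ) i)) (extChartAt (𝓡 n) x x) :=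
    Complex.ofRealCLM.hasFDerivAt.comp _
      (((EuclideanSpace.proj (𝕜 := ℝ) i).hasFDerivAt (x := extChartAt (𝓡 n) x x)).sub_const c)
  intro h0
  have h5 : fderivWithin ℝ (writtenInExtChartAt (𝓡 n) 𝓘(ℝ, ℂ) x (f : W → ℂ))
      (Set.range (𝓡 n)) (extChartAt (𝓡 n) x x) =
        Complex.ofRealCLM.comp (EuclideanSpace.proj (𝕜 := ℝ) i) := by
    rw [ModelWithCorners.range_eq_univ, fderivWithin_univ, h3.fderiv_eq, h4.fderiv]
  have h6 := congrArg (fun L : EuclideanSpace ℝ (Fin n) →L[ℝ] ℂ => L (EuclideanSpace.single i 1))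
    (h5.symm.trans (h1.symm.trans h0))
  simp at h6
  exact one_ne_zero (α := ℂ) h6

/-- A bump function times a coordinate, normalized to vanish at x. A function on all of M is needed
for the twist. -/
theorem exists_coordinate [IsManifold (𝓡 n) ∞ M] [T2Space M] (x : M) (i : Fin n) :
    ∃ h : M → ℝ, ContMDiff (𝓡 n) 𝓘(ℝ, ℝ) ∞ h ∧ h x = 0 ∧ ∃ c : ℝ,
      ∀ᶠ z in nhds (chartAt (EuclideanSpace ℝ (Fin n)) x x),
        h ((chartAt (EuclideanSpace ℝ (Fin n)) x).symm z) = z i - c := by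
  set e := chartAt (EuclideanSpace ℝ (Fin n)) x with he
  obtain ⟨χ⟩ : Nonempty (SmoothBumpFunction (𝓡 n) x) := inferInstance
  have hg : ContMDiffOn (𝓡 n) 𝓘(ℝ, ℝ) ∞ (fun y : M => e y i - e x i) e.source := by
    have h1 : ContMDiffOn (𝓡 n) (𝓡 n) ∞ e e.source := contMDiffOn_chart
    have h2 : ContDiff ℝ ∞ (fun z : EuclideanSpace ℝ (Fin n) => z i - e x i) :=
      (EuclideanSpace.proj (𝕜 := ℝ) i).contDiff.sub contDiff_const
    exact h2.contMDiff.comp_contMDiffOn h1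
  refine ⟨fun y => χ y • (e y i - e x i), χ.contMDiff_smul hg, by simp, e x i, ?_⟩
  have ht : e.target ∈ nhds (e x) :=
    e.open_target.mem_nhds (e.map_source (mem_chart_source _ x))
  have h1 : Filter.Tendsto e.symm (nhds (e x)) (nhds x) := by
    have := e.continuousAt_symm (e.map_source (mem_chart_source _ x))
    rwa [ContinuousAt, e.left_inv (mem_chart_source _ x)] at this
  filter_upwards [ht, h1.eventually χ.eventuallyEq_one] with z hz hz'
  rw [hz', e.right_inv hz]
  simp

/-- In positive dimension no point is isolated. -/
theorem exists_ne_mem_opens (hn : 0 < n) (V : Opens M) {x : M} (hx : x ∈ V) :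
    ∃ y ∈ V, y ≠ x := by
  set e := chartAt (EuclideanSpace ℝ (Fin n)) x with he
  have : Nonempty (Fin n) := ⟨⟨0, hn⟩⟩
  have ht : e.target ∈ nhds (e x) :=
    e.open_target.mem_nhds (e.map_source (mem_chart_source _ x))
  have h1 : Filter.Tendsto e.symm (nhds (e x)) (nhds x) := by
    have := e.continuousAt_symm (e.map_source (mem_chart_source _ x))
    rwa [ContinuousAt, e.left_inv (mem_chart_source _ x)] at this
  have h2 : ∀ᶠ z in nhdsWithin (e x) {e x}ᶜ, z ∈ e.target ∧ e.symm z ∈ V ∧ z ∈ ({e x}ᶜ : Set _) :=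
    Filter.Eventually.and (nhdsWithin_le_nhds ht) (Filter.Eventually.and
      (nhdsWithin_le_nhds (h1.eventually (V.2.mem_nhds hx))) self_mem_nhdsWithin)
  obtain ⟨z, hz, hzV, hzx⟩ := h2.exists
  refine ⟨e.symm z, hzV, fun h => hzx ?_⟩
  rw [Set.mem_singleton_iff, ← h, e.right_inv hz]

end FlowForms

/-! ### Transition functions given by characters -/

section Transition

variable {A S S' S'' : Type*} [Ring A] [HopfAlgebra ℂ A] [CommRing S]
  [Algebra ℂ S] [CommRing S'] [Algebra ℂ S'] [CommRing S''] [Algebra ℂ S'']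

theorem rTensor_twistHom (r : S →ₐ[ℂ] S') (g : A →ₐ[ℂ] S') (q : S' →ₐ[ℂ] S'') (r' : S →ₐ[ℂ] S'')
    (g' : A →ₐ[ℂ] S'') (hr : ∀ s, q (r s) = r' s) (hg : ∀ a, q (g a) = g' a) (z : S ⊗[ℂ] A) :
    q.toLinearMap.rTensor A (twistHom r g z) =
      twistHom (AlgHom.id ℂ S'') g' (r'.toLinearMap.rTensor A z) := by
  induction z with
  | zero => simp
  | add x y hx hy => simp only [map_add, hx, hy]
  | tmul s a =>
    rw [LinearMap.rTensor_tmul, twistHom_tmul, twistHom_tmul]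
    induction Coalgebra.comul (R := ℂ) a with
    | zero => simp
    | add x y hx hy => simp only [map_add, mul_add, hx, hy]
    | tmul x y => simp [hr, hg]

/-- The `S`-linear homomorphism `s ⊗ a ↦ s g(a⁽¹⁾) ⊗ a⁽²⁾`. -/
def transitionHom (g : A →ₐ[ℂ] S) : S ⊗[ℂ] A →ₐ[S] S ⊗[ℂ] A where
  __ := twistHom (AlgHom.id ℂ S) g
  commutes' s := twistHom_tmul_one (AlgHom.id ℂ S) g s

theorem transitionHom_apply (g : A →ₐ[ℂ] S) (z : S ⊗[ℂ] A) :
    transitionHom g z = twistHom (AlgHom.id ℂ S) g z := rfl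

theorem transitionHom_one_tmul (g : A →ₐ[ℂ] S) (a : A) :
    transitionHom g (1 ⊗ₜ a) = g.toLinearMap.rTensor A (Coalgebra.comul a) := by
  rw [transitionHom_apply, twistHom_tmul, map_one, ← Algebra.TensorProduct.one_def, one_mul]

end Transition

/-! ### Compatible ideals are stable under contractions -/

section Stability

variable {A Γ : Type*} [Ring A] [StarRing A] [HopfAlgebra ℂ A] [StarModule ℂ A]
  [AddCommGroup Γ] [Module ℂ Γ] [Module A Γ] [Module Aᵐᵒᵖ Γ] [IsScalarTower ℂ A Γ]
  [IsScalarTower ℂ Aᵐᵒᵖ Γ] [SMulCommClass A Aᵐᵒᵖ Γ] (C : BicovariantCalculus A Γ)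
  {n : ℕ} {N : Type*} [TopologicalSpace N] [ChartedSpace (EuclideanSpace ℝ (Fin n)) N]

theorem map_rTensor_of_comp_eq {V W Q T : Type*} [AddCommGroup V] [Module ℂ V] [AddCommGroup W]
    [Module ℂ W] [AddCommGroup Q] [Module ℂ Q] [AddCommGroup T] [Module ℂ T] {f : W →ₗ[ℂ] Q}
    {g : V →ₗ[ℂ] W} {k : V →ₗ[ℂ] Q} (hk : ∀ v, f (g v) = k v) (i : A →ₗ[ℂ] T) (w : V ⊗[ℂ] A) :
    TensorProduct.map f i (g.rTensor A w) = TensorProduct.map k i w := by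
  induction w with
  | zero => simp
  | add x y hx hy => simp only [map_add, hx, hy]
  | tmul v a => simp [hk]

variable {C} in
-- The condition on δ is the abstract form of d(exp(hX)(a)) = dh exp(hX)(R_X a). It identifies the
-- contraction term of the extension with the term d ⊗ id of the prescribed value on da.
theorem formExtension_comp_form_d {S O : Type*} [CommRing S] [Algebra ℂ S] [Ring O] [Algebra ℂ O]
    {θ : O →ₐ[ℂ] O} [GradedAlgebra (parityPart θ)] {f : S →ₐ[ℂ] O} {g : A →ₐ[ℂ] S} {δ : S →ₗ[ℂ] O}
    (hF : ∀ a, θ (f.comp g a) = f.comp g a) {X : A →ₗ[ℂ] ℂ} {χ : Γ →ₗ[ℂ] A}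
    (hχ : C.IsContraction X χ) {η : O} (hη : θ η = -η) (hηη : η * η = 0)
    (hFη : ∀ a, f.comp g a * η = η * f.comp g a)
    (hδ : ∀ a, δ (g a) = η * f (g (vectorField X a))) (a : A) :
    formExtension C hF χ hχ.map_smul hχ.map_op_smul hη hηη hFη (TensorBundle.form A Γ (C.d a)) =
      toGraded A Γ θ (TensorProduct.map δ (TensorBundle.incl A Γ).toLinearMap
          (g.toLinearMap.rTensor A (Coalgebra.comul a)) +
        TensorProduct.map f.toLinearMap (TensorBundle.form A Γ ∘ₗ C.d)
          (g.toLinearMap.rTensor A (Coalgebra.comul a))) := by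
  have h : ∀ b, δ (g.toLinearMap b) =
      (LinearMap.mulLeft ℂ η ∘ₗ (f.comp g).toLinearMap ∘ₗ vectorField X) b := hδ
  have h' : ∀ b, f.toLinearMap (g.toLinearMap b) = (f.comp g).toLinearMap b := fun _ => rfl
  rw [formExtension_form_d C hF hη hηη hFη hχ, map_rTensor_of_comp_eq h,
    map_rTensor_of_comp_eq h']

/-- The extension to forms of the transition function given by a family of characters. -/
def flowExtension (hA : IsCompactMatrixQuantumGroup A) {X : A →ₗ[ℂ] ℂ} (hX : IsClassicalLie X)
    {h : N → ℝ} (hh : ContMDiff (𝓡 n) 𝓘(ℝ, ℝ) ∞ h) {χ : Γ →ₗ[ℂ] A} (hχ : C.IsContraction X χ) :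
    TensorBundle A Γ →ₐ[ℂ] FormsTensor A Γ n N :=
  formExtension C (F := (formsFn n N).comp (flowChar n hA hX h hh).toAlgHom)
    (fun _ => formsParity_formsFn _) χ hχ.map_smul hχ.map_op_smul
    (formsParity_formsD (realSmooth h hh)) (formsD_mul_self _) (fun _ => formsFn_commute _ _)

theorem isTensorExtension_flowExtension (hA : IsCompactMatrixQuantumGroup A) {X : A →ₗ[ℂ] ℂ}
    (hX : IsClassicalLie X) {h : N → ℝ} (hh : ContMDiff (𝓡 n) 𝓘(ℝ, ℝ) ∞ h) {χ : Γ →ₗ[ℂ] A}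
    (hχ : C.IsContraction X χ) : IsTensorExtension C
      (fun a => transitionHom (flowChar n hA hX h hh).toAlgHom (1 ⊗ₜ a))
      (flowExtension C hA hX hh hχ) where
  map_incl a := by
    have h : flowExtension C hA hX hh hχ (TensorBundle.incl A Γ a) = _ :=
      formExtension_incl C _ _ _ _ a
    rw [h]
    simp only [transitionHom_one_tmul]
    exact congrArg (toFormsTensor A Γ n N) (map_rTensor_of_comp_eq (fun b => rfl) _ _).symm
  map_d a := by
    refine (formExtension_comp_form_d (δ := formsD n N) (fun _ => formsParity_formsFn _) hχ
      (formsParity_formsD (realSmooth h hh)) (formsD_mul_self _) (fun _ => formsFn_commute _ _)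
      (fun b => formsD_flowChar hA hX hh b) a).trans ?_
    simp only [transitionHom_one_tmul]
    rfl

/-- Where h vanishes, the character exp(hX) is ε. Therefore the functional reading off the
coefficient of dh at p takes dh exp(hX)(a) to ε(a), as `contraction_mem_of_formExtension` requires.
-/
theorem contraction_mem_of_flowExtension (hA : IsCompactMatrixQuantumGroup A) {X : A →ₗ[ℂ] ℂ}
    (hX : IsClassicalLie X) {h : N → ℝ} (hh : ContMDiff (𝓡 n) 𝓘(ℝ, ℝ) ∞ h) {χ : Γ →ₗ[ℂ] A}
    (hχ : C.IsContraction X χ) {K : Submodule ℂ (TensorBundle A Γ)}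
    (hK : ∀ x ∈ K, C.tensorCoactL x ∈ LinearMap.range (K.subtype.lTensor A)) (p : N) (hp : h p = 0)
    (hdp : diffAt (realSmooth h hh) p ≠ 0) {x : TensorBundle A Γ} (hx : x ∈ K)
    (hΦ : flowExtension C hA hX hh hχ x ∈ Submodule.map (toFormsTensor A Γ n N).toLinearMap
      (LinearMap.range (K.subtype.lTensor (Forms n N)))) :
    TensorBundle.contraction χ hχ.map_smul hχ.map_op_smul x ∈ K := by
  obtain ⟨l, hl⟩ := exists_functional (realSmooth h hh) p hdp
  refine contraction_mem_of_formExtension C _ _ _ _ hK l (fun a => ?_) hx hΦ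
  refine (hl _).trans ?_
  change expChar X a (h p) = _
  rw [hp, expChar_zero_right]

theorem exists_pi_eq {ι : Type*} {β : ι → Type*} (f : ∀ i, β i) {i j : ι} (hij : i ≠ j) (a : β i)
    (b : β j) : ∃ t : ∀ i, β i, t i = a ∧ t j = b := by
  classical
  exact ⟨Function.update (Function.update f i a) j b, by simp [hij], by simp⟩

open TopologicalSpace (Opens)

variable {M : Type*} [TopologicalSpace M] [ChartedSpace (EuclideanSpace ℝ (Fin n)) M]
  {B : Type*} [Ring B] [StarRing B] [Algebra ℂ B] [StarModule ℂ B]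

/-- A system has one trivialization for each member of its cover, which is why U and V must be
distinct. The cover consists of all open sets admitting a trivialization, with arbitrary choices
elsewhere. -/
theorem exists_trivializationSystem {P : QuantumPrincipalBundle n M A B} (hP : IsLocallyTrivial P)
    {U V : Opens M} (hUV : U ≠ V) {πU : B →⋆ₐ[ℂ] Smooth n U ⊗[ℂ] A}
    (hU : IsLocalTrivialization P U πU) {πV : B →⋆ₐ[ℂ] Smooth n V ⊗[ℂ] A}
    (hV : IsLocalTrivialization P V πV) : ∃ (τ : TrivializationSystem P) (hU' : U ∈ τ.cover)
      (hV' : V ∈ τ.cover), τ.triv ⟨U, hU'⟩ = πU ∧ τ.triv ⟨V, hV'⟩ = πV := by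
  set K : Set (Opens M) := {W | ∃ π : B →⋆ₐ[ℂ] Smooth n W ⊗[ℂ] A, IsLocalTrivialization P W π}
  obtain ⟨t, ht1, ht2⟩ := exists_pi_eq (ι := K)
    (β := fun W => {π : B →⋆ₐ[ℂ] Smooth n (W : Opens M) ⊗[ℂ] A // IsLocalTrivialization P W π})
    (fun W => ⟨W.2.choose, W.2.choose_spec⟩) (i := ⟨U, πU, hU⟩) (j := ⟨V, πV, hV⟩)
    (fun h => hUV (congrArg Subtype.val h)) ⟨πU, hU⟩ ⟨πV, hV⟩
  refine ⟨⟨K, ?_, fun W => (t W).1, fun W => (t W).2⟩, ⟨πU, hU⟩, ⟨πV, hV⟩,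
    congrArg Subtype.val ht1, congrArg Subtype.val ht2⟩
  refine eq_top_iff.2 fun x _ => ?_
  obtain ⟨W, hxW, hW⟩ := hP x
  exact Opens.mem_sSup.2 ⟨W, hW, hxW⟩

theorem isTransitionFunction_twist (hA : IsCompactMatrixQuantumGroup A) {X : A →ₗ[ℂ] ℂ}
    (hX : IsClassicalLie X) {h : M → ℝ} (hh : ContMDiff (𝓡 n) 𝓘(ℝ, ℝ) ∞ h) {U V : Opens M}
    (hUV : U ≤ V) (π : B →⋆ₐ[ℂ] Smooth n V ⊗[ℂ] A) :
    IsTransitionFunction ((QPB.twist hA.comul_star (resStar n hUV)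
      (flowChar n hA hX (fun x : U => h x) (contMDiff_restrict n hh U))).comp π) π
      (transitionHom (flowChar n hA hX (fun x : (U ⊓ V : Opens M) => h x)
        (contMDiff_restrict n hh (U ⊓ V))).toAlgHom) := fun b =>
  (rTensor_twistHom (resLE n hUV) _ (resLE n (inf_le_left : U ⊓ V ≤ U)) _ _
    (fun _ => Subtype.ext (funext fun _ => rfl)) (fun _ => Subtype.ext (funext fun _ => rfl))
    (π b)).symm

theorem contraction_mem_of_isCompatible [IsManifold (𝓡 n) ∞ M] [T2Space M] [CompactSpace M]
    [Nonempty M] (hA : IsCompactMatrixQuantumGroup A) (hn : 0 < n)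
    {P : QuantumPrincipalBundle n M A B} (hP : IsLocallyTrivial P)
    {K : Submodule ℂ (TensorBundle A Γ)}
    (hK : ∀ x ∈ K, C.tensorCoactL x ∈ LinearMap.range (K.subtype.lTensor A))
    (hcompat : IsCompatible C P K) {X : A →ₗ[ℂ] ℂ} (hX : IsClassicalLie X) {χ : Γ →ₗ[ℂ] A}
    (hχ : C.IsContraction X χ) {x : TensorBundle A Γ} (hx : x ∈ K) :
    TensorBundle.contraction χ hχ.map_smul hχ.map_op_smul x ∈ K := by
  obtain ⟨p⟩ := ‹Nonempty M›
  obtain ⟨V, hpV, π, hπ⟩ := hP p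
  obtain ⟨y, hyV, hyp⟩ := exists_ne_mem_opens hn V hpV
  obtain ⟨h, hh, hp0, c, hc⟩ := exists_coordinate p (⟨0, hn⟩ : Fin n)
  -- The twisted trivialization should be compared with π near p, but both cannot sit over the same
  -- open set. Removing a point other than p makes the sets different and keeps p in their
  -- intersection.
  set U : Opens M := V ⊓ ⟨{y}ᶜ, isOpen_compl_singleton⟩ with hU
  have hUV : U ≤ V := inf_le_left
  have hpU : p ∈ U := ⟨hpV, hyp.symm⟩
  have hne : U ≠ V := fun e => by
    rw [← e] at hyV
    exact hyV.2 rfl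
  obtain ⟨τ, hUτ, hVτ, eU, eV⟩ := exists_trivializationSystem hP hne (hπ.twist hA hX hh hUV) hπ
  have hW : U ⊓ V ≠ ⊥ := fun e => by
    have : p ∈ U ⊓ V := ⟨hpU, hpV⟩
    rw [e] at this
    exact this
  have hψ := isTransitionFunction_twist hA hX hh hUV π
  rw [← eU, ← eV] at hψ
  exact contraction_mem_of_flowExtension C hA hX (contMDiff_restrict n hh (U ⊓ V)) hχ hK
    ⟨p, hpU, hpV⟩ hp0 (diffAt_ne_zero_of_coordinate (U ⊓ V) ⟨p, hpU, hpV⟩ _ c _ hc) hx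
    (hcompat τ ⟨U, hUτ⟩ ⟨V, hVτ⟩ hW _ hψ _
      (isTensorExtension_flowExtension C hA hX (contMDiff_restrict n hh (U ⊓ V)) hχ) x hx)

end Stability

end QPB
theorem mainTheorem11
    {A Γ : Type*} [Ring A] [StarRing A] [HopfAlgebra ℂ A] [StarModule ℂ A]
    (hA : QPB.IsCompactMatrixQuantumGroup A)
    [AddCommGroup Γ] [Module ℂ Γ] [Module A Γ] [Module Aᵐᵒᵖ Γ] [IsScalarTower ℂ A Γ]
    [IsScalarTower ℂ Aᵐᵒᵖ Γ] [SMulCommClass A Aᵐᵒᵖ Γ]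
    (C : QPB.BicovariantCalculus A Γ) (hC : C.IsMinimalAdmissible)
    {n : ℕ} (hn : 0 < n)
    {M : Type*} [TopologicalSpace M] [ChartedSpace (EuclideanSpace ℝ (Fin n)) M]
    [IsManifold (𝓡 n) ∞ M] [T2Space M] [CompactSpace M] [Nonempty M]
    {B : Type*} [Ring B] [StarRing B] [Algebra ℂ B] [StarModule ℂ B]
    (P : QPB.QuantumPrincipalBundle n M A B) (hP : QPB.IsLocallyTrivial P)
    (N : Submodule ℂ (QPB.TensorBundle A Γ))
    (hN : C.IsBicovariantGradedIdeal N)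
    (hN0 : N ⊓ QPB.TensorBundle.degree A Γ 0 = ⊥)
    (hN1 : N ⊓ QPB.TensorBundle.degree A Γ 1 = ⊥)
    (hcompat : QPB.IsCompatible C P N) :
    N ≤ C.exteriorIdeal := by
  exact hN.le_exteriorIdeal hC hN0 fun X hX χ hχ x hx =>
    QPB.contraction_mem_of_isCompatible C hA hn hP hN.left_covariant hcompat hX hχ hx
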